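/- Let $b=(b_k)_{k\ge1}\in\ell^2(\mathbb R)$ with $b_k\neq0$ for all $k$ (A1), and let $(\omega_k)_{k\ge1}$ be real numbers with $\omega_1>0$ and $\omega_{k+1}-\omega_k\ge\omega_*>0$ for all $k$ (A2) and $\sup_k\sum_{j\ne k}(\omega_k-\omega_j)^{-2}<\infty$ (A3). Put $H=\ell^2(\mathbb R)\times\ell^2(\mathbb R)$, $X=(\ell^2(\mathbb C))^4$, $\Omega=\mathrm{diag}(\omega_1,\omega_2,\dots)$, $A=\begin{pmatrix}0&\Omega\\-\Omega&0\end{pmatrix}$, $B=\begin{pmatrix}0\\b\end{pmatrix}$, and let $V_{0,1}$ be the space of all $x=(\xi,\eta)\in H$ with $\|x\|_{V_{0,1}}^2=\sum_k(\xi_k^2+\eta_k^2)/|b_k|^2<\infty$. For $\bar x\in H$ and $\bar u\in\mathbb R$, let $(\hat x,\hat u)\in H\times\mathbb R$ be the minimizer of $\|x-\bar x\|_H^2+|u-\bar u|^2$ subject to $Ax+Bu=0$, and let $\hat\Lambda=(\hat\lambda,\hat\mu)\in H$ be its Lagrange multiplier, i.e. $\hat x-\bar x=A^*\hat\Lambda$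 and $\hat u-\bar u=B^*\hat\Lambda$. For $T>0$ and $x^0\in V_{0,1}$, let $(x,u)$ minimize $\int_0^T(\|x(t)-\bar x\|_H^2+|u(t)-\bar u|^2)\,dt$ over all $u\in L^2(0,T)$ and $x\in C([0,T];H)$ with $\dot x=Ax+Bu$ and $x(0)=x^0$, and let $\Lambda=(\lambda,\mu)\in C([0,T];H)$ be the associated adjoint state, i.e. the solution of $\dot\Lambda=A\Lambda+x-\bar x$, $\Lambda(T)=0$. Let $\Delta(t)=(x(t)-\hat x,\ \Lambda(t)-\hat\Lambda)\in X$ be the discrepancy. Then there is a constant $\bar C>0$, depending only on $(\omega_k)$ and $(b_k)$ (in particular not on $T$, $x^0$, $\bar x$, $\bar u$), such that in every such situation $$\|\Delta(0)\|_X+\|\Delta(T)\|_X\le\bar C\left(\|x(0)-\hat x\|_{V_{0,1}}+\|\hat\lambda\|_{\ell^2}+\|\hat\mu\|_{\ell^2}\right).$$ -/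

import Mathlib

open MeasureTheory

noncomputable section

namespace OscTurnpike

/-- The Hilbert space `ℓ²(𝕜)` of square-summable sequences. The modes `1, 2, 3, …` are indexed by
`ℕ = {0, 1, 2, …}`, so that index `k` stands for the mode `k + 1`. -/
abbrev Ell2 (𝕜 : Type) [RCLike 𝕜] : Type := lp (fun _ : ℕ => 𝕜) 2

/-- The real state space `H = ℓ²(ℝ) × ℓ²(ℝ)` of pairs `(ξ, η)`, with its Hilbert norm. -/
abbrev H : Type := WithLp 2 (Ell2 ℝ × Ell2 ℝ)

/-- The complex Hilbert space `X = (ℓ²(ℂ))⁴`. -/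
abbrev X : Type := PiLp 2 (fun _ : Fin 4 => Ell2 ℂ)

/-- The condition `b_k ≠ 0` for all `k`; that `b` lies in `ℓ²(ℝ)` is part of its type. -/
def CondA1 (b : Ell2 ℝ) : Prop := ∀ k, b k ≠ 0

/-- `ω₁ > 0` and `ω_{k+1} - ω_k ≥ ω_* > 0` for all `k`. -/
def CondA2 (ω : ℕ → ℝ) : Prop := 0 < ω 0 ∧ ∃ ωs : ℝ, 0 < ωs ∧ ∀ k, ωs ≤ ω (k + 1) - ω k

/-- `∑_{j ≠ k} 1 / (ω_k - ω_j)²` is finite and bounded uniformly in `k`. -/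
def CondA3 (ω : ℕ → ℝ) : Prop :=
  ∃ C : ℝ, ∀ k, Summable (fun j : {j : ℕ // j ≠ k} => 1 / (ω k - ω j) ^ 2) ∧
    ∑' j : {j : ℕ // j ≠ k}, 1 / (ω k - ω j) ^ 2 ≤ C

/-- The `k`-th term `ω_k^{2p} (ξ_k² + η_k²) / |b_k|^{2q}` of the squared norm of `V_{p,q}`. -/
def vTerm (ω : ℕ → ℝ) (b : Ell2 ℝ) (p q : ℝ) (x : H) (k : ℕ) : ℝ :=
  ω k ^ (2 * p) * ((x.fst k) ^ 2 + (x.snd k) ^ 2) / |b k| ^ (2 * q)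

/-- Membership of an element of `H` in the space `V_{p,q}`. -/
def MemV (ω : ℕ → ℝ) (b : Ell2 ℝ) (p q : ℝ) (x : H) : Prop := Summable (vTerm ω b p q x)

/-- The norm of `V_{p,q}`. -/
def normV (ω : ℕ → ℝ) (b : Ell2 ℝ) (p q : ℝ) (x : H) : ℝ := Real.sqrt (∑' k, vTerm ω b p q x k)

/-- The control vector `B = (0, b)`. -/
def vecB (b : Ell2 ℝ) : H := WithLp.toLp 2 (0, b)

/-- `y ∈ C([0,T]; H)` solves `y'(t) = A y(t) + f(t)` on `[0,T]`, where `A = [[0, Ω], [-Ω, 0]]`,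
`Ω = diag(ω₁, ω₂, …)`: mode by mode and integrated in time, i.e. as an identity in the larger
space `V_{-1,0}`, in which `A y(t)` lies. -/
structure IsSolution (ω : ℕ → ℝ) (T : ℝ) (f : ℝ → H) (y : ℝ → H) : Prop where
  cont : ContinuousOn y (Set.Icc 0 T)
  fst_eq : ∀ k, ∀ t ∈ Set.Icc (0 : ℝ) T,
    (y t).fst k = (y 0).fst k + ∫ s in (0 : ℝ)..t, (ω k * (y s).snd k + (f s).fst k)
  snd_eq : ∀ k, ∀ t ∈ Set.Icc (0 : ℝ) T,
    (y t).snd k = (y 0).snd k + ∫ s in (0 : ℝ)..t, (-(ω k * (y s).fst k) + (f s).snd k)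

/-- Admissible pairs of the dynamic problem: `u ∈ L²(0,T)`, `x' = A x + B u`, `x(0) = x⁰`. -/
structure IsAdmissible (ω : ℕ → ℝ) (b : Ell2 ℝ) (T : ℝ) (x0 : H) (x : ℝ → H) (u : ℝ → ℝ) :
    Prop where
  memLp : MemLp u 2 (volume.restrict (Set.Ioc 0 T))
  sol : IsSolution ω T (fun t => u t • vecB b) x
  init : x 0 = x0

/-- The cost `J_d(x, u) = ∫₀ᵀ (‖x(t) - x̄‖²_H + |u(t) - ū|²) dt`. -/
def dynCost (T : ℝ) (xbar : H) (ubar : ℝ) (x : ℝ → H) (u : ℝ → ℝ) : ℝ :=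
  ∫ t in (0 : ℝ)..T, (‖x t - xbar‖ ^ 2 + |u t - ubar| ^ 2)

/-- `(x, Λ, u)` is a solution of the dynamic problem: `(x, u)` minimizes the cost among the
admissible pairs, and `Λ` is the associated adjoint state, i.e. the solution of
`Λ' = A Λ + x - x̄`, `Λ(T) = 0`. -/
structure IsDynamicSolution (ω : ℕ → ℝ) (b : Ell2 ℝ) (T : ℝ) (x0 xbar : H) (ubar : ℝ)
    (x Λ : ℝ → H) (u : ℝ → ℝ) : Prop where
  admissible : IsAdmissible ω b T x0 x u
  minimal : ∀ (x' : ℝ → H) (u' : ℝ → ℝ), IsAdmissible ω b T x0 x' u' →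
    dynCost T xbar ubar x u ≤ dynCost T xbar ubar x' u'
  adjoint : IsSolution ω T (fun t => x t - xbar) Λ
  terminal : Λ T = 0

/-- The constraint `A x + B u = 0` of the static problem, an identity in `V_{-1,0}`. -/
def StaticConstraint (ω : ℕ → ℝ) (b : Ell2 ℝ) (x : H) (u : ℝ) : Prop :=
  ∀ k, ω k * x.snd k = 0 ∧ -(ω k * x.fst k) + b k * u = 0

/-- The cost `J_s(x, u) = ‖x - x̄‖²_H + |u - ū|²`. -/
def staticCost (xbar : H) (ubar : ℝ) (x : H) (u : ℝ) : ℝ := ‖x - xbar‖ ^ 2 + |u - ubar| ^ 2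

/-- `(x̂, û)` minimizes the static cost under the static constraint, and `Λ̂ = (λ̂, μ̂) ∈ H` is the
associated Lagrange multiplier: the derivative of
`½ J_s(x, u) - ∑ (λ̂_k ω_k η_k + μ̂_k (-ω_k ξ_k + b_k u))` with respect to each `ξ_k`, each `η_k`
and `u` vanishes at `(x̂, û)`, i.e. `x̂ - x̄ = A* Λ̂` and `û - ū = B* Λ̂`. -/
structure IsStaticSolution (ω : ℕ → ℝ) (b : Ell2 ℝ) (xbar : H) (ubar : ℝ)
    (xhat Lhat : H) (uhat : ℝ) : Prop where
  feasible : StaticConstraint ω b xhat uhat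
  minimal : ∀ (x : H) (u : ℝ), StaticConstraint ω b x u →
    staticCost xbar ubar xhat uhat ≤ staticCost xbar ubar x u
  stat_fst : ∀ k, xhat.fst k - xbar.fst k = -(ω k * Lhat.snd k)
  stat_snd : ∀ k, xhat.snd k - xbar.snd k = ω k * Lhat.fst k
  stat_control : uhat - ubar = inner ℝ (vecB b) Lhat

/-- A real square-summable sequence, seen as a complex one. -/
def toComplex (a : Ell2 ℝ) : Ell2 ℂ :=
  ⟨fun k => (a k : ℂ), (memℓp_gen_iff (by norm_num)).2 (by
    simpa using (memℓp_gen_iff (p := 2) (by norm_num)).1 (lp.memℓp a))⟩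

/-- The discrepancy `Δ(t) = (ξ(t) - ξ̂, η(t) - η̂, λ(t) - λ̂, μ(t) - μ̂) ∈ X`. -/
def discrepancy (x Λ : ℝ → H) (xhat Lhat : H) (t : ℝ) : X :=
  WithLp.toLp 2 ![toComplex (x t - xhat).fst, toComplex (x t - xhat).snd,
    toComplex (Λ t - Lhat).fst, toComplex (Λ t - Lhat).snd]

end OscTurnpike

end

/-! In an eigenbasis of the skew operator $A$ the discrepancy becomes a family of modes: $p_n$ for
the state, $q_n$ for the adjoint, with frequencies $\nu_n=\pm\omega_k$ and coefficients
$\beta_n=b_k/\sqrt2$. The optimality conditions read $p_n'=i\nu_np_n+\beta_nv$,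
$q_n'=i\nu_nq_n+p_n$, $v=\sum_n\beta_nq_n$ (`modalSystem_discrepancy`); the feedback comes from
$u-\bar u=B^*\Lambda$ (`IsDynamicSolution.control_eq`). The data are $p(0)/\beta$, measured by the
$V_{0,1}$ norm, and $q(T)=-\hat\Lambda$. What has to be bounded independently of $T$ is $p(T)$ and
$q(0)$; this is `exists_modal_bound`.

Energy: $\frac{d}{dt}\mathrm{Re}\sum\bar p_nq_n=\|p\|^2+|v|^2$, so the energy
$E=\int_0^T(\|p\|^2+|v|^2)$ is a difference of boundary terms. These pair the data with $p(T)$ and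
$\beta q(0)$ only. Both are controlled by $E$ and the data: $p(T)$ by averaging over a final
interval, $\beta q(0)$ by Ingham's inequality on an initial interval (`sum_sq_mul_q_left_le`).
Young's inequality then absorbs $E$ (`energy_le_of_boundary`).

Since $\beta_n\to0$, this does not bound $q(0)$ itself. For each $n$ the corrector $G_n=\sum_{m\ne
n}\beta_m\big(\frac{-iq_m}{\nu_m-\nu_n}+\frac{p_m}{(\nu_m-\nu_n)^2}\big)$ satisfies
$G_n'=i\nu_nG_n+\gamma_nv-\beta_nq_n$ with $\gamma_n\ge1$. Hence $Z_n=\gamma_np_n/\beta_n-G_n$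
satisfies $Z_n'=i\nu_nZ_n+\beta_nq_n$: each mode is decoupled from the others up to $G_n$. A
quadratic functional of $(Z_n,q_n)$ bounds $|q_n(0)|^2$ by the data, $|G_n(0)|^2$ and $\int|G_n|^2$,
with no loss as $\beta_n\to0$ (`mode_bound`). Finally Hilbert's inequality for separated frequencies
bounds $\sum_n|G_n|^2$ by $\sum\beta_n^2|q_n|^2+\|p\|^2$, and observability on blocks of bounded
length bounds the time integral by $E$ (`integral_corrector_le`). -/

namespace OscTurnpike

open scoped ComplexConjugate

/-! ### Exponential sums: inequalities of Ingham and Hilbert. -/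

section ExponentialSums

variable {ι : Type*} {ν : ι → ℝ} {K : ℝ}

/-- The exponential sum with coefficients `c` and frequencies `ν` over a finite set of modes. -/
noncomputable def expSum (ν : ι → ℝ) (s : Finset ι) (c : ι → ℂ) (t : ℝ) : ℂ :=
  ∑ n ∈ s, c n * Complex.exp (ν n * t * Complex.I)

theorem continuous_expSum (s : Finset ι) (c : ι → ℂ) : Continuous (expSum ν s c) := by
  unfold expSum; fun_prop

theorem integral_weight_expSum_mul_conj (w : ℝ → ℝ) (hw : Continuous w) (a b : ℝ) (s : Finset ι)
    (c d : ι → ℂ) :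
    ∫ t in a..b, (w t : ℂ) * (expSum ν s c t * conj (expSum ν s d t)) =
      ∑ m ∈ s, ∑ n ∈ s, c m * conj (d n) *
        ∫ t in a..b, (w t : ℂ) * Complex.exp ((ν m - ν n : ℝ) * t * Complex.I) := by
  have h : ∀ t : ℝ, (w t : ℂ) * (expSum ν s c t * conj (expSum ν s d t)) =
      ∑ m ∈ s, ∑ n ∈ s, c m * conj (d n) *
        ((w t : ℂ) * Complex.exp ((ν m - ν n : ℝ) * t * Complex.I)) := by
    intro t
    rw [expSum, expSum, map_sum, Finset.sum_mul_sum]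
    simp only [Finset.mul_sum]
    refine Finset.sum_congr rfl fun m _ => Finset.sum_congr rfl fun n _ => ?_
    have : ((ν m - ν n : ℝ) : ℂ) * t * Complex.I
        = ν m * t * Complex.I + conj (ν n * t * Complex.I) := by
      simp only [map_mul, Complex.conj_ofReal, Complex.conj_I]; push_cast; ring
    rw [this, Complex.exp_add, map_mul, ← Complex.exp_conj]
    ring
  simp_rw [h]
  rw [intervalIntegral.integral_finsetSum]
  · refine Finset.sum_congr rfl fun m _ => ?_
    rw [intervalIntegral.integral_finsetSum]
    · simp_rw [intervalIntegral.integral_const_mul]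
    · intro n _
      exact Continuous.intervalIntegrable (by fun_prop) _ _
  · intro m _
    exact Continuous.intervalIntegrable (by fun_prop) _ _

/-- Schur test: a kernel of size `1 / (ν m - ν n) ^ 2` off the diagonal. -/
theorem norm_form_sub_diag_le (hK : ∀ n (s : Finset ι), ∑ m ∈ s, 1 / (ν m - ν n) ^ 2 ≤ K)
    {M : ℝ} (hM : 0 ≤ M) (J : ι → ι → ℂ) (hJ : ∀ m n, m ≠ n → ‖J m n‖ ≤ M * (1 / (ν m - ν n) ^ 2))
    (s : Finset ι) (c d : ι → ℂ) :
    ‖∑ m ∈ s, ∑ n ∈ s, c m * conj (d n) * J m n - ∑ n ∈ s, c n * conj (d n) * J n n‖ ≤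
      M * K / 2 * (∑ n ∈ s, ‖c n‖ ^ 2 + ∑ n ∈ s, ‖d n‖ ^ 2) := by
  classical
  have h1 : ∑ m ∈ s, ∑ n ∈ s, c m * conj (d n) * J m n - ∑ n ∈ s, c n * conj (d n) * J n n =
      ∑ m ∈ s, ∑ n ∈ s, if m = n then 0 else c m * conj (d n) * J m n := by
    rw [← Finset.sum_sub_distrib]
    refine Finset.sum_congr rfl fun m hm => ?_
    rw [sub_eq_iff_eq_add, ← Finset.add_sum_erase s _ hm,
      ← Finset.add_sum_erase s (fun n => if m = n then _ else _) hm]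
    simp only [if_true, zero_add]
    rw [add_comm]
    congr 1
    refine Finset.sum_congr rfl fun n hn => ?_
    rw [if_neg (Finset.ne_of_mem_erase hn).symm]
  have h2 : ∀ m n, ‖if m = n then (0 : ℂ) else c m * conj (d n) * J m n‖ ≤
      M / 2 * (‖c m‖ ^ 2 * (1 / (ν n - ν m) ^ 2) + ‖d n‖ ^ 2 * (1 / (ν m - ν n) ^ 2)) := by
    intro m n
    split_ifs with h
    · rw [norm_zero]; positivity
    · rw [norm_mul, norm_mul, RCLike.norm_conj]
      have hsym : 1 / (ν n - ν m) ^ 2 = 1 / (ν m - ν n) ^ 2 := by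
        rw [← neg_sub, neg_sq]
      have h4 : ‖c m‖ * ‖d n‖ ≤ (‖c m‖ ^ 2 + ‖d n‖ ^ 2) / 2 := by
        nlinarith [sq_nonneg (‖c m‖ - ‖d n‖)]
      calc ‖c m‖ * ‖d n‖ * ‖J m n‖
          ≤ (‖c m‖ ^ 2 + ‖d n‖ ^ 2) / 2 * (M * (1 / (ν m - ν n) ^ 2)) := by
            gcongr; exact hJ m n h
        _ = _ := by rw [hsym]; ring
  rw [h1]
  calc _ ≤ ∑ m ∈ s, ∑ n ∈ s, ‖if m = n then (0 : ℂ) else c m * conj (d n) * J m n‖ :=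
        (norm_sum_le _ _).trans (Finset.sum_le_sum fun m _ => norm_sum_le _ _)
    _ ≤ ∑ m ∈ s, ∑ n ∈ s,
        M / 2 * (‖c m‖ ^ 2 * (1 / (ν n - ν m) ^ 2) + ‖d n‖ ^ 2 * (1 / (ν m - ν n) ^ 2)) :=
        Finset.sum_le_sum fun m _ => Finset.sum_le_sum fun n _ => h2 m n
    _ = M / 2 * (∑ m ∈ s, ‖c m‖ ^ 2 * ∑ n ∈ s, 1 / (ν n - ν m) ^ 2 +
          ∑ n ∈ s, ‖d n‖ ^ 2 * ∑ m ∈ s, 1 / (ν m - ν n) ^ 2) := by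
        simp_rw [← Finset.mul_sum, Finset.sum_add_distrib]
        rw [Finset.sum_comm (f := fun m n => ‖d n‖ ^ 2 * (1 / (ν m - ν n) ^ 2))]
        simp_rw [← Finset.mul_sum]
    _ ≤ M / 2 * (∑ m ∈ s, ‖c m‖ ^ 2 * K + ∑ n ∈ s, ‖d n‖ ^ 2 * K) := by
        gcongr with m _ n _
        · exact hK m s
        · exact hK n s
    _ = _ := by rw [← Finset.sum_mul, ← Finset.sum_mul]; ring

/-- A weight on `[a, b]` that vanishes to second order at both ends. -/
noncomputable def bump (a b t : ℝ) : ℝ := (t - a) ^ 2 * (b - t) ^ 2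

theorem continuous_bump (a b : ℝ) : Continuous (bump a b) := by unfold bump; fun_prop

theorem integral_bump (a b : ℝ) : ∫ t in a..b, bump a b t = (b - a) ^ 5 / 30 := by
  have h : ∀ t, HasDerivAt (fun t : ℝ => (b - a) ^ 2 * (t - a) ^ 3 / 3 - (b - a) * (t - a) ^ 4 / 2
      + (t - a) ^ 5 / 5) (bump a b t) t := by
    intro t
    have h1 : HasDerivAt (fun t : ℝ => t - a) 1 t := (hasDerivAt_id t).sub_const a
    convert! ((((h1.pow 3).const_mul ((b - a) ^ 2)).div_const 3).sub
      (((h1.pow 4).const_mul (b - a)).div_const 2)).add ((h1.pow 5).div_const 5) using 1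
    unfold bump; push_cast; ring
  rw [intervalIntegral.integral_eq_sub_of_hasDerivAt (fun t _ => h t)
    ((continuous_bump a b).intervalIntegrable _ _)]
  ring

/-- Two integrations by parts: the weight and its first derivative vanish at both ends, so only the
second derivative, of size at most `2 * (b - a) ^ 2`, remains, divided by `x ^ 2`. -/
theorem norm_integral_bump_exp_le {a b x : ℝ} (hab : a ≤ b) (hx : x ≠ 0) :
    ‖∫ t in a..b, (bump a b t : ℂ) * Complex.exp (x * t * Complex.I)‖ ≤
      2 * (b - a) ^ 3 * (1 / x ^ 2) := by
  set w2 : ℝ → ℝ := fun t => 2 * ((b - t) ^ 2 - 4 * (t - a) * (b - t) + (t - a) ^ 2) with hw2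
  set w1 : ℝ → ℝ := fun t => 2 * (t - a) * (b - t) ^ 2 - 2 * (t - a) ^ 2 * (b - t) with hw1
  have hxc : (x : ℂ) ≠ 0 := by exact_mod_cast hx
  have d0 : ∀ t, HasDerivAt (bump a b) (w1 t) t := by
    intro t
    have h1 : HasDerivAt (fun t : ℝ => t - a) 1 t := (hasDerivAt_id t).sub_const a
    have h2 : HasDerivAt (fun t : ℝ => b - t) (-1) t := (hasDerivAt_id t).const_sub b
    convert! (h1.pow 2).mul (h2.pow 2) using 1
    simp only [hw1, Pi.pow_apply]; push_cast; ring
  have d1 : ∀ t, HasDerivAt w1 (w2 t) t := by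
    intro t
    have h1 : HasDerivAt (fun t : ℝ => t - a) 1 t := (hasDerivAt_id t).sub_const a
    have h2 : HasDerivAt (fun t : ℝ => b - t) (-1) t := (hasDerivAt_id t).const_sub b
    convert! ((h1.const_mul 2).mul (h2.pow 2)).sub (((h1.pow 2).const_mul 2).mul h2) using 1
    simp only [hw2, Pi.pow_apply]; push_cast; ring
  have he : ∀ t : ℝ, HasDerivAt (fun t : ℝ => Complex.exp (x * t * Complex.I))
      (Complex.exp (x * t * Complex.I) * (x * Complex.I)) t := by
    intro t
    have := (((Complex.ofRealCLM.hasDerivAt (x := t)).const_mul (x : ℂ)).mul_const Complex.I).cexp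
    simpa using this
  have hF : ∀ t : ℝ, HasDerivAt (fun t : ℝ => Complex.exp (x * t * Complex.I) *
      (-Complex.I * (bump a b t : ℂ) / x + (w1 t : ℂ) / x ^ 2))
      ((bump a b t : ℂ) * Complex.exp (x * t * Complex.I) +
        (w2 t : ℂ) / x ^ 2 * Complex.exp (x * t * Complex.I)) t := by
    intro t
    have h := (he t).mul (((((d0 t).ofReal_comp).const_mul (-Complex.I)).div_const (x : ℂ)).add
      (((d1 t).ofReal_comp).div_const ((x : ℂ) ^ 2)))
    convert! h using 1
    simp only [Pi.add_apply]
    field_simp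
    ring_nf
    simp only [Complex.I_sq]
    ring
  have c0 : Continuous fun t : ℝ => (bump a b t : ℂ) * Complex.exp (x * t * Complex.I) := by
    have := continuous_bump a b; fun_prop
  have c2 : Continuous fun t : ℝ => (w2 t : ℂ) / x ^ 2 * Complex.exp (x * t * Complex.I) := by
    simp only [hw2]; fun_prop
  have hint := intervalIntegral.integral_eq_sub_of_hasDerivAt (a := a) (b := b) (fun t _ => hF t)
    ((c0.add c2).intervalIntegrable _ _)
  rw [intervalIntegral.integral_add (c0.intervalIntegrable _ _) (c2.intervalIntegrable _ _)] at hint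
  have hz : ∫ t in a..b, (bump a b t : ℂ) * Complex.exp (x * t * Complex.I) =
      -∫ t in a..b, (w2 t : ℂ) / x ^ 2 * Complex.exp (x * t * Complex.I) := by
    rw [eq_neg_iff_add_eq_zero, hint]
    simp [bump, hw1]
  rw [hz, norm_neg]
  have hb : ∀ t ∈ Set.uIoc a b, ‖(w2 t : ℂ) / x ^ 2 * Complex.exp (x * t * Complex.I)‖ ≤
      2 * (b - a) ^ 2 * (1 / x ^ 2) := by
    intro t ht
    rw [Set.uIoc_of_le hab] at ht
    have : Complex.exp (x * t * Complex.I) = Complex.exp ((x * t : ℝ) * Complex.I) := by push_cast; rfl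
    rw [norm_mul, this, Complex.norm_exp_ofReal_mul_I, mul_one, norm_div, Complex.norm_real, norm_pow,
      Complex.norm_real, Real.norm_eq_abs, Real.norm_eq_abs, sq_abs, div_eq_mul_one_div]
    gcongr
    rw [abs_le]
    have h1 := ht.1; have h2 := ht.2
    constructor
    · nlinarith [sq_nonneg (b + a - 2 * t), sq_nonneg (b - a)]
    · nlinarith [mul_nonneg (sub_nonneg.2 h1.le) (sub_nonneg.2 h2)]
  refine (intervalIntegral.norm_integral_le_of_norm_le_const hb).trans (le_of_eq ?_)
  rw [abs_of_nonneg (sub_nonneg.2 hab)]; ring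

theorem mul_conj_self_eq (z : ℂ) : z * conj z = ((‖z‖ ^ 2 : ℝ) : ℂ) := by
  rw [Complex.mul_conj, Complex.normSq_eq_norm_sq]

/-- The diagonal carries the mass of the bump; the rest falls under the Schur test. The convention
`1 / 0 = 0` makes the diagonal term of the sums in `hK` harmless. -/
theorem abs_integral_bump_expSum_sub_le
    (hK : ∀ n (s : Finset ι), ∑ m ∈ s, 1 / (ν m - ν n) ^ 2 ≤ K) (hν : Function.Injective ν)
    {a b : ℝ} (hab : a ≤ b) (s : Finset ι) (c : ι → ℂ) :
    |(∫ t in a..b, bump a b t * ‖expSum ν s c t‖ ^ 2) - (b - a) ^ 5 / 30 * ∑ n ∈ s, ‖c n‖ ^ 2| ≤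
      2 * (b - a) ^ 3 * K * ∑ n ∈ s, ‖c n‖ ^ 2 := by
  have h := norm_form_sub_diag_le hK (M := 2 * (b - a) ^ 3)
    (by have := sub_nonneg.2 hab; positivity)
    (fun m n => ∫ t in a..b, (bump a b t : ℂ) * Complex.exp ((ν m - ν n : ℝ) * t * Complex.I))
    (fun m n hmn => norm_integral_bump_exp_le hab (sub_ne_zero.2 (hν.ne hmn))) s c c
  rw [← integral_weight_expSum_mul_conj _ (continuous_bump a b)] at h
  have h1 : ∫ t in a..b, (bump a b t : ℂ) * (expSum ν s c t * conj (expSum ν s c t)) =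
      ((∫ t in a..b, bump a b t * ‖expSum ν s c t‖ ^ 2 : ℝ) : ℂ) := by
    rw [← intervalIntegral.integral_ofReal]
    refine intervalIntegral.integral_congr fun t _ => ?_
    simp only [mul_conj_self_eq, Complex.ofReal_mul]
  have h2 : ∑ n ∈ s, c n * conj (c n) *
      ∫ t in a..b, (bump a b t : ℂ) * Complex.exp ((ν n - ν n : ℝ) * t * Complex.I) =
      (((b - a) ^ 5 / 30 * ∑ n ∈ s, ‖c n‖ ^ 2 : ℝ) : ℂ) := by
    rw [mul_comm ((b - a) ^ 5 / 30), Finset.sum_mul, Complex.ofReal_sum]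
    refine Finset.sum_congr rfl fun n _ => ?_
    rw [mul_conj_self_eq, Complex.ofReal_mul, ← integral_bump, ← intervalIntegral.integral_ofReal]
    simp
  rw [h1, h2, ← Complex.ofReal_sub, Complex.norm_real, Real.norm_eq_abs] at h
  refine h.trans (le_of_eq ?_)
  ring

/-- Ingham's lower bound. The condition `120 * K ≤ (b - a) ^ 2` makes the off-diagonal part at most
half of the diagonal one, and the bump never exceeds `(b - a) ^ 4 / 16`. -/
theorem sum_sq_le_integral_expSum
    (hK : ∀ n (s : Finset ι), ∑ m ∈ s, 1 / (ν m - ν n) ^ 2 ≤ K) (hν : Function.Injective ν)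
    {a b : ℝ} (hab : a < b) (hL : 120 * K ≤ (b - a) ^ 2) (s : Finset ι) (c : ι → ℂ) :
    ∑ n ∈ s, ‖c n‖ ^ 2 ≤ 4 / (b - a) * ∫ t in a..b, ‖expSum ν s c t‖ ^ 2 := by
  have hpos := sub_pos.2 hab
  have h := (abs_le.1 (abs_integral_bump_expSum_sub_le hK hν hab.le s c)).1
  have hc := continuous_expSum (ν := ν) s c
  have hb := continuous_bump a b
  have h1 : ∫ t in a..b, bump a b t * ‖expSum ν s c t‖ ^ 2 ≤
      ∫ t in a..b, (b - a) ^ 4 / 16 * ‖expSum ν s c t‖ ^ 2 := by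
    refine intervalIntegral.integral_mono_on hab.le (Continuous.intervalIntegrable (by fun_prop) _ _)
      (Continuous.intervalIntegrable (by fun_prop) _ _) fun t ht => ?_
    gcongr
    have h2 : (t - a) * (b - t) ≤ (b - a) ^ 2 / 4 := by nlinarith [sq_nonneg (b + a - 2 * t)]
    have h3 : 0 ≤ (t - a) * (b - t) := mul_nonneg (sub_nonneg.2 ht.1) (sub_nonneg.2 ht.2)
    calc bump a b t = ((t - a) * (b - t)) ^ 2 := by unfold bump; ring
      _ ≤ ((b - a) ^ 2 / 4) ^ 2 := by gcongr
      _ = _ := by ring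
  rw [intervalIntegral.integral_const_mul] at h1
  set S := ∑ n ∈ s, ‖c n‖ ^ 2
  set F := ∫ t in a..b, ‖expSum ν s c t‖ ^ 2
  have hS : 0 ≤ S := by positivity
  have h5 : 2 * (b - a) ^ 3 * K * S ≤ (b - a) ^ 5 / 60 * S := by
    have : 2 * (b - a) ^ 3 * K ≤ (b - a) ^ 5 / 60 := by
      have := mul_le_mul_of_nonneg_left hL (pow_pos hpos 3).le
      nlinarith
    gcongr
  have h6 : (b - a) ^ 4 * ((b - a) * S) ≤ (b - a) ^ 4 * (4 * F) := by
    have hF : 0 ≤ F := intervalIntegral.integral_nonneg hab.le fun t _ => by positivity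
    nlinarith [mul_nonneg (pow_pos hpos 4).le hF]
  have h7 := le_of_mul_le_mul_left h6 (pow_pos hpos 4)
  rw [div_mul_eq_mul_div, le_div_iff₀ hpos]
  linarith

/-- The bump on `[-1, 2]` is at least `1` on `[0, 1]`, and its mass is `3 ^ 5 / 30 ≤ 9`. -/
theorem integral_expSum_le
    (hK : ∀ n (s : Finset ι), ∑ m ∈ s, 1 / (ν m - ν n) ^ 2 ≤ K) (hν : Function.Injective ν)
    (s : Finset ι) (c : ι → ℂ) :
    ∫ t in (0 : ℝ)..1, ‖expSum ν s c t‖ ^ 2 ≤ (9 + 54 * K) * ∑ n ∈ s, ‖c n‖ ^ 2 := by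
  have h := (abs_le.1 (abs_integral_bump_expSum_sub_le hK hν (a := -1) (b := 2) (by norm_num) s c)).2
  have hc := continuous_expSum (ν := ν) s c
  have hb := continuous_bump (-1) 2
  have h1 : ∫ t in (0 : ℝ)..1, ‖expSum ν s c t‖ ^ 2 ≤
      ∫ t in (0 : ℝ)..1, bump (-1) 2 t * ‖expSum ν s c t‖ ^ 2 := by
    refine intervalIntegral.integral_mono_on zero_le_one
      (Continuous.intervalIntegrable (by fun_prop) _ _)
      (Continuous.intervalIntegrable (by fun_prop) _ _) fun t ht => ?_
    refine le_mul_of_one_le_left (by positivity) ?_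
    have h2 : 1 ≤ (t - -1) * (2 - t) := by nlinarith [ht.1, ht.2]
    calc (1 : ℝ) ≤ ((t - -1) * (2 - t)) ^ 2 := one_le_pow₀ h2
      _ = _ := by unfold bump; ring
  have h3 : ∫ t in (0 : ℝ)..1, bump (-1) 2 t * ‖expSum ν s c t‖ ^ 2 ≤
      ∫ t in (-1 : ℝ)..2, bump (-1) 2 t * ‖expSum ν s c t‖ ^ 2 := by
    refine intervalIntegral.integral_mono_interval (by norm_num) zero_le_one (by norm_num)
      (Filter.Eventually.of_forall fun t => ?_) (Continuous.intervalIntegrable (by fun_prop) _ _)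
    simp only [bump, Pi.zero_apply]; positivity
  have hS : 0 ≤ ∑ n ∈ s, ‖c n‖ ^ 2 := by positivity
  nlinarith

/-- The ramp does not vanish at `0`, so a first-order term `I / x` survives. Thus the kernel `1 / (ν
m - ν n)` is an integral of exponentials up to a remainder of order `1 / x ^ 2`, and Hilbert's
inequality follows from the upper bound for exponential sums and the Schur test. -/
theorem integral_ramp_exp {x : ℝ} (hx : x ≠ 0) :
    ∫ t in (0 : ℝ)..1, ((1 - t : ℝ) : ℂ) * Complex.exp (x * t * Complex.I) =
      Complex.I / x + (1 - Complex.exp (x * Complex.I)) / x ^ 2 := by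
  have hxc : (x : ℂ) ≠ 0 := by exact_mod_cast hx
  have hF : ∀ t : ℝ, HasDerivAt (fun t : ℝ => Complex.exp (x * t * Complex.I) *
      (-Complex.I * ((1 - t : ℝ) : ℂ) / x - 1 / x ^ 2))
      (((1 - t : ℝ) : ℂ) * Complex.exp (x * t * Complex.I)) t := by
    intro t
    have he := (((Complex.ofRealCLM.hasDerivAt (x := t)).const_mul (x : ℂ)).mul_const
      Complex.I).cexp
    have h1 : HasDerivAt (fun t : ℝ => 1 - t) (-1) t := (hasDerivAt_id t).const_sub 1
    have h := he.mul (((h1.ofReal_comp.const_mul (-Complex.I)).div_const (x : ℂ)).sub_const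
      (1 / (x : ℂ) ^ 2))
    convert! h using 1
    simp only [Complex.ofRealCLM_apply]
    push_cast
    field_simp
    ring_nf
    simp only [Complex.I_sq]
    ring
  rw [intervalIntegral.integral_eq_sub_of_hasDerivAt (fun t _ => hF t)
    (Continuous.intervalIntegrable (by fun_prop) _ _)]
  simp
  field_simp
  ring

/-- The bilinear form with kernel `1 / (ν m - ν n)` is bounded. -/
theorem norm_hilbert_form_le
    (hK : ∀ n (s : Finset ι), ∑ m ∈ s, 1 / (ν m - ν n) ^ 2 ≤ K)
    (hν : Function.Injective ν) (s : Finset ι) (c d : ι → ℂ) :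
    ‖∑ m ∈ s, ∑ n ∈ s, c m * conj (d n) * ((1 / (ν m - ν n) : ℝ) : ℂ)‖ ≤
      (5 + 28 * K) * (∑ n ∈ s, ‖c n‖ ^ 2 + ∑ n ∈ s, ‖d n‖ ^ 2) := by
  set R : ι → ι → ℂ := fun m n => ∫ t in (0 : ℝ)..1,
    ((1 - t : ℝ) : ℂ) * Complex.exp ((ν m - ν n : ℝ) * t * Complex.I) with hR
  set J : ι → ι → ℂ := fun m n => R m n - Complex.I * ((1 / (ν m - ν n) : ℝ) : ℂ) with hJ
  -- On the diagonal `1 / 0 = 0`, so only the area of the ramp is left.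
  have hRd : ∀ n, J n n = 1 / 2 := by
    intro n
    have : ∀ t : ℝ, HasDerivAt (fun t : ℝ => t - t ^ 2 / 2) (1 - t) t := by
      intro t
      convert! (hasDerivAt_id t).sub (((hasDerivAt_id t).pow 2).div_const 2) using 1
      simp
    have h2 := intervalIntegral.integral_eq_sub_of_hasDerivAt (a := 0) (b := 1) (fun t _ => this t)
      (Continuous.intervalIntegrable (by fun_prop) _ _)
    simp only [hJ, hR, sub_self, Complex.ofReal_zero, zero_mul, Complex.exp_zero, mul_one, div_zero,
      mul_zero, sub_zero]
    rw [intervalIntegral.integral_ofReal, h2]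
    norm_num
  have hJb : ∀ m n, m ≠ n → ‖J m n‖ ≤ 2 * (1 / (ν m - ν n) ^ 2) := by
    intro m n hmn
    have hx : ν m - ν n ≠ 0 := sub_ne_zero.2 (hν.ne hmn)
    simp only [hJ, hR]
    rw [integral_ramp_exp hx]
    have : Complex.I / ((ν m - ν n : ℝ) : ℂ) +
        (1 - Complex.exp ((ν m - ν n : ℝ) * Complex.I)) / ((ν m - ν n : ℝ) : ℂ) ^ 2 -
        Complex.I * ((1 / (ν m - ν n) : ℝ) : ℂ) =
        (1 - Complex.exp ((ν m - ν n : ℝ) * Complex.I)) / ((ν m - ν n : ℝ) : ℂ) ^ 2 := by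
      push_cast; ring
    rw [this, norm_div, norm_pow, Complex.norm_real, Real.norm_eq_abs, sq_abs, div_eq_mul_one_div]
    gcongr
    refine (norm_sub_le _ _).trans ?_
    rw [Complex.norm_exp_ofReal_mul_I]; norm_num
  have h := norm_form_sub_diag_le hK (by norm_num) J hJb s c d
  set S := ∑ n ∈ s, ‖c n‖ ^ 2 with hS
  set S' := ∑ n ∈ s, ‖d n‖ ^ 2 with hS'
  have hw : Continuous fun t : ℝ => 1 - t := by fun_prop
  have hsplit : ∑ m ∈ s, ∑ n ∈ s, c m * conj (d n) * J m n =
      (∫ t in (0 : ℝ)..1, ((1 - t : ℝ) : ℂ) * (expSum ν s c t * conj (expSum ν s d t))) -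
      Complex.I * ∑ m ∈ s, ∑ n ∈ s, c m * conj (d n) * ((1 / (ν m - ν n) : ℝ) : ℂ) := by
    rw [integral_weight_expSum_mul_conj _ hw, Finset.mul_sum, ← Finset.sum_sub_distrib]
    refine Finset.sum_congr rfl fun m _ => ?_
    rw [Finset.mul_sum, ← Finset.sum_sub_distrib]
    refine Finset.sum_congr rfl fun n _ => ?_
    simp only [hJ, hR]; ring
  have hdiag : ‖∑ n ∈ s, c n * conj (d n) * J n n‖ ≤ 1 / 4 * (S + S') := by
    refine (norm_sum_le _ _).trans ?_
    rw [hS, hS', ← Finset.sum_add_distrib, Finset.mul_sum]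
    refine Finset.sum_le_sum fun n _ => ?_
    rw [hRd, norm_mul, norm_mul, RCLike.norm_conj]
    norm_num
    nlinarith [sq_nonneg (‖c n‖ - ‖d n‖)]
  have hcc := continuous_expSum (ν := ν) s c
  have hcd := continuous_expSum (ν := ν) s d
  have hint : ‖∫ t in (0 : ℝ)..1, ((1 - t : ℝ) : ℂ) * (expSum ν s c t * conj (expSum ν s d t))‖ ≤
      (9 + 54 * K) / 2 * (S + S') := by
    calc _ ≤ ∫ t in (0 : ℝ)..1, ‖((1 - t : ℝ) : ℂ) * (expSum ν s c t * conj (expSum ν s d t))‖ :=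
          intervalIntegral.norm_integral_le_integral_norm zero_le_one
      _ ≤ ∫ t in (0 : ℝ)..1, (1 / 2 * ‖expSum ν s c t‖ ^ 2 + 1 / 2 * ‖expSum ν s d t‖ ^ 2) := by
          refine intervalIntegral.integral_mono_on zero_le_one
            (Continuous.intervalIntegrable (by fun_prop) _ _)
            (Continuous.intervalIntegrable (by fun_prop) _ _) fun t ht => ?_
          rw [norm_mul, norm_mul, RCLike.norm_conj, Complex.norm_real, Real.norm_eq_abs,
            abs_of_nonneg (sub_nonneg.2 ht.2)]
          have h1 : 1 - t ≤ 1 := by linarith [ht.1]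
          have h2 : 0 ≤ ‖expSum ν s c t‖ * ‖expSum ν s d t‖ := by positivity
          nlinarith [sq_nonneg (‖expSum ν s c t‖ - ‖expSum ν s d t‖)]
      _ = 1 / 2 * (∫ t in (0 : ℝ)..1, ‖expSum ν s c t‖ ^ 2) +
          1 / 2 * ∫ t in (0 : ℝ)..1, ‖expSum ν s d t‖ ^ 2 := by
          rw [intervalIntegral.integral_add (Continuous.intervalIntegrable (by fun_prop) _ _)
            (Continuous.intervalIntegrable (by fun_prop) _ _), intervalIntegral.integral_const_mul,
            intervalIntegral.integral_const_mul]
      _ ≤ _ := by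
          have := integral_expSum_le hK hν s c
          have := integral_expSum_le hK hν s d
          linarith
  rw [hsplit] at h
  set B := ∑ m ∈ s, ∑ n ∈ s, c m * conj (d n) * ((1 / (ν m - ν n) : ℝ) : ℂ)
  set X := ∫ t in (0 : ℝ)..1, ((1 - t : ℝ) : ℂ) * (expSum ν s c t * conj (expSum ν s d t))
  set Y := ∑ n ∈ s, c n * conj (d n) * J n n
  have hB : ‖B‖ ≤ ‖X - Complex.I * B - Y‖ + ‖X‖ + ‖Y‖ := by
    have : ‖B‖ = ‖X - Y - (X - Complex.I * B - Y)‖ := by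
      rw [show X - Y - (X - Complex.I * B - Y) = Complex.I * B by ring, norm_mul, Complex.norm_I,
        one_mul]
    rw [this]
    refine (norm_sub_le _ _).trans ?_
    linarith [norm_sub_le X Y]
  have : 0 ≤ S + S' := by positivity
  nlinarith

/-- Hilbert's inequality for well-separated frequencies. -/
theorem sum_norm_sq_hilbert_le
    (hK : ∀ n (s : Finset ι), ∑ m ∈ s, 1 / (ν m - ν n) ^ 2 ≤ K) (hK0 : 0 ≤ K)
    (hν : Function.Injective ν) (s : Finset ι) (c : ι → ℂ) :
    ∑ n ∈ s, ‖∑ m ∈ s, c m * ((1 / (ν m - ν n) : ℝ) : ℂ)‖ ^ 2 ≤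
      4 * (5 + 28 * K) ^ 2 * ∑ n ∈ s, ‖c n‖ ^ 2 := by
  set C := 5 + 28 * K with hC
  have hC0 : 0 < C := by positivity
  set y : ι → ℂ := fun n => ∑ m ∈ s, c m * ((1 / (ν m - ν n) : ℝ) : ℂ) with hy
  -- Duality: testing with `y` scaled by `1 / (2 * C)` makes the `y`-term on the right half of the
  -- left side, so it can be absorbed.
  have h := norm_hilbert_form_le hK hν s c (fun n => ((1 / (2 * C) : ℝ) : ℂ) * y n)
  have h1 : ∑ m ∈ s, ∑ n ∈ s, c m * conj (((1 / (2 * C) : ℝ) : ℂ) * y n) *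
      ((1 / (ν m - ν n) : ℝ) : ℂ) = ((1 / (2 * C) * ∑ n ∈ s, ‖y n‖ ^ 2 : ℝ) : ℂ) := by
    rw [Finset.sum_comm, Complex.ofReal_mul, Complex.ofReal_sum, Finset.mul_sum]
    refine Finset.sum_congr rfl fun n _ => ?_
    rw [← mul_conj_self_eq, map_mul, Complex.conj_ofReal]
    conv_rhs => rw [hy]
    simp only [Finset.sum_mul, Finset.mul_sum]
    refine Finset.sum_congr rfl fun m _ => ?_
    ring
  have h2 : ∑ n ∈ s, ‖((1 / (2 * C) : ℝ) : ℂ) * y n‖ ^ 2 =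
      (1 / (2 * C)) ^ 2 * ∑ n ∈ s, ‖y n‖ ^ 2 := by
    rw [Finset.mul_sum]
    refine Finset.sum_congr rfl fun n _ => ?_
    rw [norm_mul, Complex.norm_real, mul_pow, Real.norm_eq_abs, sq_abs]
  rw [h1, h2, Complex.norm_real, Real.norm_eq_abs] at h
  have h := (le_abs_self _).trans h
  set Y := ∑ n ∈ s, ‖y n‖ ^ 2
  have h3 : C * ((1 / (2 * C)) ^ 2 * Y) = 1 / (4 * C) * Y := by field_simp; ring
  have h4 : 1 / (2 * C) * Y = 1 / (4 * C) * Y + 1 / (4 * C) * Y := by field_simp; ring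
  rw [← hC, mul_add C, h3, h4] at h
  have h5 : 1 / (4 * C) * Y ≤ C * ∑ n ∈ s, ‖c n‖ ^ 2 := by linarith
  rw [one_div_mul_eq_div, div_le_iff₀ (by positivity)] at h5
  linarith

end ExponentialSums

end OscTurnpike

namespace OscTurnpike

open scoped ComplexConjugate
open Filter Topology

/-! ### Square-summable series. -/

section SquareSummable

variable {ι : Type*}

theorem norm_sum_mul_sq_le (a : ι → ℝ) (f : ι → ℂ) (s : Finset ι) :
    ‖∑ n ∈ s, (a n : ℂ) * f n‖ ^ 2 ≤ (∑ n ∈ s, a n ^ 2) * ∑ n ∈ s, ‖f n‖ ^ 2 := by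
  have h1 : ‖∑ n ∈ s, (a n : ℂ) * f n‖ ≤ ∑ n ∈ s, |a n| * ‖f n‖ := by
    refine (norm_sum_le _ _).trans (le_of_eq (Finset.sum_congr rfl fun n _ => ?_))
    rw [norm_mul, Complex.norm_real, Real.norm_eq_abs]
  calc _ ≤ (∑ n ∈ s, |a n| * ‖f n‖) ^ 2 := by gcongr
    _ ≤ (∑ n ∈ s, |a n| ^ 2) * ∑ n ∈ s, ‖f n‖ ^ 2 := Finset.sum_mul_sq_le_sq_mul_sq _ _ _
    _ = _ := by simp_rw [sq_abs]

theorem summable_real_mul {a : ι → ℝ} {f : ι → ℂ} {A B : ℝ} (ha : ∀ s, ∑ n ∈ s, a n ^ 2 ≤ A)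
    (hf : ∀ s, ∑ n ∈ s, ‖f n‖ ^ 2 ≤ B) : Summable fun n => (a n : ℂ) * f n := by
  have h1 := summable_of_sum_le (fun n => sq_nonneg (a n)) ha
  have h2 := summable_of_sum_le (fun n => sq_nonneg ‖f n‖) hf
  refine Summable.of_norm_bounded (h1.add h2) fun n => ?_
  rw [norm_mul, Complex.norm_real, Real.norm_eq_abs, ← sq_abs (a n)]
  nlinarith [sq_nonneg (|a n| - ‖f n‖), sq_nonneg (|a n|), sq_nonneg ‖f n‖]

/-- By Cauchy–Schwarz the tail is controlled by the tail of `a`, which does not depend on `t`. This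
is what permits termwise differentiation of the corrector. -/
theorem tendstoUniformlyOn_sum_real_mul {a : ι → ℝ} {A B : ℝ} (ha : ∀ s, ∑ n ∈ s, a n ^ 2 ≤ A)
    {f : ℝ → ι → ℂ} {S : Set ℝ} (hB : ∀ t ∈ S, ∀ s, ∑ n ∈ s, ‖f t n‖ ^ 2 ≤ B) {F : ℝ → ℂ}
    (hF : ∀ t ∈ S, HasSum (fun n => (a n : ℂ) * f t n) (F t)) :
    TendstoUniformlyOn (fun s t => ∑ n ∈ s, (a n : ℂ) * f t n) F atTop S := by
  classical
  have hs := summable_of_sum_le (fun n => sq_nonneg (a n)) ha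
  rw [Metric.tendstoUniformlyOn_iff]
  intro ε hε
  set B0 := |B| + 1
  have hB0 : 0 < B0 := by positivity
  obtain ⟨s0, hs0⟩ := summable_iff_vanishing_norm.1 hs (ε ^ 2 / (4 * B0)) (by positivity)
  filter_upwards [eventually_ge_atTop s0] with s hs t ht
  rw [dist_eq_norm]
  refine lt_of_le_of_lt ?_ (half_lt_self hε)
  have hlim : Tendsto (fun S' : Finset ι => ‖∑ n ∈ S', (a n : ℂ) * f t n - ∑ n ∈ s, (a n : ℂ) * f t n‖)
      atTop (𝓝 ‖F t - ∑ n ∈ s, (a n : ℂ) * f t n‖) := ((hF t ht).sub_const _).norm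
  refine le_of_tendsto hlim ?_
  filter_upwards [eventually_ge_atTop s] with S' hS'
  rw [← Finset.sum_sdiff hS', add_sub_cancel_right]
  refine le_of_sq_le_sq ?_ (by positivity)
  refine (norm_sum_mul_sq_le _ _ _).trans ?_
  have h1 := (le_abs_self _).trans (hs0 (S' \ s)
    (Finset.disjoint_of_subset_right hs Finset.sdiff_disjoint)).le
  have h2 : ∑ n ∈ S' \ s, ‖f t n‖ ^ 2 ≤ B0 := (hB t ht _).trans (by
    have := le_abs_self B; simp only [B0]; linarith)
  calc _ ≤ ε ^ 2 / (4 * B0) * B0 := by gcongr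
    _ = (ε / 2) ^ 2 := by field_simp; norm_num

end SquareSummable

/-! ### Forced oscillations. -/

section Duhamel

theorem sq_integral_le {a b : ℝ} (hab : a ≤ b) {g : ℝ → ℝ} (hg : ContinuousOn g (Set.Icc a b)) :
    (∫ t in a..b, g t) ^ 2 ≤ (b - a) * ∫ t in a..b, g t ^ 2 := by
  rcases hab.eq_or_lt with rfl | hlt
  · simp
  have hpos := sub_pos.2 hlt
  set c := (∫ t in a..b, g t) / (b - a) with hc
  have i1 : IntervalIntegrable g volume a b := hg.intervalIntegrable_of_Icc hab
  have i2 : IntervalIntegrable (fun t => g t ^ 2) volume a b :=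
    (hg.pow 2).intervalIntegrable_of_Icc hab
  -- Cauchy–Schwarz as nonnegativity of the variance about the mean `c`.
  have h0 : 0 ≤ ∫ t in a..b, (g t - c) ^ 2 :=
    intervalIntegral.integral_nonneg hab fun t _ => sq_nonneg _
  have h1 : ∫ t in a..b, (g t - c) ^ 2 =
      (∫ t in a..b, g t ^ 2) - 2 * c * (∫ t in a..b, g t) + (b - a) * c ^ 2 := by
    have : ∀ t, (g t - c) ^ 2 = (g t ^ 2 - 2 * c * g t) + c ^ 2 := fun t => by ring
    simp_rw [this]
    rw [intervalIntegral.integral_add (i2.sub (i1.const_mul _)) (by simp),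
      intervalIntegral.integral_sub i2 (i1.const_mul _), intervalIntegral.integral_const_mul,
      intervalIntegral.integral_const, smul_eq_mul]
  have h2 : ∫ t in a..b, g t = (b - a) * c := by rw [hc]; field_simp
  rw [h1, h2] at h0
  rw [h2]
  nlinarith

/-- Variation of constants: the unimodular factor `exp (-ν t I)` removes the rotation, so the bound
is independent of the frequency. -/
theorem norm_sub_exp_mul_le {a b : ℝ} (hab : a ≤ b) {ν : ℝ} {f g : ℝ → ℂ}
    (hf : ContinuousOn f (Set.Icc a b)) (hg : ContinuousOn g (Set.Icc a b))
    (hd : ∀ t ∈ Set.Ioo a b, HasDerivAt f (Complex.I * ν * f t + g t) t) :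
    ‖f b - Complex.exp (ν * (b - a : ℝ) * Complex.I) * f a‖ ≤ ∫ t in a..b, ‖g t‖ := by
  have he : ∀ t : ℝ, HasDerivAt (fun t : ℝ => Complex.exp (-ν * t * Complex.I))
      (Complex.exp (-ν * t * Complex.I) * (-ν * Complex.I)) t := by
    intro t
    have := (((Complex.ofRealCLM.hasDerivAt (x := t)).const_mul (-ν : ℂ)).mul_const Complex.I).cexp
    simpa using this
  have hec : Continuous fun t : ℝ => Complex.exp (-ν * t * Complex.I) := by fun_prop
  have hn : ∀ t : ℝ, ‖Complex.exp (-ν * t * Complex.I)‖ = 1 := by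
    intro t
    rw [show (-ν * t * Complex.I : ℂ) = ((-ν * t : ℝ) : ℂ) * Complex.I by push_cast; ring,
      Complex.norm_exp_ofReal_mul_I]
  have hint := intervalIntegral.integral_eq_sub_of_hasDerivAt_of_le hab
    (f := fun t => Complex.exp (-ν * t * Complex.I) * f t)
    (f' := fun t => Complex.exp (-ν * t * Complex.I) * g t)
    (hec.continuousOn.mul hf) (fun t ht => by
      convert! (he t).mul (hd t ht) using 1; ring)
    ((hec.continuousOn.mul hg).intervalIntegrable_of_Icc hab)
  have h1 : ‖f b - Complex.exp (ν * (b - a : ℝ) * Complex.I) * f a‖ =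
      ‖Complex.exp (-ν * b * Complex.I) * f b - Complex.exp (-ν * a * Complex.I) * f a‖ := by
    rw [← one_mul ‖f b - _‖, ← hn b, ← norm_mul, mul_sub, ← mul_assoc, ← Complex.exp_add]
    congr 5
    push_cast; ring
  rw [h1, ← hint]
  refine (intervalIntegral.norm_integral_le_integral_norm hab).trans (le_of_eq ?_)
  refine intervalIntegral.integral_congr fun t _ => ?_
  simp only [norm_mul, hn, one_mul]

theorem norm_sub_exp_mul_sq_le {a b : ℝ} (hab : a ≤ b) {ν : ℝ} {f g : ℝ → ℂ}
    (hf : ContinuousOn f (Set.Icc a b)) (hg : ContinuousOn g (Set.Icc a b))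
    (hd : ∀ t ∈ Set.Ioo a b, HasDerivAt f (Complex.I * ν * f t + g t) t) :
    ‖f b - Complex.exp (ν * (b - a : ℝ) * Complex.I) * f a‖ ^ 2 ≤
      (b - a) * ∫ t in a..b, ‖g t‖ ^ 2 := by
  refine le_trans ?_ (sq_integral_le hab hg.norm)
  gcongr
  exact norm_sub_exp_mul_le hab hf hg hd

theorem norm_exp_mul_I_mul (ν x : ℝ) (z : ℂ) : ‖Complex.exp (ν * x * Complex.I) * z‖ = ‖z‖ := by
  rw [norm_mul, show (ν * x * Complex.I : ℂ) = ((ν * x : ℝ) : ℂ) * Complex.I by push_cast; ring,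
    Complex.norm_exp_ofReal_mul_I, one_mul]

theorem integral_mono_subinterval {a b c d : ℝ} (hca : c ≤ a) (hab : a ≤ b) (hbd : b ≤ d)
    {g : ℝ → ℝ} (hg : ContinuousOn g (Set.Icc c d)) (h0 : ∀ t ∈ Set.Icc c d, 0 ≤ g t) :
    ∫ t in a..b, g t ≤ ∫ t in c..d, g t := by
  refine intervalIntegral.integral_mono_interval hca hab hbd ?_
    (hg.intervalIntegrable_of_Icc (hca.trans (hab.trans hbd)))
  filter_upwards [ae_restrict_mem measurableSet_Ioc] with t ht
  exact h0 t ⟨ht.1.le, ht.2⟩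

/-- The size of a forced oscillation at two times of `[a, b]`. -/
theorem norm_sq_le_of_forced {a b : ℝ} {ν : ℝ} {f g : ℝ → ℂ}
    (hf : ContinuousOn f (Set.Icc a b)) (hg : ContinuousOn g (Set.Icc a b))
    (hd : ∀ t ∈ Set.Ioo a b, HasDerivAt f (Complex.I * ν * f t + g t) t)
    {t t0 : ℝ} (ht : t ∈ Set.Icc a b) (ht0 : t0 ∈ Set.Icc a b) :
    ‖f t‖ ^ 2 ≤ 2 * ‖f t0‖ ^ 2 + 2 * ((b - a) * ∫ t in a..b, ‖g t‖ ^ 2) := by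
  have key : ∀ r ∈ Set.Icc a b, ∀ r' ∈ Set.Icc a b, r ≤ r' →
      ‖f r' - Complex.exp (ν * (r' - r : ℝ) * Complex.I) * f r‖ ^ 2 ≤
        (b - a) * ∫ t in a..b, ‖g t‖ ^ 2 := by
    intro r hr r' hr' hle
    have hsub : Set.Icc r r' ⊆ Set.Icc a b := Set.Icc_subset_Icc hr.1 hr'.2
    refine (norm_sub_exp_mul_sq_le hle (hf.mono hsub) (hg.mono hsub) fun t ht =>
      hd t (Set.Ioo_subset_Ioo hr.1 hr'.2 ht)).trans ?_
    have h1 : ∫ t in r..r', ‖g t‖ ^ 2 ≤ ∫ t in a..b, ‖g t‖ ^ 2 :=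
      integral_mono_subinterval hr.1 hle hr'.2 (hg.norm.pow 2) fun t _ => by positivity
    have h2 : 0 ≤ ∫ t in r..r', ‖g t‖ ^ 2 :=
      intervalIntegral.integral_nonneg hle fun t _ => by positivity
    have h3 : r' - r ≤ b - a := by linarith [hr.1, hr'.2]
    have h4 : 0 ≤ b - a := by linarith [hr.1, hr'.2]
    exact mul_le_mul h3 h1 h2 h4
  have hsq : ∀ x y z : ℝ, 0 ≤ x → x ≤ y + z → x ^ 2 ≤ 2 * y ^ 2 + 2 * z ^ 2 := by
    intro x y z hx hxy
    nlinarith [sq_nonneg (y - z)]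
  -- The propagator is unimodular, so the estimate runs backwards in time as well as forwards.
  rcases le_total t0 t with h | h
  · have h1 := key t0 ht0 t ht h
    have h2 := hsq ‖f t‖ ‖f t0‖ ‖f t - Complex.exp (ν * (t - t0 : ℝ) * Complex.I) * f t0‖
      (norm_nonneg _) (by
        have := norm_sub_norm_le (f t) (Complex.exp (ν * (t - t0 : ℝ) * Complex.I) * f t0)
        rw [norm_exp_mul_I_mul] at this
        linarith)
    linarith
  · have h1 := key t ht t0 ht0 h
    have h2 := hsq ‖f t‖ ‖f t0‖ ‖f t0 - Complex.exp (ν * (t0 - t : ℝ) * Complex.I) * f t‖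
      (norm_nonneg _) (by
        have := norm_sub_norm_le (Complex.exp (ν * (t0 - t : ℝ) * Complex.I) * f t) (f t0)
        rw [norm_exp_mul_I_mul, norm_sub_rev] at this
        linarith)
    linarith

end Duhamel

end OscTurnpike

/-! ### The modal system: propagation, observability and the energy identity. -/

namespace OscTurnpike

open scoped ComplexConjugate
open Filter Topology

/-- The optimality system in modal coordinates: `p' = iν p + β v`, `q' = iν q + p` on `[0, T]`,
where `v = ∑ β_n q_n`; the function `N` is the squared `ℓ²`-norm of `p`. -/
structure ModalSystem {ι : Type*} (ν β : ι → ℝ) (T : ℝ) (p q : ℝ → ι → ℂ) (v : ℝ → ℂ)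
    (N : ℝ → ℝ) : Prop where
  p_cont : ∀ n, ContinuousOn (fun t => p t n) (Set.Icc 0 T)
  q_cont : ∀ n, ContinuousOn (fun t => q t n) (Set.Icc 0 T)
  p_deriv : ∀ n, ∀ t ∈ Set.Ioo 0 T,
    HasDerivAt (fun t => p t n) (Complex.I * ν n * p t n + β n * v t) t
  q_deriv : ∀ n, ∀ t ∈ Set.Ioo 0 T, HasDerivAt (fun t => q t n) (Complex.I * ν n * q t n + p t n) t
  v_cont : ContinuousOn v (Set.Icc 0 T)
  v_sum : ∀ t ∈ Set.Icc 0 T, HasSum (fun n => (β n : ℂ) * q t n) (v t)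
  N_cont : ContinuousOn N (Set.Icc 0 T)
  N_sum : ∀ t ∈ Set.Icc 0 T, HasSum (fun n => ‖p t n‖ ^ 2) (N t)
  q_bdd : ∃ B, ∀ t ∈ Set.Icc 0 T, ∀ s : Finset ι, ∑ n ∈ s, ‖q t n‖ ^ 2 ≤ B

namespace ModalSystem

variable {ι : Type*} {ν β : ι → ℝ} {T : ℝ} {p q : ℝ → ι → ℂ} {v : ℝ → ℂ} {N : ℝ → ℝ} {A K : ℝ}
  (h : ModalSystem ν β T p q v N)

include h

theorem sum_p_le {t : ℝ} (ht : t ∈ Set.Icc 0 T) (s : Finset ι) : ∑ n ∈ s, ‖p t n‖ ^ 2 ≤ N t :=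
  sum_le_hasSum s (fun _ _ => by positivity) (h.N_sum t ht)

theorem N_nonneg {t : ℝ} (ht : t ∈ Set.Icc 0 T) : 0 ≤ N t := by simpa using h.sum_p_le ht ∅

theorem energy_cont : ContinuousOn (fun t => N t + ‖v t‖ ^ 2) (Set.Icc 0 T) :=
  h.N_cont.add (h.v_cont.norm.pow 2)

theorem sum_integral_p_le {a b : ℝ} (ha : 0 ≤ a) (hab : a ≤ b) (hb : b ≤ T) (s : Finset ι) :
    ∑ n ∈ s, ∫ t in a..b, ‖p t n‖ ^ 2 ≤ ∫ t in a..b, N t := by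
  have hsub : Set.Icc a b ⊆ Set.Icc 0 T := Set.Icc_subset_Icc ha hb
  have hi : ∀ n ∈ s, IntervalIntegrable (fun t => ‖p t n‖ ^ 2) volume a b := fun n _ =>
    (((h.p_cont n).mono hsub).norm.pow 2).intervalIntegrable_of_Icc hab
  rw [← intervalIntegral.integral_finsetSum hi]
  refine intervalIntegral.integral_mono_on hab ?_
    ((h.N_cont.mono hsub).intervalIntegrable_of_Icc hab) fun t ht => h.sum_p_le (hsub ht) s
  exact (continuousOn_finsetSum _ fun n _ =>
    ((h.p_cont n).mono hsub).norm.pow 2).intervalIntegrable_of_Icc hab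

theorem integral_N_le_energy {a b : ℝ} (ha : 0 ≤ a) (hab : a ≤ b) (hb : b ≤ T) :
    ∫ t in a..b, N t ≤ ∫ t in a..b, (N t + ‖v t‖ ^ 2) := by
  have hsub : Set.Icc a b ⊆ Set.Icc 0 T := Set.Icc_subset_Icc ha hb
  refine intervalIntegral.integral_mono_on hab
    ((h.N_cont.mono hsub).intervalIntegrable_of_Icc hab)
    ((h.energy_cont.mono hsub).intervalIntegrable_of_Icc hab) fun t _ => ?_
  have : 0 ≤ ‖v t‖ ^ 2 := by positivity
  linarith

theorem integral_v_le_energy {a b : ℝ} (ha : 0 ≤ a) (hab : a ≤ b) (hb : b ≤ T) :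
    ∫ t in a..b, ‖v t‖ ^ 2 ≤ ∫ t in a..b, (N t + ‖v t‖ ^ 2) := by
  have hsub : Set.Icc a b ⊆ Set.Icc 0 T := Set.Icc_subset_Icc ha hb
  refine intervalIntegral.integral_mono_on hab
    (((h.v_cont.mono hsub).norm.pow 2).intervalIntegrable_of_Icc hab)
    ((h.energy_cont.mono hsub).intervalIntegrable_of_Icc hab) fun t ht => ?_
  linarith [h.N_nonneg (hsub ht)]

theorem energy_mono {a b : ℝ} (ha : 0 ≤ a) (hab : a ≤ b) (hb : b ≤ T) :
    ∫ t in a..b, (N t + ‖v t‖ ^ 2) ≤ ∫ t in (0 : ℝ)..T, (N t + ‖v t‖ ^ 2) :=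
  integral_mono_subinterval ha hab hb h.energy_cont fun t ht => by
    have := h.N_nonneg ht
    positivity

theorem energy_nonneg {a b : ℝ} (ha : 0 ≤ a) (hab : a ≤ b) (hb : b ≤ T) :
    0 ≤ ∫ t in a..b, (N t + ‖v t‖ ^ 2) :=
  intervalIntegral.integral_nonneg hab fun t ht => by
    have := h.N_nonneg (Set.Icc_subset_Icc ha hb ht)
    positivity

/-- The weights that matter are `1` and `β ^ 2`. -/
theorem sum_q_le {a b : ℝ} (ha : 0 ≤ a) (hb : b ≤ T) {w : ι → ℝ} (hw0 : ∀ n, 0 ≤ w n) {W : ℝ}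
    (hw : ∀ n, w n ≤ W) {t t0 : ℝ} (ht : t ∈ Set.Icc a b) (ht0 : t0 ∈ Set.Icc a b)
    (s : Finset ι) :
    ∑ n ∈ s, w n * ‖q t n‖ ^ 2 ≤
      2 * ∑ n ∈ s, w n * ‖q t0 n‖ ^ 2 + 2 * W * (b - a) * ∫ t in a..b, N t := by
  have hab : a ≤ b := ht.1.trans ht.2
  have hsub : Set.Icc a b ⊆ Set.Icc 0 T := Set.Icc_subset_Icc ha hb
  have hi : ∀ n, 0 ≤ ∫ t in a..b, ‖p t n‖ ^ 2 := fun n =>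
    intervalIntegral.integral_nonneg hab fun t _ => by positivity
  have hba := sub_nonneg.2 hab
  rcases s.eq_empty_or_nonempty with rfl | ⟨n0, _⟩
  · have : 0 ≤ ∫ t in a..b, N t :=
      intervalIntegral.integral_nonneg hab fun t ht => h.N_nonneg (hsub ht)
    -- `W` can be negative only when there are no modes at all, and then `N` vanishes.
    by_cases hW : 0 ≤ W
    · simp; positivity
    · by_cases hι : Nonempty ι
      · exact absurd ((hw0 hι.some).trans (hw _)) hW
      · have hN : ∫ t in a..b, N t = 0 := by
          rw [intervalIntegral.integral_congr (g := fun _ => 0)]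
          · simp
          · intro t ht
            rw [Set.uIcc_of_le hab] at ht
            have := not_nonempty_iff.1 hι
            exact (h.N_sum t (hsub ht)).unique (by simp)
        simp [hN]
  have hW : 0 ≤ W := (hw0 n0).trans (hw n0)
  calc ∑ n ∈ s, w n * ‖q t n‖ ^ 2
      ≤ ∑ n ∈ s, (2 * (w n * ‖q t0 n‖ ^ 2) + 2 * W * (b - a) * ∫ t in a..b, ‖p t n‖ ^ 2) := by
        refine Finset.sum_le_sum fun n _ => ?_
        have h1 := norm_sq_le_of_forced ((h.q_cont n).mono hsub) ((h.p_cont n).mono hsub)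
          (fun t ht => h.q_deriv n t (Set.Ioo_subset_Ioo ha hb ht)) ht ht0
        have h2 := mul_le_mul_of_nonneg_left h1 (hw0 n)
        have h3 := mul_le_mul_of_nonneg_right (hw n) (mul_nonneg hba (hi n))
        nlinarith
    _ = 2 * ∑ n ∈ s, w n * ‖q t0 n‖ ^ 2 +
        2 * W * (b - a) * ∑ n ∈ s, ∫ t in a..b, ‖p t n‖ ^ 2 := by
        rw [Finset.sum_add_distrib, Finset.mul_sum, Finset.mul_sum]
    _ ≤ _ := by
        gcongr
        exact h.sum_integral_p_le ha hab hb s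

theorem sum_p_le_of_mem (hA : ∀ s : Finset ι, ∑ n ∈ s, β n ^ 2 ≤ A) {a b : ℝ} (ha : 0 ≤ a)
    (hb : b ≤ T) {t t0 : ℝ} (ht : t ∈ Set.Icc a b) (ht0 : t0 ∈ Set.Icc a b) (s : Finset ι) :
    ∑ n ∈ s, ‖p t n‖ ^ 2 ≤
      2 * ∑ n ∈ s, ‖p t0 n‖ ^ 2 + 2 * A * (b - a) * ∫ t in a..b, ‖v t‖ ^ 2 := by
  have hab : a ≤ b := ht.1.trans ht.2
  have hsub : Set.Icc a b ⊆ Set.Icc 0 T := Set.Icc_subset_Icc ha hb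
  have hi : 0 ≤ ∫ t in a..b, ‖v t‖ ^ 2 :=
    intervalIntegral.integral_nonneg hab fun t _ => by positivity
  have hba := sub_nonneg.2 hab
  calc ∑ n ∈ s, ‖p t n‖ ^ 2
      ≤ ∑ n ∈ s, (2 * ‖p t0 n‖ ^ 2 + 2 * β n ^ 2 * ((b - a) * ∫ t in a..b, ‖v t‖ ^ 2)) := by
        refine Finset.sum_le_sum fun n _ => ?_
        have h1 := norm_sq_le_of_forced (g := fun t => (β n : ℂ) * v t) ((h.p_cont n).mono hsub)
          (continuousOn_const.mul (h.v_cont.mono hsub))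
          (fun t ht => h.p_deriv n t (Set.Ioo_subset_Ioo ha hb ht)) ht ht0
        have h2 : ∫ t in a..b, ‖(β n : ℂ) * v t‖ ^ 2 = β n ^ 2 * ∫ t in a..b, ‖v t‖ ^ 2 := by
          rw [← intervalIntegral.integral_const_mul]
          refine intervalIntegral.integral_congr fun t _ => ?_
          simp only [norm_mul, Complex.norm_real, mul_pow, Real.norm_eq_abs, sq_abs]
        rw [h2] at h1
        linarith
    _ = 2 * ∑ n ∈ s, ‖p t0 n‖ ^ 2 +
        2 * (∑ n ∈ s, β n ^ 2) * ((b - a) * ∫ t in a..b, ‖v t‖ ^ 2) := by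
        rw [Finset.sum_add_distrib, Finset.mul_sum, Finset.mul_sum, Finset.sum_mul]
    _ ≤ 2 * ∑ n ∈ s, ‖p t0 n‖ ^ 2 + 2 * A * ((b - a) * ∫ t in a..b, ‖v t‖ ^ 2) := by
        gcongr
        exact hA s
    _ = _ := by ring

/-- Ingham's inequality concerns finite sums; this limit transfers it to the full series `v`. -/
theorem tendsto_integral_sum_v [Countable ι] (hA : ∀ s : Finset ι, ∑ n ∈ s, β n ^ 2 ≤ A) {a b : ℝ}
    (ha : 0 ≤ a) (hab : a ≤ b) (hb : b ≤ T) :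
    Tendsto (fun s : Finset ι => ∫ t in a..b, ‖∑ n ∈ s, (β n : ℂ) * q t n‖ ^ 2) atTop
      (𝓝 (∫ t in a..b, ‖v t‖ ^ 2)) := by
  have hsub : Set.Icc a b ⊆ Set.Icc 0 T := Set.Icc_subset_Icc ha hb
  obtain ⟨B, hB⟩ := h.q_bdd
  refine intervalIntegral.tendsto_integral_filter_of_dominated_convergence (fun _ => A * B)
    (Eventually.of_forall fun s => ?_) (Eventually.of_forall fun s => ?_) (by simp) ?_
  · rw [Set.uIoc_of_le hab]
    refine (ContinuousOn.mono ?_ Set.Ioc_subset_Icc_self).aestronglyMeasurable measurableSet_Ioc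
    exact (continuousOn_finsetSum _ fun n _ =>
      continuousOn_const.mul ((h.q_cont n).mono hsub)).norm.pow 2
  · refine Eventually.of_forall fun t ht => ?_
    rw [Set.uIoc_of_le hab] at ht
    have ht := hsub (Set.Ioc_subset_Icc_self ht)
    rw [Real.norm_eq_abs, abs_of_nonneg (by positivity)]
    refine (norm_sum_mul_sq_le _ _ _).trans ?_
    have h0 : 0 ≤ A := by simpa using hA ∅
    have h1 := hA s
    have h2 := hB t ht s
    gcongr
  · refine Eventually.of_forall fun t ht => ?_
    rw [Set.uIoc_of_le hab] at ht
    exact ((h.v_sum t (hsub (Set.Ioc_subset_Icc_self ht))).norm).pow 2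

/-- Observability of the weighted norm of `q` at the left end of an interval. -/
theorem sum_sq_mul_q_left_le [Countable ι] (hA : ∀ s : Finset ι, ∑ n ∈ s, β n ^ 2 ≤ A)
    (hK : ∀ n (s : Finset ι), ∑ m ∈ s, 1 / (ν m - ν n) ^ 2 ≤ K) (hν : Function.Injective ν)
    {a b : ℝ} (ha : 0 ≤ a) (hab : a < b) (hb : b ≤ T) (hL : 120 * K ≤ (b - a) ^ 2)
    (s : Finset ι) :
    ∑ n ∈ s, β n ^ 2 * ‖q a n‖ ^ 2 ≤
      (8 / (b - a) + 8 * A * (b - a)) * ∫ t in a..b, (N t + ‖v t‖ ^ 2) := by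
  have hsub : Set.Icc a b ⊆ Set.Icc 0 T := Set.Icc_subset_Icc ha hb
  have hba := sub_pos.2 hab
  have hA0 : 0 ≤ A := by simpa using hA ∅
  -- Ingham's inequality is applied to a set `S` that later grows, because only the sums over large
  -- `S` approach `v`; the modes outside `s` are dropped from the left side.
  have main : ∀ S : Finset ι, s ⊆ S → ∑ n ∈ s, β n ^ 2 * ‖q a n‖ ^ 2 ≤
      4 / (b - a) * (2 * (∫ t in a..b, ‖∑ n ∈ S, (β n : ℂ) * q t n‖ ^ 2) +
        (b - a) * (2 * A * ((b - a) * ∫ t in a..b, N t))) := by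
    intro S hS
    -- The phase moves the time origin to `a`: `expSum ν S c` is the observation of the free
    -- evolution issued from `q a`.
    set c : ι → ℂ := fun n => β n * (Complex.exp (ν n * (0 - a : ℝ) * Complex.I) * q a n) with hc
    have hcn : ∀ n, ‖c n‖ ^ 2 = β n ^ 2 * ‖q a n‖ ^ 2 := by
      intro n
      rw [hc, norm_mul, norm_exp_mul_I_mul, Complex.norm_real, mul_pow, Real.norm_eq_abs, sq_abs]
    have hF : ∀ t ∈ Set.Icc a b, ‖expSum ν S c t‖ ^ 2 ≤
        2 * ‖∑ n ∈ S, (β n : ℂ) * q t n‖ ^ 2 + 2 * A * ((b - a) * ∫ t in a..b, N t) := by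
      intro t ht
      have hsub' : Set.Icc a t ⊆ Set.Icc a b := Set.Icc_subset_Icc le_rfl ht.2
      -- The deviation of `q` from the free evolution is driven by `p` alone, hence bounded by the
      -- energy.
      set d : ι → ℂ := fun n => q t n - Complex.exp (ν n * (t - a : ℝ) * Complex.I) * q a n with hd
      have h1 : expSum ν S c t = ∑ n ∈ S, (β n : ℂ) * q t n - ∑ n ∈ S, (β n : ℂ) * d n := by
        rw [expSum, ← Finset.sum_sub_distrib]
        refine Finset.sum_congr rfl fun n _ => ?_
        have : Complex.exp (ν n * (t - a : ℝ) * Complex.I) =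
            Complex.exp (ν n * (0 - a : ℝ) * Complex.I) * Complex.exp (ν n * t * Complex.I) := by
          rw [← Complex.exp_add]; congr 1; push_cast; ring
        simp only [hc, hd, this]; ring
      have h2 : ∑ n ∈ S, ‖d n‖ ^ 2 ≤ (b - a) * ∫ t in a..b, N t := by
        calc ∑ n ∈ S, ‖d n‖ ^ 2 ≤ ∑ n ∈ S, (t - a) * ∫ r in a..t, ‖p r n‖ ^ 2 :=
              Finset.sum_le_sum fun n _ => norm_sub_exp_mul_sq_le ht.1
                ((h.q_cont n).mono (hsub'.trans hsub)) ((h.p_cont n).mono (hsub'.trans hsub))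
                fun r hr => h.q_deriv n r (Set.Ioo_subset_Ioo ha (ht.2.trans hb) hr)
          _ = (t - a) * ∑ n ∈ S, ∫ r in a..t, ‖p r n‖ ^ 2 := by rw [Finset.mul_sum]
          _ ≤ (t - a) * ∫ r in a..t, N r := by
              have := sub_nonneg.2 ht.1
              gcongr
              exact h.sum_integral_p_le ha ht.1 (ht.2.trans hb) S
          _ ≤ (b - a) * ∫ t in a..b, N t := by
              refine mul_le_mul (by linarith [ht.2]) ?_ ?_ hba.le
              · exact integral_mono_subinterval le_rfl ht.1 ht.2 (h.N_cont.mono hsub)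
                  fun r hr => h.N_nonneg (hsub hr)
              · exact intervalIntegral.integral_nonneg ht.1 fun r hr =>
                  h.N_nonneg (hsub (hsub' hr))
      have h3 : ‖∑ n ∈ S, (β n : ℂ) * d n‖ ^ 2 ≤ A * ((b - a) * ∫ t in a..b, N t) := by
        refine (norm_sum_mul_sq_le _ _ _).trans ?_
        exact mul_le_mul (hA S) h2 (by positivity) hA0
      rw [h1]
      have h4 := norm_sub_le (∑ n ∈ S, (β n : ℂ) * q t n) (∑ n ∈ S, (β n : ℂ) * d n)
      have h5 := pow_le_pow_left₀ (norm_nonneg _) h4 2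
      nlinarith [sq_nonneg (‖∑ n ∈ S, (β n : ℂ) * q t n‖ - ‖∑ n ∈ S, (β n : ℂ) * d n‖)]
    have hcS : ContinuousOn (fun t => 2 * ‖∑ n ∈ S, (β n : ℂ) * q t n‖ ^ 2) (Set.Icc a b) :=
      continuousOn_const.mul ((continuousOn_finsetSum _ fun n _ =>
        continuousOn_const.mul ((h.q_cont n).mono hsub)).norm.pow 2)
    calc ∑ n ∈ s, β n ^ 2 * ‖q a n‖ ^ 2 = ∑ n ∈ s, ‖c n‖ ^ 2 :=
          Finset.sum_congr rfl fun n _ => (hcn n).symm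
      _ ≤ ∑ n ∈ S, ‖c n‖ ^ 2 := Finset.sum_le_sum_of_subset_of_nonneg hS fun _ _ _ => by positivity
      _ ≤ 4 / (b - a) * ∫ t in a..b, ‖expSum ν S c t‖ ^ 2 :=
          sum_sq_le_integral_expSum hK hν hab hL S c
      _ ≤ 4 / (b - a) * ∫ t in a..b, (2 * ‖∑ n ∈ S, (β n : ℂ) * q t n‖ ^ 2 +
            2 * A * ((b - a) * ∫ t in a..b, N t)) := by
          gcongr
          exact intervalIntegral.integral_mono_on hab.le
            (((continuous_expSum S c).norm.pow 2).intervalIntegrable _ _)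
            ((hcS.add continuousOn_const).intervalIntegrable_of_Icc hab.le) hF
      _ = _ := by
          rw [intervalIntegral.integral_add (hcS.intervalIntegrable_of_Icc hab.le) (by simp),
            intervalIntegral.integral_const, smul_eq_mul, intervalIntegral.integral_const_mul]
  have hlim := ((((h.tendsto_integral_sum_v hA ha hab.le hb).const_mul 2).add_const
    ((b - a) * (2 * A * ((b - a) * ∫ t in a..b, N t)))).const_mul (4 / (b - a)))
  have h1 := ge_of_tendsto hlim ((eventually_ge_atTop s).mono fun S hS => main S hS)
  refine h1.trans ?_
  have h2 := h.integral_N_le_energy ha hab.le hb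
  have h3 := h.integral_v_le_energy ha hab.le hb
  calc _ = 8 / (b - a) * (∫ t in a..b, ‖v t‖ ^ 2) + 8 * A * (b - a) * ∫ t in a..b, N t := by
        field_simp; ring
    _ ≤ 8 / (b - a) * (∫ t in a..b, (N t + ‖v t‖ ^ 2)) +
        8 * A * (b - a) * ∫ t in a..b, (N t + ‖v t‖ ^ 2) := by gcongr
    _ = _ := by ring

/-- Observability at the left end, propagated to every time of the interval. The corrector needs
this bound pointwise in time. -/
theorem sum_sq_mul_q_le [Countable ι] (hA : ∀ s : Finset ι, ∑ n ∈ s, β n ^ 2 ≤ A)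
    (hK : ∀ n (s : Finset ι), ∑ m ∈ s, 1 / (ν m - ν n) ^ 2 ≤ K) (hν : Function.Injective ν)
    {a b : ℝ} (ha : 0 ≤ a) (hab : a < b) (hb : b ≤ T) (hL : 120 * K ≤ (b - a) ^ 2)
    {t : ℝ} (ht : t ∈ Set.Icc a b) (s : Finset ι) :
    ∑ n ∈ s, β n ^ 2 * ‖q t n‖ ^ 2 ≤
      (16 / (b - a) + 18 * A * (b - a)) * ∫ t in a..b, (N t + ‖v t‖ ^ 2) := by
  have h1 := h.sum_sq_mul_q_left_le hA hK hν ha hab hb hL s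
  have h2 := h.sum_q_le (w := fun n => β n ^ 2) (W := A) ha hb (fun n => sq_nonneg _)
    (fun n => by simpa using hA {n}) ht (Set.left_mem_Icc.2 hab.le) s
  have h3 := h.integral_N_le_energy ha hab.le hb
  have hA0 : 0 ≤ A := by simpa using hA ∅
  have hba := sub_pos.2 hab
  have h4 := mul_le_mul_of_nonneg_left h3 (by positivity : 0 ≤ 2 * A * (b - a))
  calc _ ≤ _ := h2
    _ ≤ 2 * ((8 / (b - a) + 8 * A * (b - a)) * ∫ t in a..b, (N t + ‖v t‖ ^ 2)) +
        2 * A * (b - a) * ∫ t in a..b, (N t + ‖v t‖ ^ 2) := by linarith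
    _ = _ := by ring

/-- The energy identity, as an upper bound. -/
theorem energy_le [Countable ι] (hT : 0 ≤ T) (hA : ∀ s : Finset ι, ∑ n ∈ s, β n ^ 2 ≤ A) {R : ℝ}
    (hR : ∀ s : Finset ι, ∑ n ∈ s, ((conj (p T n) * q T n).re - (conj (p 0 n) * q 0 n).re) ≤ R) :
    ∫ t in (0 : ℝ)..T, (N t + ‖v t‖ ^ 2) ≤ R := by
  obtain ⟨B, hB⟩ := h.q_bdd
  have hA0 : 0 ≤ A := by simpa using hA ∅
  -- The rotations cancel in the derivative of `conj p * q`. For finitely many modes the forcing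
  -- still contains the full `v`, so `‖v‖ ^ 2` appears only in the limit.
  have hid : ∀ s : Finset ι, ∫ t in (0 : ℝ)..T, (∑ n ∈ s, ‖p t n‖ ^ 2 +
      (conj (v t) * ∑ n ∈ s, (β n : ℂ) * q t n).re) =
      ∑ n ∈ s, ((conj (p T n) * q T n).re - (conj (p 0 n) * q 0 n).re) := by
    intro s
    have hc : ∀ n, ContinuousOn (fun t => conj (p t n) * q t n) (Set.Icc 0 T) := fun n =>
      (Complex.continuous_conj.comp_continuousOn (h.p_cont n)).mul (h.q_cont n)
    have h1 := intervalIntegral.integral_eq_sub_of_hasDerivAt_of_le hT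
      (f := fun t => ∑ n ∈ s, (conj (p t n) * q t n).re)
      (f' := fun t => ∑ n ∈ s, ‖p t n‖ ^ 2 + (conj (v t) * ∑ n ∈ s, (β n : ℂ) * q t n).re)
      (continuousOn_finsetSum _ fun n _ => Complex.continuous_re.comp_continuousOn (hc n))
      (fun t ht => by
        rw [Finset.mul_sum, Complex.re_sum, ← Finset.sum_add_distrib]
        refine HasDerivAt.fun_sum fun n _ => ?_
        have hd := Complex.reCLM.hasFDerivAt.comp_hasDerivAt t
          ((h.p_deriv n t ht).star.mul (h.q_deriv n t ht))
        convert! hd using 1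
        simp only [Complex.reCLM_apply, Complex.star_def, map_add, map_mul, Complex.conj_I, Complex.conj_ofReal]
        rw [← Complex.ofReal_re (‖p t n‖ ^ 2), ← mul_conj_self_eq, ← Complex.add_re,
          ← Complex.add_re]
        congr 1
        ring) ?_
    · rw [h1, Finset.sum_sub_distrib]
    · refine ContinuousOn.intervalIntegrable_of_Icc hT ?_
      refine (continuousOn_finsetSum _ fun n _ => (h.p_cont n).norm.pow 2).add
        (Complex.continuous_re.comp_continuousOn ?_)
      exact (Complex.continuous_conj.comp_continuousOn h.v_cont).mul
        (continuousOn_finsetSum _ fun n _ => continuousOn_const.mul (h.q_cont n))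
  have hlim : Tendsto (fun s : Finset ι => ∫ t in (0 : ℝ)..T, (∑ n ∈ s, ‖p t n‖ ^ 2 +
      (conj (v t) * ∑ n ∈ s, (β n : ℂ) * q t n).re)) atTop
      (𝓝 (∫ t in (0 : ℝ)..T, (N t + ‖v t‖ ^ 2))) := by
    refine intervalIntegral.tendsto_integral_filter_of_dominated_convergence
      (fun t => N t + ‖v t‖ * Real.sqrt (A * B))
      (Eventually.of_forall fun s => ?_) (Eventually.of_forall fun s => ?_) ?_ ?_
    · rw [Set.uIoc_of_le hT]
      refine (ContinuousOn.mono ?_ Set.Ioc_subset_Icc_self).aestronglyMeasurable measurableSet_Ioc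
      refine (continuousOn_finsetSum _ fun n _ => (h.p_cont n).norm.pow 2).add
        (Complex.continuous_re.comp_continuousOn ?_)
      exact (Complex.continuous_conj.comp_continuousOn h.v_cont).mul
        (continuousOn_finsetSum _ fun n _ => continuousOn_const.mul (h.q_cont n))
    · refine Eventually.of_forall fun t ht => ?_
      rw [Set.uIoc_of_le hT] at ht
      have ht := Set.Ioc_subset_Icc_self ht
      refine (norm_add_le _ _).trans (add_le_add ?_ ?_)
      · rw [Real.norm_eq_abs, abs_of_nonneg (by positivity)]
        exact h.sum_p_le ht s
      · rw [Real.norm_eq_abs]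
        refine (Complex.abs_re_le_norm _).trans ?_
        rw [norm_mul, RCLike.norm_conj]
        gcongr
        refine Real.le_sqrt_of_sq_le ((norm_sum_mul_sq_le _ _ _).trans ?_)
        have h1 := hA s
        have h2 := hB t ht s
        gcongr
    · exact (h.N_cont.add (h.v_cont.norm.mul continuousOn_const)).intervalIntegrable_of_Icc hT
    · refine Eventually.of_forall fun t ht => ?_
      rw [Set.uIoc_of_le hT] at ht
      have ht := Set.Ioc_subset_Icc_self ht
      refine Tendsto.add (h.N_sum t ht) ?_
      have h1 : Tendsto (fun s : Finset ι => (conj (v t) * ∑ n ∈ s, (β n : ℂ) * q t n).re) atTop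
          (𝓝 (conj (v t) * v t).re) :=
        (Complex.continuous_re.tendsto _).comp (Tendsto.const_mul _ (h.v_sum t ht))
      rwa [mul_comm, mul_conj_self_eq, Complex.ofReal_re] at h1
  exact le_of_tendsto' hlim fun s => (hid s).le.trans (hR s)

end ModalSystem

end OscTurnpike

namespace OscTurnpike

open scoped ComplexConjugate
open Filter Topology

/-! ### The corrector and its bound in square mean. -/

section Coupling

variable {ι : Type*} {ν β : ι → ℝ} {A B K V M : ℝ}

/-- The corrector that removes the coupling of mode `n` to the other modes. -/
noncomputable def corrector (ν β : ι → ℝ) (n : ι) (p q : ι → ℂ) : ℂ :=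
  ∑' m, ((β m * (1 / (ν m - ν n)) : ℝ) : ℂ) * (-Complex.I * q m) +
    ∑' m, ((β m * (1 / (ν m - ν n)) ^ 2 : ℝ) : ℂ) * p m

theorem inv_sub_sq_le (hK : ∀ n (s : Finset ι), ∑ m ∈ s, 1 / (ν m - ν n) ^ 2 ≤ K) (m n : ι) :
    (1 / (ν m - ν n)) ^ 2 ≤ K := by
  have := hK n {m}
  rw [Finset.sum_singleton] at this
  rwa [one_div_pow]

theorem sum_sq_mul_inv_le (hA : ∀ s : Finset ι, ∑ n ∈ s, β n ^ 2 ≤ A)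
    (hK : ∀ n (s : Finset ι), ∑ m ∈ s, 1 / (ν m - ν n) ^ 2 ≤ K) (hK0 : 0 ≤ K) (n : ι)
    (s : Finset ι) : ∑ m ∈ s, (β m * (1 / (ν m - ν n))) ^ 2 ≤ A * K := by
  calc _ ≤ ∑ m ∈ s, β m ^ 2 * K := Finset.sum_le_sum fun m _ => by
        rw [mul_pow]; gcongr; exact inv_sub_sq_le hK m n
    _ = (∑ m ∈ s, β m ^ 2) * K := by rw [Finset.sum_mul]
    _ ≤ A * K := by gcongr; exact hA s

theorem sum_sq_mul_inv_sq_le (hA : ∀ s : Finset ι, ∑ n ∈ s, β n ^ 2 ≤ A)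
    (hK : ∀ n (s : Finset ι), ∑ m ∈ s, 1 / (ν m - ν n) ^ 2 ≤ K) (n : ι) (s : Finset ι) :
    ∑ m ∈ s, (β m * (1 / (ν m - ν n)) ^ 2) ^ 2 ≤ A * K ^ 2 := by
  calc _ ≤ ∑ m ∈ s, β m ^ 2 * K ^ 2 := Finset.sum_le_sum fun m _ => by
        rw [mul_pow]; gcongr; exact inv_sub_sq_le hK m n
    _ = (∑ m ∈ s, β m ^ 2) * K ^ 2 := by rw [Finset.sum_mul]
    _ ≤ A * K ^ 2 := by gcongr; exact hA s

theorem norm_neg_I_mul (z : ℂ) : ‖-Complex.I * z‖ = ‖z‖ := by simp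

theorem hasSum_corrector_fst (hA : ∀ s : Finset ι, ∑ n ∈ s, β n ^ 2 ≤ A)
    (hK : ∀ n (s : Finset ι), ∑ m ∈ s, 1 / (ν m - ν n) ^ 2 ≤ K) (hK0 : 0 ≤ K) (n : ι) {q : ι → ℂ}
    (hq : ∀ s : Finset ι, ∑ m ∈ s, ‖q m‖ ^ 2 ≤ B) :
    HasSum (fun m => ((β m * (1 / (ν m - ν n)) : ℝ) : ℂ) * (-Complex.I * q m))
      (∑' m, ((β m * (1 / (ν m - ν n)) : ℝ) : ℂ) * (-Complex.I * q m)) :=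
  (summable_real_mul (sum_sq_mul_inv_le hA hK hK0 n)
    (by simpa only [norm_neg_I_mul] using hq)).hasSum

theorem hasSum_corrector_snd (hA : ∀ s : Finset ι, ∑ n ∈ s, β n ^ 2 ≤ A)
    (hK : ∀ n (s : Finset ι), ∑ m ∈ s, 1 / (ν m - ν n) ^ 2 ≤ K) (n : ι) {p : ι → ℂ}
    (hp : ∀ s : Finset ι, ∑ m ∈ s, ‖p m‖ ^ 2 ≤ M) :
    HasSum (fun m => ((β m * (1 / (ν m - ν n)) ^ 2 : ℝ) : ℂ) * p m)
      (∑' m, ((β m * (1 / (ν m - ν n)) ^ 2 : ℝ) : ℂ) * p m) :=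
  (summable_real_mul (sum_sq_mul_inv_sq_le hA hK n) hp).hasSum

/-- The first series is a discrete Hilbert transform of `β q`, so it costs only the weighted norm
`V`; the bound `B` on `q` itself serves for convergence and does not enter the estimate. The second
series has a square-summable kernel. -/
theorem sum_norm_sq_corrector_le (hA : ∀ s : Finset ι, ∑ n ∈ s, β n ^ 2 ≤ A)
    (hK : ∀ n (s : Finset ι), ∑ m ∈ s, 1 / (ν m - ν n) ^ 2 ≤ K) (hK0 : 0 ≤ K)
    (hν : Function.Injective ν) {p q : ι → ℂ} (hq : ∀ s : Finset ι, ∑ m ∈ s, ‖q m‖ ^ 2 ≤ B)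
    (hp : ∀ s : Finset ι, ∑ m ∈ s, ‖p m‖ ^ 2 ≤ M)
    (hV : ∀ s : Finset ι, ∑ m ∈ s, β m ^ 2 * ‖q m‖ ^ 2 ≤ V) (s : Finset ι) :
    ∑ n ∈ s, ‖corrector ν β n p q‖ ^ 2 ≤ 8 * (5 + 28 * K) ^ 2 * V + 2 * A * K ^ 2 * M := by
  set G : Finset ι → ι → ℂ := fun S n =>
    ∑ m ∈ S, ((β m * (1 / (ν m - ν n)) : ℝ) : ℂ) * (-Complex.I * q m) +
      ∑ m ∈ S, ((β m * (1 / (ν m - ν n)) ^ 2 : ℝ) : ℂ) * p m with hG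
  have hlim : Tendsto (fun S => ∑ n ∈ s, ‖G S n‖ ^ 2) atTop
      (𝓝 (∑ n ∈ s, ‖corrector ν β n p q‖ ^ 2)) := by
    refine tendsto_finsetSum _ fun n _ => ?_
    exact (((hasSum_corrector_fst hA hK hK0 n hq).add (hasSum_corrector_snd hA hK n hp)).congr
      (fun S => by simp only [hG, Finset.sum_add_distrib]) |>.norm.pow 2)
  -- Hilbert's inequality has the same finite set of rows and columns, so the inner series are
  -- truncated to `S ⊇ s` and the outer sum is enlarged to `S`.
  refine le_of_tendsto hlim ((eventually_ge_atTop s).mono fun S hS => ?_)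
  have hM : 0 ≤ M := by simpa using hp ∅
  have hA0 : 0 ≤ A := by simpa using hA ∅
  have h1 : ∑ n ∈ S, ‖∑ m ∈ S, ((β m * (1 / (ν m - ν n)) : ℝ) : ℂ) * (-Complex.I * q m)‖ ^ 2 ≤
      4 * (5 + 28 * K) ^ 2 * V := by
    have := sum_norm_sq_hilbert_le hK hK0 hν S (fun m => β m * (-Complex.I * q m))
    refine le_trans (le_of_eq ?_) (this.trans ?_)
    · refine Finset.sum_congr rfl fun n _ => ?_
      congr 2
      refine Finset.sum_congr rfl fun m _ => ?_
      push_cast; ring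
    · gcongr
      refine le_trans (le_of_eq (Finset.sum_congr rfl fun m _ => ?_)) (hV S)
      rw [norm_mul, norm_neg_I_mul, Complex.norm_real, mul_pow, Real.norm_eq_abs, sq_abs]
  have h2 : ∑ n ∈ S, ‖∑ m ∈ S, ((β m * (1 / (ν m - ν n)) ^ 2 : ℝ) : ℂ) * p m‖ ^ 2 ≤
      A * K ^ 2 * M := by
    calc _ ≤ ∑ n ∈ S, (∑ m ∈ S, (β m * (1 / (ν m - ν n)) ^ 2) ^ 2) * M := by
          refine Finset.sum_le_sum fun n _ => (norm_sum_mul_sq_le _ _ _).trans ?_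
          gcongr
          exact hp S
      _ = (∑ m ∈ S, ∑ n ∈ S, (β m * (1 / (ν m - ν n)) ^ 2) ^ 2) * M := by
          rw [← Finset.sum_mul, Finset.sum_comm]
      _ ≤ (∑ m ∈ S, β m ^ 2 * (K * K)) * M := by
          gcongr with m _
          calc ∑ n ∈ S, (β m * (1 / (ν m - ν n)) ^ 2) ^ 2
              -- One factor `(ν m - ν n) ^ (-2)` is bounded by `K`; the other is kept to be summed
              -- over `n`.
              ≤ ∑ n ∈ S, β m ^ 2 * (K * (1 / (ν n - ν m) ^ 2)) := by
                refine Finset.sum_le_sum fun n _ => ?_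
                have h3 := inv_sub_sq_le hK m n
                have h4 : 1 / (ν n - ν m) ^ 2 = (1 / (ν m - ν n)) ^ 2 := by
                  rw [one_div_pow, ← neg_sub, neg_sq]
                rw [h4, mul_pow, sq ((1 / (ν m - ν n)) ^ 2)]
                gcongr
            _ = β m ^ 2 * (K * ∑ n ∈ S, 1 / (ν n - ν m) ^ 2) := by
                rw [Finset.mul_sum, Finset.mul_sum]
            _ ≤ _ := by gcongr; exact hK m S
      _ = (∑ m ∈ S, β m ^ 2) * (K * K) * M := by rw [← Finset.sum_mul]
      _ ≤ A * (K * K) * M := by gcongr; exact hA S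
      _ = _ := by ring
  calc ∑ n ∈ s, ‖G S n‖ ^ 2 ≤ ∑ n ∈ S, ‖G S n‖ ^ 2 :=
        Finset.sum_le_sum_of_subset_of_nonneg hS fun _ _ _ => by positivity
    _ ≤ ∑ n ∈ S, (2 * ‖∑ m ∈ S, ((β m * (1 / (ν m - ν n)) : ℝ) : ℂ) * (-Complex.I * q m)‖ ^ 2 +
          2 * ‖∑ m ∈ S, ((β m * (1 / (ν m - ν n)) ^ 2 : ℝ) : ℂ) * p m‖ ^ 2) := by
        refine Finset.sum_le_sum fun n _ => ?_
        have h4 := pow_le_pow_left₀ (norm_nonneg _) (norm_add_le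
          (∑ m ∈ S, ((β m * (1 / (ν m - ν n)) : ℝ) : ℂ) * (-Complex.I * q m))
          (∑ m ∈ S, ((β m * (1 / (ν m - ν n)) ^ 2 : ℝ) : ℂ) * p m)) 2
        refine h4.trans ?_
        nlinarith [sq_nonneg (‖∑ m ∈ S, ((β m * (1 / (ν m - ν n)) : ℝ) : ℂ) * (-Complex.I * q m)‖
          - ‖∑ m ∈ S, ((β m * (1 / (ν m - ν n)) ^ 2 : ℝ) : ℂ) * p m‖)]
    _ ≤ _ := by
        rw [Finset.sum_add_distrib, ← Finset.mul_sum, ← Finset.mul_sum]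
        linarith

end Coupling

/-- A pair of modes coupled to a remainder `G`, after the normal form transformation. -/
theorem mode_bound {T β γ ν : ℝ} (hT : 0 ≤ T) (hγ : 1 ≤ γ) {P q G v : ℝ → ℂ}
    (hP : ContinuousOn P (Set.Icc 0 T)) (hq : ContinuousOn q (Set.Icc 0 T))
    (hG : ContinuousOn G (Set.Icc 0 T))
    (hdP : ∀ t ∈ Set.Ioo 0 T, HasDerivAt P (Complex.I * ν * P t + v t) t)
    (hdq : ∀ t ∈ Set.Ioo 0 T, HasDerivAt q (Complex.I * ν * q t + β * P t) t)
    (hdG : ∀ t ∈ Set.Ioo 0 T, HasDerivAt G (Complex.I * ν * G t + (γ * v t - β * q t)) t) :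
    ‖q 0‖ ^ 2 ≤ 3 * ‖γ * P 0 - G 0‖ ^ 2 + (2 * γ + 1) * ‖q T‖ ^ 2 +
      3 * |β| * ∫ t in (0 : ℝ)..T, ‖G t‖ ^ 2 := by
  -- `σ` is the sign of `β`; it orients the cross term of `Ψ`.
  obtain ⟨σ, hσ, hσ1⟩ : ∃ σ : ℝ, σ * β = |β| ∧ |σ| ≤ 1 := by
    rcases le_total 0 β with hβ | hβ
    · exact ⟨1, by rw [abs_of_nonneg hβ, one_mul], by simp⟩
    · exact ⟨-1, by rw [abs_of_nonpos hβ]; ring, by simp⟩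
  -- `v` cancels: `Z` is driven by `β q` only.
  set Z : ℝ → ℂ := fun t => γ * P t - G t with hZ
  have hZc : ContinuousOn Z (Set.Icc 0 T) := (continuousOn_const.mul hP).sub hG
  have hdZ : ∀ t ∈ Set.Ioo 0 T, HasDerivAt Z (Complex.I * ν * Z t + β * q t) t := by
    intro t ht
    convert! ((hdP t ht).const_mul (γ : ℂ)).sub (hdG t ht) using 1
    simp only [hZ]; ring
  -- The derivative of `γ |q|² - |Z|²` is `2 β Re (conj q * G)`. The cross term contributes `|β|
  -- (|q|² + Re (conj Z * P))`, which absorbs `q` and leaves only `G`. Since `|Z|²` enters with a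
  -- minus sign, nothing need be known about `Z T`.
  set Ψ : ℝ → ℂ := fun t => γ * (conj (q t) * q t) - conj (Z t) * Z t + σ * (conj (Z t) * q t)
    with hΨ
  have hΨc : ContinuousOn (fun t => -(Ψ t).re) (Set.Icc 0 T) := by
    have c1 := Complex.continuous_conj.comp_continuousOn hq
    have c2 := Complex.continuous_conj.comp_continuousOn hZc
    exact (Complex.continuous_re.comp_continuousOn
      (((continuousOn_const.mul (c1.mul hq)).sub (c2.mul hZc)).add
        (continuousOn_const.mul (c2.mul hq)))).neg
  have hΨd : ∀ t ∈ Set.Ioo 0 T, HasDerivAt (fun t => -(Ψ t).re)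
      (-(2 * β * (conj (q t) * G t).re + |β| * (‖q t‖ ^ 2 + (conj (Z t) * P t).re))) t := by
    intro t ht
    have hq' := hdq t ht
    have hZ' := hdZ t ht
    have hd := (Complex.reCLM.hasFDerivAt.comp_hasDerivAt t
      ((((hq'.star.mul hq').const_mul (γ : ℂ)).sub (hZ'.star.mul hZ')).add
        ((hZ'.star.mul hq').const_mul (σ : ℂ)))).neg
    convert! hd using 1
    have hGP : G t = γ * P t - Z t := by simp only [hZ]; ring
    rw [hGP, ← hσ, ← Complex.normSq_eq_norm_sq, Complex.normSq_apply]
    simp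
    ring
  have hle := intervalIntegral.sub_le_integral_of_hasDeriv_right_of_le hT hΨc
    (fun t ht => (hΨd t ht).hasDerivWithinAt) (φ := fun t => 3 / 2 * |β| * ‖G t‖ ^ 2)
    ((continuousOn_const.mul (hG.norm.pow 2)).integrableOn_Icc) (fun t _ => by
      have hGP : G t + Z t = γ * P t := by simp only [hZ]; ring
      have h1 : |(conj (q t) * G t).re| ≤ ‖q t‖ * ‖G t‖ := by
        refine (Complex.abs_re_le_norm _).trans ?_
        rw [norm_mul, RCLike.norm_conj]
      have h2 : |(conj (Z t) * G t).re| ≤ ‖Z t‖ * ‖G t‖ := by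
        refine (Complex.abs_re_le_norm _).trans ?_
        rw [norm_mul, RCLike.norm_conj]
      have h3 : γ * (conj (Z t) * P t).re = (conj (Z t) * G t).re + ‖Z t‖ ^ 2 := by
        have : γ * (conj (Z t) * P t).re = (conj (Z t) * (γ * P t)).re := by
          rw [mul_left_comm, Complex.re_ofReal_mul]
        rw [this, ← hGP, mul_add, Complex.add_re, mul_comm _ (Z t), mul_conj_self_eq,
          Complex.ofReal_re]
      have h4 : -(1 / 2 * ‖G t‖ ^ 2) ≤ (conj (Z t) * P t).re := by
        have h5 : -(1 / 2 * ‖G t‖ ^ 2) ≤ γ * (conj (Z t) * P t).re := by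
          rw [h3]
          nlinarith [(abs_le.1 h2).1, sq_nonneg (‖Z t‖ - ‖G t‖ / 2), sq_nonneg ‖G t‖]
        -- If `Re (conj Z * P)` were below this negative bound, multiplying it by `γ ≥ 1` would only
        -- lower it, against `h5`.
        by_contra hcon
        push Not at hcon
        nlinarith [sq_nonneg ‖G t‖]
      have h6 : -(|β| * (‖q t‖ * ‖G t‖)) ≤ β * (conj (q t) * G t).re := by
        have := neg_abs_le (β * (conj (q t) * G t).re)
        rw [abs_mul] at this
        have := mul_le_mul_of_nonneg_left h1 (abs_nonneg β)
        linarith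
      have h7 := mul_le_mul_of_nonneg_left h4 (abs_nonneg β)
      have h8 : |β| * (2 * (‖q t‖ * ‖G t‖)) ≤ |β| * (‖q t‖ ^ 2 + ‖G t‖ ^ 2) := by
        gcongr
        nlinarith [sq_nonneg (‖q t‖ - ‖G t‖)]
      linarith)
  rw [intervalIntegral.integral_const_mul] at hle
  have hΨre : ∀ t, (Ψ t).re = γ * ‖q t‖ ^ 2 - ‖Z t‖ ^ 2 + σ * (conj (Z t) * q t).re := by
    intro t
    simp only [hΨ, Complex.add_re, Complex.sub_re, Complex.re_ofReal_mul]
    rw [mul_comm (conj (q t)), mul_comm _ (Z t), mul_conj_self_eq, mul_conj_self_eq,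
      Complex.ofReal_re, Complex.ofReal_re]
  have hcross : ∀ t, |σ * (conj (Z t) * q t).re| ≤ 1 / 2 * ‖Z t‖ ^ 2 + 1 / 2 * ‖q t‖ ^ 2 := by
    intro t
    rw [abs_mul]
    have h1 : |(conj (Z t) * q t).re| ≤ ‖Z t‖ * ‖q t‖ := by
      refine (Complex.abs_re_le_norm _).trans ?_
      rw [norm_mul, RCLike.norm_conj]
    have h2 := mul_le_mul hσ1 h1 (abs_nonneg _) zero_le_one
    nlinarith [sq_nonneg (‖Z t‖ - ‖q t‖)]
  rw [hΨre, hΨre] at hle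
  have h0 := (abs_le.1 (hcross 0)).1
  have h1 := (abs_le.1 (hcross T)).2
  have h2 : ‖q 0‖ ^ 2 ≤ γ * ‖q 0‖ ^ 2 := le_mul_of_one_le_left (by positivity) hγ
  have h3 : 0 ≤ ‖Z T‖ ^ 2 := by positivity
  have h4 : ‖(γ : ℂ) * P 0 - G 0‖ = ‖Z 0‖ := rfl
  rw [h4]
  linarith

/-- Summation of estimates over consecutive intervals of comparable lengths. -/
theorem integral_le_of_blocks {T L C : ℝ} (hL : 0 < L) (hLT : L ≤ T) {g e : ℝ → ℝ}
    (hg : ContinuousOn g (Set.Icc 0 T)) (he : ContinuousOn e (Set.Icc 0 T))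
    (hb : ∀ a b, 0 ≤ a → b ≤ T → L ≤ b - a → b - a ≤ 2 * L →
      ∫ t in a..b, g t ≤ C * ∫ t in a..b, e t) :
    ∫ t in (0 : ℝ)..T, g t ≤ C * ∫ t in (0 : ℝ)..T, e t := by
  have hT : 0 ≤ T := hL.le.trans hLT
  -- Dividing `[0, T]` into `⌊T / L⌋` equal blocks leaves no remainder and gives lengths between `L`
  -- and `2 * L`.
  set M := ⌊T / L⌋₊ with hM
  have hM1 : 1 ≤ M := Nat.le_floor (by rw [Nat.cast_one, le_div_iff₀ hL]; linarith)
  have hM1' : (1 : ℝ) ≤ M := by exact_mod_cast hM1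
  have hMpos : (0 : ℝ) < M := by linarith
  have hle : (M : ℝ) * L ≤ T := by
    rw [← le_div_iff₀ hL]; exact Nat.floor_le (by positivity)
  have hlt : T < ((M : ℝ) + 1) * L := by
    rw [← div_lt_iff₀ hL]; exact Nat.lt_floor_add_one _
  set l := T / M with hl
  have hMl : (M : ℝ) * l = T := by rw [hl]; field_simp
  have hl0 : 0 ≤ l := by positivity
  have hl1 : L ≤ l := by rw [hl, le_div_iff₀ hMpos]; linarith
  have hl2 : l ≤ 2 * L := by rw [hl, div_le_iff₀ hMpos]; nlinarith
  set a : ℕ → ℝ := fun j => j * l with ha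
  have ha0 : a 0 = 0 := by simp [ha]
  have haM : a M = T := hMl
  have hstep : ∀ j, a (j + 1) - a j = l := fun j => by simp only [ha]; push_cast; ring
  have hpos : ∀ j, 0 ≤ a j := fun j => by simp only [ha]; positivity
  have htop : ∀ j < M, a (j + 1) ≤ T := by
    intro j hj
    rw [← hMl]
    simp only [ha]
    gcongr
    exact_mod_cast hj
  have hint : ∀ f : ℝ → ℝ, ContinuousOn f (Set.Icc 0 T) → ∀ j < M,
      IntervalIntegrable f volume (a j) (a (j + 1)) := fun f hf j hj =>
    (hf.mono (Set.Icc_subset_Icc (hpos j) (htop j hj))).intervalIntegrable_of_Icc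
      (by linarith [hstep j])
  have h1 := intervalIntegral.sum_integral_adjacent_intervals (hint g hg)
  have h2 := intervalIntegral.sum_integral_adjacent_intervals (hint e he)
  rw [ha0, haM] at h1 h2
  rw [← h1, ← h2, Finset.mul_sum]
  refine Finset.sum_le_sum fun j hj => ?_
  have hj := Finset.mem_range.1 hj
  exact hb _ _ (hpos j) (htop j hj) (by rw [hstep]; exact hl1) (by rw [hstep]; exact hl2)

end OscTurnpike

/-! ### The equation of the corrector, and the energy bound uniform in the horizon. -/

namespace OscTurnpike

open scoped ComplexConjugate
open Filter Topology

theorem sum_norm_sq_le_of_div {ι : Type*} {β : ι → ℝ} {A D : ℝ}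
    (hA : ∀ s : Finset ι, ∑ n ∈ s, β n ^ 2 ≤ A) (hβ : ∀ n, β n ≠ 0) {z : ι → ℂ}
    (hz : ∀ s : Finset ι, ∑ n ∈ s, ‖z n / β n‖ ^ 2 ≤ D) (s : Finset ι) :
    ∑ n ∈ s, ‖z n‖ ^ 2 ≤ A * D := by
  have hA0 : 0 ≤ A := by simpa using hA ∅
  calc ∑ n ∈ s, ‖z n‖ ^ 2 ≤ ∑ n ∈ s, A * ‖z n / β n‖ ^ 2 := by
        refine Finset.sum_le_sum fun n _ => ?_
        have : ‖z n‖ ^ 2 = β n ^ 2 * ‖z n / β n‖ ^ 2 := by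
          rw [norm_div, Complex.norm_real, Real.norm_eq_abs, div_pow, sq_abs,
            mul_div_cancel₀ _ (pow_ne_zero 2 (hβ n))]
        rw [this]
        gcongr
        simpa using hA {n}
    _ = A * ∑ n ∈ s, ‖z n / β n‖ ^ 2 := by rw [Finset.mul_sum]
    _ ≤ A * D := by gcongr; exact hz s

namespace ModalSystem

variable {ι : Type*} {ν β : ι → ℝ} {T : ℝ} {p q : ℝ → ι → ℂ} {v : ℝ → ℂ} {N : ℝ → ℝ} {A K : ℝ}
  (h : ModalSystem ν β T p q v N)

include h

theorem exists_p_bdd : ∃ M, ∀ t ∈ Set.Icc 0 T, ∀ s : Finset ι, ∑ n ∈ s, ‖p t n‖ ^ 2 ≤ M := by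
  obtain ⟨M, hM⟩ := isCompact_Icc.exists_bound_of_continuousOn h.N_cont
  exact ⟨M, fun t ht s => (h.sum_p_le ht s).trans ((le_abs_self _).trans (hM t ht))⟩

theorem tendstoUniformlyOn_corrector (hA : ∀ s : Finset ι, ∑ n ∈ s, β n ^ 2 ≤ A)
    (hK : ∀ n (s : Finset ι), ∑ m ∈ s, 1 / (ν m - ν n) ^ 2 ≤ K) (hK0 : 0 ≤ K) (n : ι) :
    TendstoUniformlyOn (fun (s : Finset ι) t =>
      ∑ m ∈ s, ((β m * (1 / (ν m - ν n)) : ℝ) : ℂ) * (-Complex.I * q t m) +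
        ∑ m ∈ s, ((β m * (1 / (ν m - ν n)) ^ 2 : ℝ) : ℂ) * p t m)
      (fun t => corrector ν β n (p t) (q t)) atTop (Set.Icc 0 T) := by
  obtain ⟨B, hB⟩ := h.q_bdd
  obtain ⟨M, hM⟩ := h.exists_p_bdd
  exact (tendstoUniformlyOn_sum_real_mul (sum_sq_mul_inv_le hA hK hK0 n)
      (f := fun t m => -Complex.I * q t m)
      (by simpa only [norm_neg_I_mul] using hB)
      (fun t ht => hasSum_corrector_fst hA hK hK0 n (hB t ht))).add
    (tendstoUniformlyOn_sum_real_mul (sum_sq_mul_inv_sq_le hA hK n) hM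
      (fun t ht => hasSum_corrector_snd hA hK n (hM t ht)))

theorem continuousOn_corrector (hA : ∀ s : Finset ι, ∑ n ∈ s, β n ^ 2 ≤ A)
    (hK : ∀ n (s : Finset ι), ∑ m ∈ s, 1 / (ν m - ν n) ^ 2 ≤ K) (hK0 : 0 ≤ K) (n : ι) :
    ContinuousOn (fun t => corrector ν β n (p t) (q t)) (Set.Icc 0 T) := by
  refine (h.tendstoUniformlyOn_corrector hA hK hK0 n).continuousOn
    (Eventually.frequently (Eventually.of_forall fun s => ?_))
  exact (continuousOn_finsetSum _ fun m _ =>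
      continuousOn_const.mul (continuousOn_const.mul (h.q_cont m))).add
    (continuousOn_finsetSum _ fun m _ => continuousOn_const.mul (h.p_cont m))

/-- Since `ν m / (ν m - ν n) = 1 + ν n / (ν m - ν n)`, the unbounded frequencies leave the
differentiated series. The ones rebuild `v` without its `n`-th term, the stray `p`-terms of the two
series cancel, and the forcing of `p` contributes `κ v`. Each resulting series converges uniformly
in time. -/
theorem hasDerivAt_corrector (hA : ∀ s : Finset ι, ∑ n ∈ s, β n ^ 2 ≤ A)
    (hK : ∀ n (s : Finset ι), ∑ m ∈ s, 1 / (ν m - ν n) ^ 2 ≤ K) (hK0 : 0 ≤ K)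
    (hν : Function.Injective ν) (n : ι) {t : ℝ} (ht : t ∈ Set.Ioo 0 T) :
    HasDerivAt (fun t => corrector ν β n (p t) (q t))
      (Complex.I * ν n * corrector ν β n (p t) (q t) +
        (((1 + ∑' m, (β m * (1 / (ν m - ν n))) ^ 2 : ℝ) : ℂ) * v t - β n * q t n)) t := by
  classical
  obtain ⟨B, hB⟩ := h.q_bdd
  obtain ⟨M, hM⟩ := h.exists_p_bdd
  obtain ⟨W, hW⟩ := isCompact_Icc.exists_bound_of_continuousOn h.v_cont
  have hρ := sum_sq_mul_inv_le hA hK hK0 n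
  have hκ : HasSum (fun m => (β m * (1 / (ν m - ν n))) ^ 2)
      (∑' m, (β m * (1 / (ν m - ν n))) ^ 2) :=
    (summable_of_sum_le (fun m => sq_nonneg _) hρ).hasSum
  set κ := ∑' m, (β m * (1 / (ν m - ν n))) ^ 2 with hκdef
  have hu1 := (h.tendstoUniformlyOn_corrector hA hK hK0 n)
  have hu2 := tendstoUniformlyOn_sum_real_mul hA hB h.v_sum
  have hu3 : TendstoUniformlyOn (fun (s : Finset ι) t =>
      ∑ m ∈ s, ((β m * (1 / (ν m - ν n)) : ℝ) : ℂ) * (((β m * (1 / (ν m - ν n)) : ℝ) : ℂ) * v t))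
      (fun t => (κ : ℂ) * v t) atTop (Set.Icc 0 T) := by
    refine tendstoUniformlyOn_sum_real_mul (B := A * K * W ^ 2) hρ
      (f := fun t m => ((β m * (1 / (ν m - ν n)) : ℝ) : ℂ) * v t) (fun t ht s => ?_)
      (fun t ht => ?_)
    · have h1 : ∑ m ∈ s, ‖((β m * (1 / (ν m - ν n)) : ℝ) : ℂ) * v t‖ ^ 2 =
          (∑ m ∈ s, (β m * (1 / (ν m - ν n))) ^ 2) * ‖v t‖ ^ 2 := by
        rw [Finset.sum_mul]
        refine Finset.sum_congr rfl fun m _ => ?_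
        rw [norm_mul, mul_pow, Complex.norm_real, Real.norm_eq_abs, sq_abs]
      rw [h1]
      have h2 := hW t ht
      have h3 : 0 ≤ A * K := by simpa using hρ ∅
      gcongr
      exact hρ s
    · convert! (Complex.hasSum_ofReal.2 hκ).mul_right (v t) using 2 with m
      push_cast; ring
  have hu4 := (ContinuousLinearMap.mul ℂ ℂ (Complex.I * ν n)).uniformContinuous.comp_tendstoUniformlyOn
    hu1
  have hconst : TendstoUniformlyOn (fun (_ : Finset ι) t => (β n : ℂ) * q t n)
      (fun t => (β n : ℂ) * q t n) atTop (Set.Icc 0 T) :=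
    Metric.tendstoUniformlyOn_iff.2 fun ε hε => Eventually.of_forall fun _ _ _ => by simpa using hε
  have hu := ((hu4.add ((hu2.add hu3).sub hconst))).mono Set.Ioo_subset_Icc_self
  have hd := hasDerivAt_of_tendstoUniformlyOn isOpen_Ioo hu (f := fun (s : Finset ι) t =>
      ∑ m ∈ s, ((β m * (1 / (ν m - ν n)) : ℝ) : ℂ) * (-Complex.I * q t m) +
        ∑ m ∈ s, ((β m * (1 / (ν m - ν n)) ^ 2 : ℝ) : ℂ) * p t m)
    -- The partial sums must contain `n`, so that subtracting `β n * q t n` removes one of their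
    -- terms.
    ((eventually_ge_atTop {n}).mono fun s hs t ht => ?_)
    (fun t ht => hu1.tendsto_at (Set.Ioo_subset_Icc_self ht)) ht
  · convert! hd using 1
    simp only [Pi.add_apply, Pi.sub_apply, Function.comp_apply, ContinuousLinearMap.mul_apply']
    push_cast; ring
  · have hn : n ∈ s := hs (Finset.mem_singleton_self n)
    have h1 : HasDerivAt (fun t => ∑ m ∈ s, ((β m * (1 / (ν m - ν n)) : ℝ) : ℂ) *
        (-Complex.I * q t m) + ∑ m ∈ s, ((β m * (1 / (ν m - ν n)) ^ 2 : ℝ) : ℂ) * p t m)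
        (∑ m ∈ s, ((β m * (1 / (ν m - ν n)) : ℝ) : ℂ) *
          (-Complex.I * (Complex.I * ν m * q t m + p t m)) +
        ∑ m ∈ s, ((β m * (1 / (ν m - ν n)) ^ 2 : ℝ) : ℂ) *
          (Complex.I * ν m * p t m + β m * v t)) t :=
      (HasDerivAt.fun_sum fun m _ => ((h.q_deriv m t ht).const_mul _).const_mul _).add
        (HasDerivAt.fun_sum fun m _ => (h.p_deriv m t ht).const_mul _)
    convert! h1 using 1
    simp only [Pi.add_apply, Pi.sub_apply, Function.comp_apply, ContinuousLinearMap.mul_apply']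
    have h2 : (β n : ℂ) * q t n = ∑ m ∈ s, if m = n then (β m : ℂ) * q t m else 0 := by
      rw [Finset.sum_ite_eq' s n, if_pos hn]
    rw [h2, mul_add, Finset.mul_sum, Finset.mul_sum, ← Finset.sum_add_distrib,
      ← Finset.sum_add_distrib, ← Finset.sum_sub_distrib, ← Finset.sum_add_distrib,
      ← Finset.sum_add_distrib]
    refine Finset.sum_congr rfl fun m _ => ?_
    by_cases hmn : m = n
    -- By `1 / 0 = 0` the mode `n` is absent from its own corrector.
    · subst hmn
      simp
    · have hne : ((ν m : ℂ) - ν n) ≠ 0 := by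
        exact_mod_cast sub_ne_zero.2 (hν.ne hmn)
      rw [if_neg hmn]
      push_cast
      field_simp
      ring_nf
      simp only [Complex.I_sq]
      ring

/-- Bounds for the boundary terms of the energy identity. -/
theorem boundary_le [Countable ι] (hA : ∀ s : Finset ι, ∑ n ∈ s, β n ^ 2 ≤ A)
    (hK : ∀ n (s : Finset ι), ∑ m ∈ s, 1 / (ν m - ν n) ^ 2 ≤ K) (hν : Function.Injective ν)
    (hT : 0 < T) {L : ℝ} (hL1 : 1 ≤ L) (hL : 120 * K ≤ L ^ 2) {D : ℝ}
    (hp : ∀ s : Finset ι, ∑ n ∈ s, ‖p 0 n / β n‖ ^ 2 ≤ D) (hβ : ∀ n, β n ≠ 0)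
    (hq : ∀ s : Finset ι, ∑ n ∈ s, ‖q T n‖ ^ 2 ≤ D) (s : Finset ι) :
    ∑ n ∈ s, ‖p T n‖ ^ 2 ≤
        (8 + 8 * A * L) * (D + ∫ t in (0 : ℝ)..T, (N t + ‖v t‖ ^ 2)) ∧
      ∑ n ∈ s, β n ^ 2 * ‖q 0 n‖ ^ 2 ≤
        (8 + 8 * A * L) * (D + ∫ t in (0 : ℝ)..T, (N t + ‖v t‖ ^ 2)) := by
  have hA0 : 0 ≤ A := by simpa using hA ∅
  have hD : 0 ≤ D := by simpa using hq ∅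
  have hL0 : 0 < L := by linarith
  have hβA : ∀ n, β n ^ 2 ≤ A := fun n => by simpa using hA {n}
  have hE := h.energy_nonneg le_rfl hT.le le_rfl
  have hv := h.integral_v_le_energy le_rfl hT.le le_rfl
  have hN := h.integral_N_le_energy le_rfl hT.le le_rfl
  set E := ∫ t in (0 : ℝ)..T, (N t + ‖v t‖ ^ 2) with hEdef
  have hAL : A ≤ A * L := le_mul_of_one_le_right hA0 hL1
  have h0 : (0 : ℝ) ∈ Set.Icc 0 T := ⟨le_rfl, hT.le⟩
  have h1 : T ∈ Set.Icc 0 T := ⟨hT.le, le_rfl⟩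
  -- A short horizon allows propagation from the opposite end, where the data are given. A long one
  -- contains full intervals of length `L` at both ends.
  rcases le_total T L with hTL | hTL
  · have hATL : A * T ≤ A * L := by gcongr
    constructor
    · have h2 := h.sum_p_le_of_mem hA le_rfl le_rfl h1 h0 s
      have h3 : ∑ n ∈ s, ‖p 0 n‖ ^ 2 ≤ A * D := sum_norm_sq_le_of_div hA hβ hp s
      have h4 : A * (T - 0) * ∫ t in (0 : ℝ)..T, ‖v t‖ ^ 2 ≤ A * L * E := by
        rw [sub_zero]
        have : 0 ≤ ∫ t in (0 : ℝ)..T, ‖v t‖ ^ 2 :=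
          intervalIntegral.integral_nonneg hT.le fun t _ => by positivity
        gcongr
      nlinarith [mul_le_mul_of_nonneg_right hAL hD, mul_nonneg (mul_nonneg hA0 hL0.le) hE,
        mul_nonneg (mul_nonneg hA0 hL0.le) hD]
    · have h2 := h.sum_q_le (w := fun n => β n ^ 2) le_rfl le_rfl (fun n => sq_nonneg _) hβA h0 h1 s
      have h3 : ∑ n ∈ s, β n ^ 2 * ‖q T n‖ ^ 2 ≤ A * D := by
        calc _ ≤ ∑ n ∈ s, A * ‖q T n‖ ^ 2 :=
              Finset.sum_le_sum fun n _ => by gcongr; exact hβA n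
          _ = A * ∑ n ∈ s, ‖q T n‖ ^ 2 := by rw [Finset.mul_sum]
          _ ≤ A * D := by gcongr; exact hq s
      have h4 : A * (T - 0) * ∫ t in (0 : ℝ)..T, N t ≤ A * L * E := by
        rw [sub_zero]
        have : 0 ≤ ∫ t in (0 : ℝ)..T, N t :=
          intervalIntegral.integral_nonneg hT.le fun t ht => h.N_nonneg ht
        gcongr
      nlinarith [mul_le_mul_of_nonneg_right hAL hD, mul_nonneg (mul_nonneg hA0 hL0.le) hE,
        mul_nonneg (mul_nonneg hA0 hL0.le) hD]
  · constructor
    · have hTL0 : 0 ≤ T - L := sub_nonneg.2 hTL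
      have hTLT : T - L ≤ T := by linarith
      have hsub : Set.Icc (T - L) T ⊆ Set.Icc 0 T := Set.Icc_subset_Icc hTL0 le_rfl
      have h2 : ∀ t ∈ Set.Icc (T - L) T, ∑ n ∈ s, ‖p T n‖ ^ 2 ≤ 2 * N t + 2 * A * L * E := by
        intro t ht
        have h3 := h.sum_p_le_of_mem hA hTL0 le_rfl ⟨hTLT, le_rfl⟩ ht s
        have h4 := h.sum_p_le (hsub ht) s
        have h5 : A * (T - (T - L)) * ∫ t in (T - L)..T, ‖v t‖ ^ 2 ≤ A * L * E := by
          rw [sub_sub_cancel]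
          gcongr
          exact (h.integral_v_le_energy hTL0 hTLT le_rfl).trans (h.energy_mono hTL0 hTLT le_rfl)
        linarith
      have hNi : ContinuousOn (fun t => 2 * N t) (Set.Icc (T - L) T) :=
        continuousOn_const.mul (h.N_cont.mono hsub)
      -- Averaging over the last interval turns the pointwise `N t` into energy.
      have h6 := intervalIntegral.integral_mono_on (f := fun _ => ∑ n ∈ s, ‖p T n‖ ^ 2)
        (g := fun t => 2 * N t + 2 * A * L * E) (μ := volume) hTLT
        intervalIntegrable_const
        ((hNi.add continuousOn_const).intervalIntegrable_of_Icc hTLT) h2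
      rw [intervalIntegral.integral_const, intervalIntegral.integral_add
        (hNi.intervalIntegrable_of_Icc hTLT) (by simp), intervalIntegral.integral_const,
        intervalIntegral.integral_const_mul, sub_sub_cancel, smul_eq_mul, smul_eq_mul] at h6
      have h7 := (h.integral_N_le_energy hTL0 hTLT le_rfl).trans (h.energy_mono hTL0 hTLT le_rfl)
      have h8 : L * ∑ n ∈ s, ‖p T n‖ ^ 2 ≤ L * (2 * E + 2 * A * L * E) := by
        nlinarith [mul_le_mul_of_nonneg_right hL1 hE]
      have h9 := le_of_mul_le_mul_left h8 hL0
      nlinarith [mul_nonneg (mul_nonneg hA0 hL0.le) hE, mul_nonneg (mul_nonneg hA0 hL0.le) hD]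
    · have h2 := h.sum_sq_mul_q_left_le hA hK hν le_rfl hL0 hTL (by simpa using hL) s
      rw [sub_zero] at h2
      have h3 := h.energy_mono le_rfl hL0.le hTL
      have h4 := h.energy_nonneg le_rfl hL0.le hTL
      have h5 : 8 / L ≤ 8 := div_le_self (by norm_num) hL1
      calc _ ≤ _ := h2
        _ ≤ (8 + 8 * A * L) * E := by gcongr
        _ ≤ _ := by gcongr; linarith

/-- The energy of the discrepancy is bounded independently of the horizon. -/
theorem energy_le_of_boundary [Countable ι] (hA : ∀ s : Finset ι, ∑ n ∈ s, β n ^ 2 ≤ A)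
    (hT : 0 < T) {C D : ℝ} (hC : 0 < C)
    (hp : ∀ s : Finset ι, ∑ n ∈ s, ‖p 0 n / β n‖ ^ 2 ≤ D) (hβ : ∀ n, β n ≠ 0)
    (hq : ∀ s : Finset ι, ∑ n ∈ s, ‖q T n‖ ^ 2 ≤ D)
    (hpT : ∀ s : Finset ι, ∑ n ∈ s, ‖p T n‖ ^ 2 ≤
      C * (D + ∫ t in (0 : ℝ)..T, (N t + ‖v t‖ ^ 2)))
    (hq0 : ∀ s : Finset ι, ∑ n ∈ s, β n ^ 2 * ‖q 0 n‖ ^ 2 ≤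
      C * (D + ∫ t in (0 : ℝ)..T, (N t + ‖v t‖ ^ 2))) :
    ∫ t in (0 : ℝ)..T, (N t + ‖v t‖ ^ 2) ≤ (1 + 4 * C) * D := by
  set E := ∫ t in (0 : ℝ)..T, (N t + ‖v t‖ ^ 2) with hE
  -- With these Young weights each of the two unknown boundary norms returns `(D + E) / 4`, so half
  -- of `E` is absorbed.
  have hre : ∀ z w : ℂ, |(conj z * w).re| ≤ ‖z‖ ^ 2 / (4 * C) + C * ‖w‖ ^ 2 := by
    intro z w
    refine (Complex.abs_re_le_norm _).trans ?_
    rw [norm_mul, RCLike.norm_conj, div_add' _ _ _ (by positivity), le_div_iff₀ (by positivity)]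
    nlinarith [sq_nonneg (‖z‖ - 2 * C * ‖w‖)]
  have hkey : E ≤ 1 / (4 * C) * (C * (D + E)) + C * D + (C * D + 1 / (4 * C) * (C * (D + E))) := by
    refine h.energy_le hT.le hA fun s => ?_
    calc ∑ n ∈ s, ((conj (p T n) * q T n).re - (conj (p 0 n) * q 0 n).re)
        ≤ ∑ n ∈ s, ((1 / (4 * C) * ‖p T n‖ ^ 2 + C * ‖q T n‖ ^ 2) +
            (C * ‖p 0 n / β n‖ ^ 2 + 1 / (4 * C) * (β n ^ 2 * ‖q 0 n‖ ^ 2))) := by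
          refine Finset.sum_le_sum fun n _ => ?_
          have h1 := (abs_le.1 (hre (p T n) (q T n))).2
          -- The factor `β n` is shifted from `p` to `q`: the datum is `p / β`, the observable
          -- quantity `β q`.
          have h2 := (abs_le.1 (hre (β n * q 0 n) (p 0 n / β n))).1
          have hβc : (β n : ℂ) ≠ 0 := by exact_mod_cast hβ n
          have h3 : (conj (β n * q 0 n) * (p 0 n / β n)).re = (conj (p 0 n) * q 0 n).re := by
            have : conj (β n * q 0 n) * (p 0 n / β n) = conj (conj (p 0 n) * q 0 n) := by
              simp only [map_mul, Complex.conj_ofReal, Complex.conj_conj]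
              field_simp
            rw [this, Complex.conj_re]
          rw [h3, norm_mul, Complex.norm_real, Real.norm_eq_abs, mul_pow, sq_abs] at h2
          rw [one_div_mul_eq_div, one_div_mul_eq_div]
          linarith
      _ = (1 / (4 * C) * ∑ n ∈ s, ‖p T n‖ ^ 2 + C * ∑ n ∈ s, ‖q T n‖ ^ 2) +
            (C * ∑ n ∈ s, ‖p 0 n / β n‖ ^ 2 + 1 / (4 * C) * ∑ n ∈ s, β n ^ 2 * ‖q 0 n‖ ^ 2) := by
          simp only [Finset.sum_add_distrib, Finset.mul_sum]
      _ ≤ _ := by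
          have h1 := hpT s
          have h2 := hq s
          have h3 := hp s
          have h4 := hq0 s
          gcongr
  have h5 : 1 / (4 * C) * (C * (D + E)) = (D + E) / 4 := by field_simp
  rw [h5] at hkey
  linarith

end ModalSystem

end OscTurnpike

/-! ### Unweighted bound for the adjoint at the initial time. -/

namespace OscTurnpike

open scoped ComplexConjugate
open Filter Topology

namespace ModalSystem

variable {ι : Type*} {ν β : ι → ℝ} {T : ℝ} {p q : ℝ → ι → ℂ} {v : ℝ → ℂ} {N : ℝ → ℝ} {A K : ℝ}
  (h : ModalSystem ν β T p q v N)

include h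

/-- On each block observability bounds the weighted norm of `q` at every time by the energy of that
same block, so summing over blocks produces no factor `T`. -/
theorem integral_corrector_le [Countable ι] (hA : ∀ s : Finset ι, ∑ n ∈ s, β n ^ 2 ≤ A)
    (hK : ∀ n (s : Finset ι), ∑ m ∈ s, 1 / (ν m - ν n) ^ 2 ≤ K) (hK0 : 0 ≤ K)
    (hν : Function.Injective ν) {L : ℝ} (hL1 : 1 ≤ L) (hL : 120 * K ≤ L ^ 2) (hTL : L ≤ T)
    (s : Finset ι) :
    ∫ t in (0 : ℝ)..T, ∑ n ∈ s, ‖corrector ν β n (p t) (q t)‖ ^ 2 ≤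
      (2 * L * (8 * (5 + 28 * K) ^ 2 * (16 + 36 * A * L)) + 2 * A * K ^ 2) *
        ∫ t in (0 : ℝ)..T, (N t + ‖v t‖ ^ 2) := by
  have hA0 : 0 ≤ A := by simpa using hA ∅
  have hL0 : 0 < L := by linarith
  have hc : ContinuousOn (fun t => ∑ n ∈ s, ‖corrector ν β n (p t) (q t)‖ ^ 2) (Set.Icc 0 T) :=
    continuousOn_finsetSum _ fun n _ => (h.continuousOn_corrector hA hK hK0 n).norm.pow 2
  obtain ⟨B, hB⟩ := h.q_bdd
  refine integral_le_of_blocks hL0 hTL hc h.energy_cont fun a b ha hb hab1 hab2 => ?_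
  have hab : a < b := by linarith
  have hsub : Set.Icc a b ⊆ Set.Icc 0 T := Set.Icc_subset_Icc ha hb
  have hE := h.energy_nonneg ha hab.le hb
  have hN := h.integral_N_le_energy ha hab.le hb
  have hobs := fun t (ht : t ∈ Set.Icc a b) => h.sum_sq_mul_q_le hA hK hν ha hab hb
    (hL.trans (by gcongr)) ht
  set E := ∫ t in a..b, (N t + ‖v t‖ ^ 2) with hEdef
  have hCb : 16 / (b - a) + 18 * A * (b - a) ≤ 16 + 36 * A * L := by
    have h1 : 16 / (b - a) ≤ 16 := div_le_self (by norm_num) (by linarith)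
    nlinarith
  have hpt : ∀ t ∈ Set.Icc a b, ∑ n ∈ s, ‖corrector ν β n (p t) (q t)‖ ^ 2 ≤
      8 * (5 + 28 * K) ^ 2 * ((16 + 36 * A * L) * E) + 2 * A * K ^ 2 * N t := by
    intro t ht
    refine sum_norm_sq_corrector_le hA hK hK0 hν (hB t (hsub ht)) (h.sum_p_le (hsub ht))
      (fun S => (hobs t ht S).trans ?_) s
    gcongr
  have hNi : ContinuousOn (fun t => 2 * A * K ^ 2 * N t) (Set.Icc a b) :=
    continuousOn_const.mul (h.N_cont.mono hsub)
  calc _ ≤ ∫ t in a..b, (8 * (5 + 28 * K) ^ 2 * ((16 + 36 * A * L) * E) + 2 * A * K ^ 2 * N t) :=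
        intervalIntegral.integral_mono_on hab.le
          ((hc.mono hsub).intervalIntegrable_of_Icc hab.le)
          ((continuousOn_const.add hNi).intervalIntegrable_of_Icc hab.le) hpt
    _ = (b - a) * (8 * (5 + 28 * K) ^ 2 * ((16 + 36 * A * L) * E)) +
        2 * A * K ^ 2 * ∫ t in a..b, N t := by
        rw [intervalIntegral.integral_add (by simp) (hNi.intervalIntegrable_of_Icc hab.le),
          intervalIntegral.integral_const, smul_eq_mul, intervalIntegral.integral_const_mul]
    _ ≤ (2 * L) * (8 * (5 + 28 * K) ^ 2 * ((16 + 36 * A * L) * E)) + 2 * A * K ^ 2 * E := by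
        gcongr
    _ = _ := by ring

/-- The initial value of `q` in terms of the normal form, for long horizons. -/
theorem sum_q_zero_le_of_corrector (hA : ∀ s : Finset ι, ∑ n ∈ s, β n ^ 2 ≤ A)
    (hK : ∀ n (s : Finset ι), ∑ m ∈ s, 1 / (ν m - ν n) ^ 2 ≤ K) (hK0 : 0 ≤ K)
    (hν : Function.Injective ν) (hβ : ∀ n, β n ≠ 0) (hT : 0 < T) {D : ℝ}
    (hp : ∀ s : Finset ι, ∑ n ∈ s, ‖p 0 n / β n‖ ^ 2 ≤ D)
    (hq : ∀ s : Finset ι, ∑ n ∈ s, ‖q T n‖ ^ 2 ≤ D) (s : Finset ι) :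
    ∑ n ∈ s, ‖q 0 n‖ ^ 2 ≤ (6 * (1 + A * K) ^ 2 + (3 + 2 * (A * K))) * D +
      6 * ∑ n ∈ s, ‖corrector ν β n (p 0) (q 0)‖ ^ 2 +
      3 * (1 + A) * ∫ t in (0 : ℝ)..T, ∑ n ∈ s, ‖corrector ν β n (p t) (q t)‖ ^ 2 := by
  have hA0 : 0 ≤ A := by simpa using hA ∅
  have hβA : ∀ n, β n ^ 2 ≤ A := fun n => by simpa using hA {n}
  have hci := fun n => h.continuousOn_corrector hA hK hK0 n
  have hii : ∀ n ∈ s, IntervalIntegrable (fun t => ‖corrector ν β n (p t) (q t)‖ ^ 2) volume 0 T :=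
    fun n _ => ((hci n).norm.pow 2).intervalIntegrable_of_Icc hT.le
  rw [intervalIntegral.integral_finsetSum hii]
  have hmode : ∀ n, ‖q 0 n‖ ^ 2 ≤ 6 * (1 + A * K) ^ 2 * ‖p 0 n / β n‖ ^ 2 +
      (3 + 2 * (A * K)) * ‖q T n‖ ^ 2 + 6 * ‖corrector ν β n (p 0) (q 0)‖ ^ 2 +
      3 * (1 + A) * ∫ t in (0 : ℝ)..T, ‖corrector ν β n (p t) (q t)‖ ^ 2 := by
    intro n
    have hβc : (β n : ℂ) ≠ 0 := by exact_mod_cast hβ n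
    set κ := ∑' m, (β m * (1 / (ν m - ν n))) ^ 2 with hκ
    have hκ0 : 0 ≤ κ := tsum_nonneg fun m => sq_nonneg _
    have hκ1 : κ ≤ A * K := Real.tsum_le_of_sum_le (fun m => sq_nonneg _)
      (sum_sq_mul_inv_le hA hK hK0 n)
    -- After division by `β n` the forcing of `p` is `v` for every mode, with the same weight. The
    -- bounds `κ ≤ A * K` and `|β n| ≤ 1 + A` make the estimate uniform in `n`.
    have hm := mode_bound (T := T) (β := β n) (γ := 1 + κ) (ν := ν n) (P := fun t => p t n / β n)
      (q := fun t => q t n) (G := fun t => corrector ν β n (p t) (q t)) (v := v) hT.le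
      (by linarith) ((h.p_cont n).div_const _) (h.q_cont n) (hci n)
      (fun t ht => by
        convert! (h.p_deriv n t ht).div_const (β n : ℂ) using 1
        field_simp)
      (fun t ht => by
        convert! h.q_deriv n t ht using 1
        field_simp)
      (fun t ht => h.hasDerivAt_corrector hA hK hK0 hν n ht)
    refine hm.trans ?_
    have hi : 0 ≤ ∫ t in (0 : ℝ)..T, ‖corrector ν β n (p t) (q t)‖ ^ 2 :=
      intervalIntegral.integral_nonneg hT.le fun t _ => by positivity
    have h1 : |β n| ≤ 1 + A := by
      nlinarith [hβA n, sq_abs (β n), sq_nonneg (|β n| - 1), abs_nonneg (β n)]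
    have h2 : ‖((1 + κ : ℝ) : ℂ) * (p 0 n / β n) - corrector ν β n (p 0) (q 0)‖ ^ 2 ≤
        2 * ((1 + A * K) ^ 2 * ‖p 0 n / β n‖ ^ 2) + 2 * ‖corrector ν β n (p 0) (q 0)‖ ^ 2 := by
      have h3 := norm_sub_le (((1 + κ : ℝ) : ℂ) * (p 0 n / β n)) (corrector ν β n (p 0) (q 0))
      have h4 : ‖((1 + κ : ℝ) : ℂ) * (p 0 n / β n)‖ ≤ (1 + A * K) * ‖p 0 n / β n‖ := by
        rw [norm_mul, Complex.norm_real, Real.norm_eq_abs, abs_of_nonneg (by linarith)]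
        gcongr
      have h5 := pow_le_pow_left₀ (norm_nonneg _) (h3.trans (add_le_add_left h4 _)) 2
      nlinarith [sq_nonneg ((1 + A * K) * ‖p 0 n / β n‖ - ‖corrector ν β n (p 0) (q 0)‖)]
    have h6 : (2 * (1 + κ) + 1) * ‖q T n‖ ^ 2 ≤ (3 + 2 * (A * K)) * ‖q T n‖ ^ 2 :=
      mul_le_mul_of_nonneg_right (by linarith) (by positivity)
    have h7 : |β n| * (∫ t in (0 : ℝ)..T, ‖corrector ν β n (p t) (q t)‖ ^ 2) ≤
        (1 + A) * ∫ t in (0 : ℝ)..T, ‖corrector ν β n (p t) (q t)‖ ^ 2 := by gcongr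
    linarith
  calc _ ≤ _ := Finset.sum_le_sum fun n _ => hmode n
    _ = 6 * (1 + A * K) ^ 2 * ∑ n ∈ s, ‖p 0 n / β n‖ ^ 2 +
      (3 + 2 * (A * K)) * ∑ n ∈ s, ‖q T n‖ ^ 2 +
      6 * ∑ n ∈ s, ‖corrector ν β n (p 0) (q 0)‖ ^ 2 +
      3 * (1 + A) * ∑ n ∈ s, ∫ t in (0 : ℝ)..T, ‖corrector ν β n (p t) (q t)‖ ^ 2 := by
        simp only [Finset.sum_add_distrib, Finset.mul_sum]
    _ ≤ 6 * (1 + A * K) ^ 2 * D + (3 + 2 * (A * K)) * D +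
      6 * ∑ n ∈ s, ‖corrector ν β n (p 0) (q 0)‖ ^ 2 +
      3 * (1 + A) * ∑ n ∈ s, ∫ t in (0 : ℝ)..T, ‖corrector ν β n (p t) (q t)‖ ^ 2 := by
        have h1 := hp s
        have h2 := hq s
        have h3 : 0 ≤ A * K := by positivity
        gcongr
    _ = _ := by ring

end ModalSystem

/-- Horizon-independent bounds for the optimality system in modal coordinates. -/
theorem exists_modal_bound {ι : Type*} [Countable ι] {ν β : ι → ℝ} {A K : ℝ}
    (hA : ∀ s : Finset ι, ∑ n ∈ s, β n ^ 2 ≤ A)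
    (hK : ∀ n (s : Finset ι), ∑ m ∈ s, 1 / (ν m - ν n) ^ 2 ≤ K) (hK0 : 0 ≤ K)
    (hν : Function.Injective ν) (hβ : ∀ n, β n ≠ 0) :
    ∃ C : ℝ, 0 ≤ C ∧ ∀ (T : ℝ), 0 < T → ∀ (p q : ℝ → ι → ℂ) (v : ℝ → ℂ) (N : ℝ → ℝ),
      ModalSystem ν β T p q v N → ∀ D : ℝ, (∀ s : Finset ι, ∑ n ∈ s, ‖p 0 n / β n‖ ^ 2 ≤ D) →
      (∀ s : Finset ι, ∑ n ∈ s, ‖q T n‖ ^ 2 ≤ D) → ∀ s : Finset ι,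
      ∑ n ∈ s, ‖q 0 n‖ ^ 2 ≤ C * D ∧ ∑ n ∈ s, ‖p T n‖ ^ 2 ≤ C * D := by
  have hA0 : 0 ≤ A := by simpa using hA ∅
  have hβA : ∀ n, β n ^ 2 ≤ A := fun n => by simpa using hA {n}
  -- Long enough for Ingham's inequality; the added `1` ensures `1 ≤ L`.
  set L := Real.sqrt (120 * K) + 1 with hLdef
  have hL1 : 1 ≤ L := by have := Real.sqrt_nonneg (120 * K); linarith
  have hL0 : 0 < L := by linarith
  have hL : 120 * K ≤ L ^ 2 := by
    have h1 := Real.sq_sqrt (show 0 ≤ 120 * K by positivity)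
    have h2 := Real.sqrt_nonneg (120 * K)
    nlinarith
  set C1 := 8 + 8 * A * L with hC1
  have hC1pos : 0 < C1 := by positivity
  set C2 := 1 + 4 * C1 with hC2
  set C3 := 2 * L * (8 * (5 + 28 * K) ^ 2 * (16 + 36 * A * L)) + 2 * A * K ^ 2 with hC3
  set C4 := 8 * (5 + 28 * K) ^ 2 * (C1 * (1 + C2)) + 2 * A * K ^ 2 * A with hC4
  set Cshort := 2 + 2 * L * C2 with hCs
  set Clong := 6 * (1 + A * K) ^ 2 + (3 + 2 * (A * K)) + 6 * C4 + 3 * (1 + A) * (C3 * C2) with hCl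
  have hs0 : 0 ≤ Cshort := by positivity
  have hl0 : 0 ≤ Clong := by positivity
  refine ⟨Cshort + Clong + C1 * (1 + C2), by positivity, ?_⟩
  intro T hT p q v N h D hp hq
  have hD : 0 ≤ D := by simpa using hq ∅
  have hbd := h.boundary_le hA hK hν hT hL1 hL hp hβ hq
  have hE := h.energy_le_of_boundary hA hT hC1pos hp hβ hq (fun s => (hbd s).1) fun s => (hbd s).2
  have hE0 := h.energy_nonneg le_rfl hT.le le_rfl
  have hNE := h.integral_N_le_energy le_rfl hT.le le_rfl
  set E := ∫ t in (0 : ℝ)..T, (N t + ‖v t‖ ^ 2) with hEdef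
  have hDE : C1 * (D + E) ≤ C1 * (1 + C2) * D := by
    rw [mul_assoc]; gcongr; linarith
  have h0 : (0 : ℝ) ∈ Set.Icc 0 T := ⟨le_rfl, hT.le⟩
  intro s
  have hpT := (hbd s).1.trans hDE
  have hq0 : ∑ n ∈ s, ‖q 0 n‖ ^ 2 ≤ (Cshort + Clong) * D := by
    -- For `T ≤ L` the value at `T` is simply propagated back; the block argument needs `L ≤ T`.
    rcases le_total T L with hTL | hTL
    · have h1 := h.sum_q_le (w := fun _ => 1) le_rfl le_rfl (fun _ => zero_le_one)
        (fun _ => le_rfl) h0 ⟨hT.le, le_rfl⟩ s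
      simp only [one_mul, mul_one, sub_zero] at h1
      have h2 : 2 * T * ∫ t in (0 : ℝ)..T, N t ≤ 2 * L * (C2 * D) := by
        have h3 := hNE.trans hE
        have h4 : 0 ≤ ∫ t in (0 : ℝ)..T, N t :=
          intervalIntegral.integral_nonneg hT.le fun t ht => h.N_nonneg ht
        exact mul_le_mul (by linarith) h3 h4 (by linarith)
      have h5 := hq s
      have h6 := mul_nonneg hl0 hD
      rw [hCs]
      linarith
    · have h1 := h.sum_q_zero_le_of_corrector hA hK hK0 hν hβ hT hp hq s
      have h2 := h.integral_corrector_le hA hK hK0 hν hL1 hL hTL s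
      obtain ⟨B, hB⟩ := h.q_bdd
      have hp0 := sum_norm_sq_le_of_div hA hβ hp
      have h3 := sum_norm_sq_corrector_le hA hK hK0 hν (hB 0 h0) hp0
        (fun S => (hbd S).2.trans hDE) s
      have h4 : ∫ t in (0 : ℝ)..T, ∑ n ∈ s, ‖corrector ν β n (p t) (q t)‖ ^ 2 ≤ C3 * (C2 * D) :=
        h2.trans (by gcongr)
      have h5 : ∑ n ∈ s, ‖corrector ν β n (p 0) (q 0)‖ ^ 2 ≤ C4 * D := by
        refine h3.trans (le_of_eq ?_)
        rw [hC4]; ring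
      have h6 := mul_nonneg hs0 hD
      have h7 := mul_le_mul_of_nonneg_left h4 (show 0 ≤ 3 * (1 + A) by positivity)
      have h8 : Clong * D = (6 * (1 + A * K) ^ 2 + (3 + 2 * (A * K))) * D + 6 * (C4 * D) +
          3 * (1 + A) * (C3 * (C2 * D)) := by rw [hCl]; ring
      linarith
  have h9 : 0 ≤ C1 * (1 + C2) * D := by positivity
  have h10 := mul_nonneg (add_nonneg hs0 hl0) hD
  constructor <;> linarith

end OscTurnpike

namespace OscTurnpike

open Filter Topology

/-! ### Coordinates and inner products in the state space. -/

section Coordinates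

theorem continuous_ell2_apply (k : ℕ) : Continuous fun y : Ell2 ℝ => y k :=
  LipschitzWith.continuous (K := 1) <| LipschitzWith.of_dist_le_mul fun x y => by
    rw [dist_eq_norm, dist_eq_norm, NNReal.coe_one, one_mul, ← Pi.sub_apply, ← lp.coeFn_sub]
    exact lp.norm_apply_le_norm (by norm_num) _ _

theorem continuous_fst_apply (k : ℕ) : Continuous fun y : H => y.fst k :=
  (continuous_ell2_apply k).comp (by fun_prop : Continuous fun y : H => y.fst)

theorem continuous_snd_apply (k : ℕ) : Continuous fun y : H => y.snd k :=
  (continuous_ell2_apply k).comp (by fun_prop : Continuous fun y : H => y.snd)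

theorem hasSum_ell2_inner (x y : Ell2 ℝ) : HasSum (fun k => x k * y k) (inner ℝ x y) := by
  have := lp.hasSum_inner (𝕜 := ℝ) x y
  simpa [mul_comm] using this

theorem hasSum_ell2_norm_sq (x : Ell2 ℝ) : HasSum (fun k => x k ^ 2) (‖x‖ ^ 2) := by
  have := hasSum_ell2_inner x x
  rw [real_inner_self_eq_norm_sq] at this
  simpa [sq] using this

theorem hasSum_inner_H (x y : H) :
    HasSum (fun k => x.fst k * y.fst k + x.snd k * y.snd k) (inner ℝ x y) := by
  rw [WithLp.prod_inner_apply]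
  exact (hasSum_ell2_inner _ _).add (hasSum_ell2_inner _ _)

theorem inner_vecB (b : Ell2 ℝ) (y : H) : inner ℝ (vecB b) y = inner ℝ b y.snd := by
  rw [WithLp.prod_inner_apply]
  simp [vecB]

theorem hasSum_norm_sq_H (x : H) : HasSum (fun k => x.fst k ^ 2 + x.snd k ^ 2) (‖x‖ ^ 2) := by
  rw [WithLp.prod_norm_sq_eq_of_L2]
  exact (hasSum_ell2_norm_sq _).add (hasSum_ell2_norm_sq _)

theorem abs_sum_inner_le (x y : H) (s : Finset ℕ) :
    |∑ k ∈ s, (x.fst k * y.fst k + x.snd k * y.snd k)| ≤ ‖x‖ ^ 2 + ‖y‖ ^ 2 := by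
  have hx := sum_le_hasSum s (fun k _ => by positivity) (hasSum_norm_sq_H x)
  have hy := sum_le_hasSum s (fun k _ => by positivity) (hasSum_norm_sq_H y)
  refine (Finset.abs_sum_le_sum_abs _ _).trans (le_trans ?_ (add_le_add hx hy))
  rw [← Finset.sum_add_distrib]
  refine Finset.sum_le_sum fun k _ => abs_le.2 ⟨?_, ?_⟩
  · nlinarith [sq_nonneg (x.fst k + y.fst k), sq_nonneg (x.snd k + y.snd k),
      sq_nonneg (x.fst k), sq_nonneg (x.snd k), sq_nonneg (y.fst k), sq_nonneg (y.snd k)]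
  · nlinarith [sq_nonneg (x.fst k - y.fst k), sq_nonneg (x.snd k - y.snd k),
      sq_nonneg (x.fst k), sq_nonneg (x.snd k), sq_nonneg (y.fst k), sq_nonneg (y.snd k)]

theorem abs_sum_ell2_inner_le (x y : Ell2 ℝ) (s : Finset ℕ) :
    |∑ k ∈ s, x k * y k| ≤ ‖x‖ ^ 2 + ‖y‖ ^ 2 := by
  have hx := sum_le_hasSum s (fun k _ => by positivity) (hasSum_ell2_norm_sq x)
  have hy := sum_le_hasSum s (fun k _ => by positivity) (hasSum_ell2_norm_sq y)
  refine (Finset.abs_sum_le_sum_abs _ _).trans (le_trans ?_ (add_le_add hx hy))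
  rw [← Finset.sum_add_distrib]
  refine Finset.sum_le_sum fun k _ => abs_le.2 ⟨?_, ?_⟩
  · nlinarith [sq_nonneg (x k + y k), sq_nonneg (x k), sq_nonneg (y k)]
  · nlinarith [sq_nonneg (x k - y k), sq_nonneg (x k), sq_nonneg (y k)]

end Coordinates

/-! ### Variations of the state. -/

section Variation

/-- A curve in `ℓ²` assembled from dominated continuous coordinates. -/
theorem exists_continuous_ell2 (b : Ell2 ℝ) (f : ℕ → ℝ → ℝ) (hf : ∀ k, Continuous (f k))
    (m : ℝ → ℝ) (hm : Continuous m) (hb : ∀ k t, |f k t| ≤ |b k| * m t) :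
    ∃ y : ℝ → Ell2 ℝ, Continuous y ∧ ∀ t k, y t k = f k t := by
  have hbs := (hasSum_ell2_norm_sq b).summable
  have hmem : ∀ t, Memℓp (fun k => f k t) 2 := fun t => memℓp_gen (by
    refine Summable.of_nonneg_of_le (fun k => by positivity) (fun k => ?_) (hbs.mul_right (m t ^ 2))
    simp only [ENNReal.toReal_ofNat, Real.rpow_two, Real.norm_eq_abs]
    rw [← sq_abs (b k), ← mul_pow]
    exact pow_le_pow_left₀ (abs_nonneg _) (hb k t) 2)
  refine ⟨fun t => ⟨fun k => f k t, hmem t⟩, ?_, fun t k => rfl⟩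
  set y : ℝ → Ell2 ℝ := fun t => ⟨fun k => f k t, hmem t⟩ with hy
  refine continuous_iff_continuousAt.2 fun t0 => ?_
  have key : Tendsto (fun t => ‖y t - y t0‖ ^ 2) (𝓝 t0) (𝓝 0) := by
    have h1 : ∀ t, ‖y t - y t0‖ ^ 2 = ∑' k, (f k t - f k t0) ^ 2 := fun t =>
      ((hasSum_ell2_norm_sq (y t - y t0)).tsum_eq).symm
    have h2 : (0 : ℝ) = ∑' k : ℕ, (0 : ℝ) := tsum_zero.symm
    simp_rw [h1]
    rw [h2]
    refine tendsto_tsum_of_dominated_convergence (bound := fun k => b k ^ 2 * (2 * m t0 + 1) ^ 2)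
      (hbs.mul_right _) (fun k => ?_) ?_
    · have := (((hf k).tendsto t0).sub_const (f k t0)).pow 2
      simpa using this
    · have hev : ∀ᶠ t in 𝓝 t0, m t < m t0 + 1 :=
        (hm.tendsto t0).eventually_lt_const (by linarith)
      filter_upwards [hev] with t ht k
      rw [Real.norm_eq_abs, abs_of_nonneg (sq_nonneg _), ← sq_abs (b k), ← mul_pow, ← sq_abs]
      refine pow_le_pow_left₀ (abs_nonneg _) ?_ 2
      calc |f k t - f k t0| ≤ |f k t| + |f k t0| := abs_sub _ _
        _ ≤ |b k| * m t + |b k| * m t0 := add_le_add (hb k t) (hb k t0)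
        _ = |b k| * (m t + m t0) := by ring
        _ ≤ |b k| * (2 * m t0 + 1) := mul_le_mul_of_nonneg_left (by linarith) (abs_nonneg _)
  rw [ContinuousAt, tendsto_iff_norm_sub_tendsto_zero]
  have := key.sqrt
  simpa using this

/-- The response of the oscillators, initially at rest, to a bounded continuous control. -/
theorem exists_response (ω : ℕ → ℝ) (b : Ell2 ℝ) {h : ℝ → ℝ} (hh : Continuous h) {M : ℝ}
    (hM : ∀ t, |h t| ≤ M) :
    ∃ y : ℝ → H, Continuous y ∧ y 0 = 0 ∧
      (∀ k t, HasDerivAt (fun t => (y t).fst k) (ω k * (y t).snd k) t) ∧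
      ∀ k t, HasDerivAt (fun t => (y t).snd k) (-(ω k * (y t).fst k) + b k * h t) t := by
  -- Duhamel's kernels `sin (ω (t - s))` and `cos (ω (t - s))` are expanded by the addition
  -- formulas, so that `t` leaves the integrands.
  set c : ℕ → ℝ → ℝ := fun k t => ∫ s in (0 : ℝ)..t, Real.cos (ω k * s) * h s with hc
  set d : ℕ → ℝ → ℝ := fun k t => ∫ s in (0 : ℝ)..t, Real.sin (ω k * s) * h s with hd
  have hM0 : 0 ≤ M := (abs_nonneg _).trans (hM 0)
  have dc : ∀ k t, HasDerivAt (c k) (Real.cos (ω k * t) * h t) t := fun k t =>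
    intervalIntegral.integral_hasDerivAt_right (Continuous.intervalIntegrable (by fun_prop) _ _)
      (Continuous.stronglyMeasurableAtFilter (by fun_prop) _ _) (by fun_prop)
  have dd : ∀ k t, HasDerivAt (d k) (Real.sin (ω k * t) * h t) t := fun k t =>
    intervalIntegral.integral_hasDerivAt_right (Continuous.intervalIntegrable (by fun_prop) _ _)
      (Continuous.stronglyMeasurableAtFilter (by fun_prop) _ _) (by fun_prop)
  have bc : ∀ k t, |c k t| ≤ M * |t| := by
    intro k t
    have := intervalIntegral.norm_integral_le_of_norm_le_const (a := 0) (b := t)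
      (f := fun s => Real.cos (ω k * s) * h s) (C := M) fun s _ => by
        rw [norm_mul, Real.norm_eq_abs, Real.norm_eq_abs]
        calc _ ≤ 1 * M := mul_le_mul (Real.abs_cos_le_one _) (hM s) (abs_nonneg _) zero_le_one
          _ = M := one_mul M
    simpa using this
  have bd : ∀ k t, |d k t| ≤ M * |t| := by
    intro k t
    have := intervalIntegral.norm_integral_le_of_norm_le_const (a := 0) (b := t)
      (f := fun s => Real.sin (ω k * s) * h s) (C := M) fun s _ => by
        rw [norm_mul, Real.norm_eq_abs, Real.norm_eq_abs]
        calc _ ≤ 1 * M := mul_le_mul (Real.abs_sin_le_one _) (hM s) (abs_nonneg _) zero_le_one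
          _ = M := one_mul M
    simpa using this
  have cc : ∀ k, Continuous (c k) := fun k =>
    continuous_iff_continuousAt.2 fun t => (dc k t).continuousAt
  have cd : ∀ k, Continuous (d k) := fun k =>
    continuous_iff_continuousAt.2 fun t => (dd k t).continuousAt
  have hbound : ∀ (z w x y : ℝ) (t : ℝ), |z| ≤ 1 → |w| ≤ 1 → |x| ≤ M * |t| → |y| ≤ M * |t| →
      |z * x + w * y| ≤ 2 * M * |t| := by
    intro z w x y t hz hw hx hy
    refine (abs_add_le _ _).trans ?_
    rw [abs_mul, abs_mul]
    have h1 := mul_le_mul hz hx (abs_nonneg _) zero_le_one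
    have h2 := mul_le_mul hw hy (abs_nonneg _) zero_le_one
    linarith
  obtain ⟨ξ, hξ, hξk⟩ := exists_continuous_ell2 b
    (fun k t => b k * (Real.sin (ω k * t) * c k t + -Real.cos (ω k * t) * d k t))
    (fun k => by have := cc k; have := cd k; fun_prop) (fun t => 2 * M * |t|) (by fun_prop)
    (fun k t => by
      rw [abs_mul]
      gcongr
      exact hbound _ _ _ _ t (Real.abs_sin_le_one _)
        (by rw [abs_neg]; exact Real.abs_cos_le_one _) (bc k t) (bd k t))
  obtain ⟨η, hη, hηk⟩ := exists_continuous_ell2 b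
    (fun k t => b k * (Real.cos (ω k * t) * c k t + Real.sin (ω k * t) * d k t))
    (fun k => by have := cc k; have := cd k; fun_prop) (fun t => 2 * M * |t|) (by fun_prop)
    (fun k t => by
      rw [abs_mul]
      gcongr
      exact hbound _ _ _ _ t (Real.abs_cos_le_one _) (Real.abs_sin_le_one _) (bc k t) (bd k t))
  have dsin : ∀ k t, HasDerivAt (fun t => Real.sin (ω k * t)) (Real.cos (ω k * t) * ω k) t := by
    intro k t
    have := ((hasDerivAt_id t).const_mul (ω k)).sin
    simpa using this
  have dcos : ∀ k t, HasDerivAt (fun t => Real.cos (ω k * t)) (-Real.sin (ω k * t) * ω k) t := by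
    intro k t
    have := ((hasDerivAt_id t).const_mul (ω k)).cos
    simpa using this
  refine ⟨fun t => WithLp.toLp 2 (ξ t, η t), by fun_prop, ?_, fun k t => ?_, fun k t => ?_⟩
  · have h1 : ξ 0 = 0 := by ext k; simp [hξk, hc, hd]
    have h2 : η 0 = 0 := by ext k; simp [hηk, hc, hd]
    simp [h1, h2]
  · simp only [WithLp.toLp_fst, WithLp.toLp_snd, hξk, hηk]
    convert! (((dsin k t).mul (dc k t)).add ((dcos k t).neg.mul (dd k t))).const_mul (b k) using 1
    simp only [Pi.neg_apply]
    ring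
  · simp only [WithLp.toLp_fst, WithLp.toLp_snd, hξk, hηk]
    convert! (((dcos k t).mul (dc k t)).add ((dsin k t).mul (dd k t))).const_mul (b k) using 1
    linear_combination (-(b k * h t)) * Real.sin_sq_add_cos_sq (ω k * t)

end Variation

end OscTurnpike

/-! ### First-order optimality conditions of the dynamic problem. -/

namespace OscTurnpike

open Filter Topology

variable {ω : ℕ → ℝ} {b : Ell2 ℝ} {T ubar : ℝ} {x0 xbar : H} {x Λ : ℝ → H} {u : ℝ → ℝ}

theorem IsAdmissible.intervalIntegrable (h : IsAdmissible ω b T x0 x u) (hT : 0 ≤ T) :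
    IntervalIntegrable u volume 0 T :=
  (intervalIntegrable_iff_integrableOn_Ioc_of_le hT).2 (h.memLp.integrable (by norm_num))

theorem IntervalIntegrable.mono_Icc {f : ℝ → ℝ} (h : IntervalIntegrable f volume 0 T) {t : ℝ}
    (ht : t ∈ Set.Icc 0 T) : IntervalIntegrable f volume 0 t :=
  h.mono_set (by
    rw [Set.uIcc_of_le ht.1, Set.uIcc_of_le (ht.1.trans ht.2)]
    exact Set.Icc_subset_Icc le_rfl ht.2)

theorem add_smul_fst_apply (y z : H) (c : ℝ) (k : ℕ) :
    (y + c • z).fst k = y.fst k + c * z.fst k := rfl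

theorem add_smul_snd_apply (y z : H) (c : ℝ) (k : ℕ) :
    (y + c • z).snd k = y.snd k + c * z.snd k := rfl

theorem IsAdmissible.add_smul (hx : IsAdmissible ω b T x0 x u) (hT : 0 ≤ T) {h : ℝ → ℝ}
    (hh : Continuous h) {M : ℝ} (hM : ∀ t, |h t| ≤ M) {y : ℝ → H} (hy : Continuous y)
    (hy0 : y 0 = 0) (hd1 : ∀ k t, HasDerivAt (fun t => (y t).fst k) (ω k * (y t).snd k) t)
    (hd2 : ∀ k t, HasDerivAt (fun t => (y t).snd k) (-(ω k * (y t).fst k) + b k * h t) t) (ε : ℝ) :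
    IsAdmissible ω b T x0 (fun t => x t + ε • y t) (fun t => u t + ε * h t) := by
  have hu := hx.intervalIntegrable hT
  have c1 : ∀ k, Continuous fun t => (y t).fst k := fun k => (continuous_fst_apply k).comp hy
  have c2 : ∀ k, Continuous fun t => (y t).snd k := fun k => (continuous_snd_apply k).comp hy
  have cx1 : ∀ k, ContinuousOn (fun t => (x t).fst k) (Set.Icc 0 T) := fun k =>
    (continuous_fst_apply k).comp_continuousOn hx.sol.cont
  have cx2 : ∀ k, ContinuousOn (fun t => (x t).snd k) (Set.Icc 0 T) := fun k =>
    (continuous_snd_apply k).comp_continuousOn hx.sol.cont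
  refine ⟨hx.memLp.add ?_, ⟨hx.sol.cont.add (hy.const_smul ε).continuousOn, fun k t ht => ?_,
    fun k t ht => ?_⟩, by simp [hy0, hx.init]⟩
  · exact MemLp.of_bound (by fun_prop) (|ε| * M) (Eventually.of_forall fun t => by
      rw [Real.norm_eq_abs, abs_mul]; gcongr; exact hM t)
  · have h1 := hx.sol.fst_eq k t ht
    have h2 := intervalIntegral.integral_eq_sub_of_hasDerivAt (a := 0) (b := t)
      (fun s _ => (hd1 k s).const_mul ε) (Continuous.intervalIntegrable (by
        have := c2 k; fun_prop) _ _)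
    have h3 : ∀ s, ω k * (x s + ε • y s).snd k + ((u s + ε * h s) • vecB b).fst k =
        (ω k * (x s).snd k + (u s • vecB b).fst k) + ε * (ω k * (y s).snd k) := by
      intro s
      rw [add_smul_snd_apply]
      simp [vecB]
      ring
    simp_rw [h3]
    rw [intervalIntegral.integral_add, h2]
    · rw [add_smul_fst_apply, add_smul_fst_apply, h1, hy0]
      simp
      ring
    · refine IntervalIntegrable.mono_Icc ?_ ht
      have : ∀ s, ω k * (x s).snd k + (u s • vecB b).fst k = ω k * (x s).snd k := by
        intro s; simp [vecB]
      simp_rw [this]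
      exact ((cx2 k).intervalIntegrable_of_Icc hT).const_mul _
    · exact Continuous.intervalIntegrable (by have := c2 k; fun_prop) _ _
  · have h1 := hx.sol.snd_eq k t ht
    have h2 := intervalIntegral.integral_eq_sub_of_hasDerivAt (a := 0) (b := t)
      (fun s _ => (hd2 k s).const_mul ε) (Continuous.intervalIntegrable (by
        have := c1 k; fun_prop) _ _)
    have h3 : ∀ s, -(ω k * (x s + ε • y s).fst k) + ((u s + ε * h s) • vecB b).snd k =
        (-(ω k * (x s).fst k) + (u s • vecB b).snd k) + ε * (-(ω k * (y s).fst k) + b k * h s) := by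
      intro s
      rw [add_smul_fst_apply]
      simp [vecB]
      ring
    simp_rw [h3]
    rw [intervalIntegral.integral_add, h2]
    · rw [add_smul_snd_apply, add_smul_snd_apply, h1, hy0]
      simp
      ring
    · refine IntervalIntegrable.mono_Icc ?_ ht
      have : ∀ s, -(ω k * (x s).fst k) + (u s • vecB b).snd k =
          -(ω k * (x s).fst k) + u s * b k := by
        intro s; simp [vecB]
      simp_rw [this]
      exact (((cx1 k).intervalIntegrable_of_Icc hT).const_mul _).neg.add (hu.mul_const _)
    · exact Continuous.intervalIntegrable (by have := c1 k; fun_prop) _ _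

/-- The first variation of the cost vanishes. -/
theorem IsDynamicSolution.integral_variation_eq_zero
    (hs : IsDynamicSolution ω b T x0 xbar ubar x Λ u) (hT : 0 ≤ T) {h : ℝ → ℝ}
    (hh : Continuous h) {M : ℝ} (hM : ∀ t, |h t| ≤ M) {y : ℝ → H} (hy : Continuous y)
    (hy0 : y 0 = 0) (hd1 : ∀ k t, HasDerivAt (fun t => (y t).fst k) (ω k * (y t).snd k) t)
    (hd2 : ∀ k t, HasDerivAt (fun t => (y t).snd k) (-(ω k * (y t).fst k) + b k * h t) t) :
    ∫ t in (0 : ℝ)..T, (inner ℝ (x t - xbar) (y t) + (u t - ubar) * h t) = 0 := by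
  have hx := hs.admissible.sol.cont
  have hu := hs.admissible.intervalIntegrable hT
  have cxb : ContinuousOn (fun t => x t - xbar) (Set.Icc 0 T) := hx.sub continuousOn_const
  have i0 : IntervalIntegrable (fun t => ‖x t - xbar‖ ^ 2 + |u t - ubar| ^ 2) volume 0 T := by
    refine ((cxb.norm.pow 2).intervalIntegrable_of_Icc hT).add ?_
    rw [intervalIntegrable_iff_integrableOn_Ioc_of_le hT]
    simp_rw [sq_abs]
    exact (hs.admissible.memLp.sub (memLp_const ubar)).integrable_sq
  have i1 : IntervalIntegrable (fun t => inner ℝ (x t - xbar) (y t) + (u t - ubar) * h t)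
      volume 0 T :=
    ((cxb.inner (𝕜 := ℝ) hy.continuousOn).intervalIntegrable_of_Icc hT).add
      ((hu.sub intervalIntegrable_const).mul_continuousOn hh.continuousOn)
  have i2 : IntervalIntegrable (fun t => ‖y t‖ ^ 2 + h t ^ 2) volume 0 T :=
    Continuous.intervalIntegrable (by fun_prop) _ _
  have hexp : ∀ ε t, ‖x t + ε • y t - xbar‖ ^ 2 + |u t + ε * h t - ubar| ^ 2 =
      (‖x t - xbar‖ ^ 2 + |u t - ubar| ^ 2) +
        2 * ε * (inner ℝ (x t - xbar) (y t) + (u t - ubar) * h t) +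
        ε ^ 2 * (‖y t‖ ^ 2 + h t ^ 2) := by
    intro ε t
    rw [add_sub_right_comm, norm_add_sq_real, norm_smul, inner_smul_right, sq_abs, sq_abs, mul_pow,
      Real.norm_eq_abs, sq_abs]
    ring
  set J1 := ∫ t in (0 : ℝ)..T, (inner ℝ (x t - xbar) (y t) + (u t - ubar) * h t) with hJ1
  -- The cost along the variation is a quadratic polynomial in `ε` minimal at `0`; its discriminant
  -- forces the linear coefficient to vanish.
  have hquad : ∀ ε : ℝ, 0 ≤ (∫ t in (0 : ℝ)..T, (‖y t‖ ^ 2 + h t ^ 2)) * (ε * ε) +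
      2 * J1 * ε + 0 := by
    intro ε
    have hmin := hs.minimal _ _ (hs.admissible.add_smul hT hh hM hy hy0 hd1 hd2 ε)
    unfold dynCost at hmin
    simp_rw [hexp] at hmin
    rw [intervalIntegral.integral_add (i0.add (i1.const_mul _)) (i2.const_mul _),
      intervalIntegral.integral_add i0 (i1.const_mul _), intervalIntegral.integral_const_mul,
      intervalIntegral.integral_const_mul] at hmin
    linarith
  have hdisc := discrim_le_zero hquad
  rw [discrim] at hdisc
  nlinarith [sq_nonneg J1]

theorem hasDerivAt_of_integral_eq {f g : ℝ → ℝ} {c : ℝ} (hg : ContinuousOn g (Set.Icc 0 T))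
    (hf : ∀ t ∈ Set.Icc (0 : ℝ) T, f t = c + ∫ s in (0 : ℝ)..t, g s) {t : ℝ}
    (ht : t ∈ Set.Ioo 0 T) : HasDerivAt f (g t) t := by
  have hnhds : Set.Icc 0 T ∈ 𝓝 t := Icc_mem_nhds ht.1 ht.2
  have hT : 0 ≤ T := ht.1.le.trans ht.2.le
  have h1 : HasDerivAt (fun t => c + ∫ s in (0 : ℝ)..t, g s) (g t) t := by
    refine HasDerivAt.const_add c (intervalIntegral.integral_hasDerivAt_right
      (IntervalIntegrable.mono_Icc (hg.intervalIntegrable_of_Icc hT) ⟨ht.1.le, ht.2.le⟩) ?_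
      (hg.continuousAt hnhds))
    exact ContinuousOn.stronglyMeasurableAtFilter isOpen_Ioo
      (hg.mono Set.Ioo_subset_Icc_self) t ht
  exact h1.congr_of_eventuallyEq (by
    filter_upwards [hnhds] with s hs using hf s hs)

theorem IsSolution.hasDerivAt_fst {f y : ℝ → H} (hy : IsSolution ω T f y)
    (hf : ContinuousOn f (Set.Icc 0 T)) (k : ℕ) {t : ℝ} (ht : t ∈ Set.Ioo 0 T) :
    HasDerivAt (fun t => (y t).fst k) (ω k * (y t).snd k + (f t).fst k) t :=
  hasDerivAt_of_integral_eq (g := fun t => ω k * (y t).snd k + (f t).fst k)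
    ((continuousOn_const.mul ((continuous_snd_apply k).comp_continuousOn hy.cont)).add
      ((continuous_fst_apply k).comp_continuousOn hf)) (hy.fst_eq k) ht

theorem IsSolution.hasDerivAt_snd {f y : ℝ → H} (hy : IsSolution ω T f y)
    (hf : ContinuousOn f (Set.Icc 0 T)) (k : ℕ) {t : ℝ} (ht : t ∈ Set.Ioo 0 T) :
    HasDerivAt (fun t => (y t).snd k) (-(ω k * (y t).fst k) + (f t).snd k) t :=
  hasDerivAt_of_integral_eq (g := fun t => -(ω k * (y t).fst k) + (f t).snd k)
    ((continuousOn_const.mul ((continuous_fst_apply k).comp_continuousOn hy.cont)).neg.add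
      ((continuous_snd_apply k).comp_continuousOn hf)) (hy.snd_eq k) ht

/-- Duality between the adjoint state and the variations of the state. -/
theorem IsDynamicSolution.integral_adjoint_eq_zero
    (hs : IsDynamicSolution ω b T x0 xbar ubar x Λ u) (hT : 0 ≤ T) {h : ℝ → ℝ}
    (hh : Continuous h) {y : ℝ → H} (hy : Continuous y)
    (hy0 : y 0 = 0) (hd1 : ∀ k t, HasDerivAt (fun t => (y t).fst k) (ω k * (y t).snd k) t)
    (hd2 : ∀ k t, HasDerivAt (fun t => (y t).snd k) (-(ω k * (y t).fst k) + b k * h t) t) :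
    ∫ t in (0 : ℝ)..T, (inner ℝ (x t - xbar) (y t) + inner ℝ (vecB b) (Λ t) * h t) = 0 := by
  have cxb : ContinuousOn (fun t => x t - xbar) (Set.Icc 0 T) :=
    hs.admissible.sol.cont.sub continuousOn_const
  have cΛ := hs.adjoint.cont
  have c1 : ∀ k, ContinuousOn (fun t => (y t).fst k) (Set.Icc 0 T) := fun k =>
    ((continuous_fst_apply k).comp hy).continuousOn
  have c2 : ∀ k, ContinuousOn (fun t => (y t).snd k) (Set.Icc 0 T) := fun k =>
    ((continuous_snd_apply k).comp hy).continuousOn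
  have cΛ1 : ∀ k, ContinuousOn (fun t => (Λ t).fst k) (Set.Icc 0 T) := fun k =>
    (continuous_fst_apply k).comp_continuousOn cΛ
  have cΛ2 : ∀ k, ContinuousOn (fun t => (Λ t).snd k) (Set.Icc 0 T) := fun k =>
    (continuous_snd_apply k).comp_continuousOn cΛ
  have cx1 : ∀ k, ContinuousOn (fun t => (x t - xbar).fst k) (Set.Icc 0 T) := fun k =>
    (continuous_fst_apply k).comp_continuousOn cxb
  have cx2 : ∀ k, ContinuousOn (fun t => (x t - xbar).snd k) (Set.Icc 0 T) := fun k =>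
    (continuous_snd_apply k).comp_continuousOn cxb
  set S : Finset ℕ → ℝ → ℝ := fun s t =>
    ∑ k ∈ s, ((x t - xbar).fst k * (y t).fst k + (x t - xbar).snd k * (y t).snd k) +
      (∑ k ∈ s, b k * (Λ t).snd k) * h t with hS
  have cS : ∀ s, ContinuousOn (S s) (Set.Icc 0 T) := fun s =>
    (continuousOn_finsetSum _ fun k _ => ((cx1 k).mul (c1 k)).add ((cx2 k).mul (c2 k))).add
      ((continuousOn_finsetSum _ fun k _ => continuousOn_const.mul (cΛ2 k)).mul hh.continuousOn)
  -- Integration by parts on finitely many modes, where the equations hold coordinatewise: the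
  -- rotations cancel by skewness, and `y 0 = 0`, `Λ T = 0` remove the boundary terms.
  have hzero : ∀ s, ∫ t in (0 : ℝ)..T, S s t = 0 := by
    intro s
    rw [intervalIntegral.integral_eq_sub_of_hasDerivAt_of_le hT
      (f := fun t => ∑ k ∈ s, ((Λ t).fst k * (y t).fst k + (Λ t).snd k * (y t).snd k))
      (continuousOn_finsetSum _ fun k _ => ((cΛ1 k).mul (c1 k)).add ((cΛ2 k).mul (c2 k)))
      (fun t ht => ?_) ((cS s).intervalIntegrable_of_Icc hT)]
    · rw [hs.terminal, hy0]; simp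
    · have : S s t = ∑ k ∈ s, (((x t - xbar).fst k * (y t).fst k +
          (x t - xbar).snd k * (y t).snd k) + b k * (Λ t).snd k * h t) := by
        simp only [hS]
        rw [Finset.sum_mul, ← Finset.sum_add_distrib]
      rw [this]
      refine HasDerivAt.fun_sum fun k _ => ?_
      convert! ((hs.adjoint.hasDerivAt_fst cxb k ht).mul (hd1 k t)).add
        ((hs.adjoint.hasDerivAt_snd cxb k ht).mul (hd2 k t)) using 1
      ring
  obtain ⟨M1, hM1⟩ := isCompact_Icc.exists_bound_of_continuousOn (cxb.norm.pow 2)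
  obtain ⟨M2, hM2⟩ := isCompact_Icc.exists_bound_of_continuousOn
    ((hy.norm.pow 2).continuousOn (s := Set.Icc 0 T))
  obtain ⟨M3, hM3⟩ := isCompact_Icc.exists_bound_of_continuousOn (cΛ.norm.pow 2)
  obtain ⟨M4, hM4⟩ := isCompact_Icc.exists_bound_of_continuousOn (hh.continuousOn (s := Set.Icc 0 T))
  have hlim : Tendsto (fun s => ∫ t in (0 : ℝ)..T, S s t) atTop
      (𝓝 (∫ t in (0 : ℝ)..T, (inner ℝ (x t - xbar) (y t) + inner ℝ (vecB b) (Λ t) * h t))) := by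
    refine intervalIntegral.tendsto_integral_filter_of_dominated_convergence
      (fun _ => M1 + M2 + (‖b‖ ^ 2 + M3) * M4)
      (Eventually.of_forall fun s => ?_) (Eventually.of_forall fun s => ?_)
      intervalIntegrable_const ?_
    · rw [Set.uIoc_of_le hT]
      exact ((cS s).mono Set.Ioc_subset_Icc_self).aestronglyMeasurable measurableSet_Ioc
    · refine Eventually.of_forall fun t ht => ?_
      rw [Set.uIoc_of_le hT] at ht
      have ht := Set.Ioc_subset_Icc_self ht
      have e1 := (le_abs_self _).trans (hM1 t ht)
      have e2 := (le_abs_self _).trans (hM2 t ht)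
      have e3 := (le_abs_self _).trans (hM3 t ht)
      have e4 := hM4 t ht
      refine (norm_add_le _ _).trans (add_le_add ?_ ?_)
      · exact (abs_sum_inner_le _ _ s).trans (add_le_add e1 e2)
      · rw [norm_mul]
        have e5 : ‖(Λ t).snd‖ ^ 2 ≤ ‖Λ t‖ ^ 2 := by
          rw [WithLp.prod_norm_sq_eq_of_L2]
          have : 0 ≤ ‖(Λ t).fst‖ ^ 2 := by positivity
          linarith
        have e6 := abs_sum_ell2_inner_le b (Λ t).snd s
        refine mul_le_mul (e6.trans ?_) e4 (norm_nonneg _) ?_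
        · have := e5.trans e3
          linarith
        · have : 0 ≤ M3 := le_trans (by positivity) (e5.trans e3)
          positivity
    · refine Eventually.of_forall fun t ht => ?_
      refine Tendsto.add (hasSum_inner_H _ _) (Tendsto.mul_const _ ?_)
      rw [inner_vecB]
      exact hasSum_ell2_inner _ _
  simp_rw [hzero] at hlim
  exact (tendsto_nhds_unique hlim tendsto_const_nhds)

/-- The optimality condition `u - ū = B* Λ`. -/
theorem IsDynamicSolution.control_eq (hs : IsDynamicSolution ω b T x0 xbar ubar x Λ u)
    (hT : 0 < T) :
    ∀ᵐ t ∂(volume : Measure ℝ), t ∈ Set.Ioo 0 T → u t - ubar - inner ℝ (vecB b) (Λ t) = 0 := by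
  have hu := hs.admissible.intervalIntegrable hT.le
  have cB : ContinuousOn (fun t => inner ℝ (vecB b) (Λ t)) (Set.Icc 0 T) :=
    continuousOn_const.inner (𝕜 := ℝ) hs.adjoint.cont
  have hi : IntervalIntegrable (fun t => u t - ubar - inner ℝ (vecB b) (Λ t)) volume 0 T :=
    (hu.sub intervalIntegrable_const).sub (cB.intervalIntegrable_of_Icc hT.le)
  -- Fundamental lemma of the calculus of variations: comparing the first variation with the duality
  -- relation leaves `∫ h (u - ū - B* Λ) = 0` for all test functions `h`.
  refine isOpen_Ioo.ae_eq_zero_of_integral_contDiff_smul_eq_zero ?_ fun h hh hcs hsub => ?_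
  · have := (intervalIntegrable_iff_integrableOn_Ioc_of_le hT.le).1 hi
    exact (this.mono_set Set.Ioo_subset_Ioc_self).locallyIntegrableOn
  · have hhc := hh.continuous
    obtain ⟨M, hM⟩ := hcs.exists_bound_of_continuous hhc
    obtain ⟨y, hy, hy0, hd1, hd2⟩ := exists_response ω b hhc hM
    have e1 := hs.integral_variation_eq_zero hT.le hhc hM hy hy0 hd1 hd2
    have e2 := hs.integral_adjoint_eq_zero hT.le hhc hy hy0 hd1 hd2
    have cxb : ContinuousOn (fun t => x t - xbar) (Set.Icc 0 T) :=
      hs.admissible.sol.cont.sub continuousOn_const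
    have i0 := (cxb.inner (𝕜 := ℝ) hy.continuousOn).intervalIntegrable_of_Icc (μ := volume) hT.le
    have i1 : IntervalIntegrable (fun t => (u t - ubar) * h t) volume 0 T :=
      (hu.sub intervalIntegrable_const).mul_continuousOn hhc.continuousOn
    have i2 : IntervalIntegrable (fun t => inner ℝ (vecB b) (Λ t) * h t) volume 0 T :=
      (cB.mul hhc.continuousOn).intervalIntegrable_of_Icc hT.le
    rw [intervalIntegral.integral_add i0 i1] at e1
    rw [intervalIntegral.integral_add i0 i2] at e2
    have e3 : ∫ t in (0 : ℝ)..T, h t • (u t - ubar - inner ℝ (vecB b) (Λ t)) = 0 := by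
      have : ∀ t, h t • (u t - ubar - inner ℝ (vecB b) (Λ t)) =
          (u t - ubar) * h t - inner ℝ (vecB b) (Λ t) * h t := fun t => by
        rw [smul_eq_mul]; ring
      simp_rw [this]
      rw [intervalIntegral.integral_sub i1 i2]
      linarith
    rw [intervalIntegral.integral_of_le hT.le] at e3
    rw [← e3]
    refine (setIntegral_eq_integral_of_forall_compl_eq_zero fun t ht => ?_).symm
    have : t ∉ tsupport h := fun hmem => ht (Set.Ioo_subset_Ioc_self (hsub hmem))
    rw [image_eq_zero_of_notMem_tsupport this, zero_smul]

end OscTurnpike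

namespace OscTurnpike

open Filter Topology

/-! ### Equations of the discrepancy. -/

section Discrepancy

variable {ω : ℕ → ℝ} {b : Ell2 ℝ} {T ubar uhat : ℝ} {x0 xbar xhat Lhat : H} {x Λ : ℝ → H}
  {u : ℝ → ℝ}

theorem sub_fst_apply (y z : H) (k : ℕ) : (y - z).fst k = y.fst k - z.fst k := rfl

theorem sub_snd_apply (y z : H) (k : ℕ) : (y - z).snd k = y.snd k - z.snd k := rfl

theorem smul_vecB_fst_apply (c : ℝ) (k : ℕ) : (c • vecB b).fst k = 0 := by simp [vecB]

theorem smul_vecB_snd_apply (c : ℝ) (k : ℕ) : (c • vecB b).snd k = c * b k := by simp [vecB]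

/-- The optimal control may be replaced by the continuous function `ū + B* Λ`. -/
theorem IsDynamicSolution.isSolution_feedback
    (hs : IsDynamicSolution ω b T x0 xbar ubar x Λ u) (hT : 0 < T) :
    IsSolution ω T (fun t => (ubar + inner ℝ (vecB b) (Λ t)) • vecB b) x := by
  have hu : ∀ᵐ t ∂(volume : Measure ℝ), t ∈ Set.Ioc 0 T →
      u t = ubar + inner ℝ (vecB b) (Λ t) := by
    have hne : ∀ᵐ t ∂(volume : Measure ℝ), t ≠ T := by simp [ae_iff]
    filter_upwards [hs.control_eq hT, hne] with t h1 h2 h3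
    linarith [h1 ⟨h3.1, lt_of_le_of_ne h3.2 h2⟩]
  have hu' : ∀ t ∈ Set.Icc (0 : ℝ) T, ∀ᵐ s ∂(volume : Measure ℝ), s ∈ Set.uIoc 0 t →
      u s = ubar + inner ℝ (vecB b) (Λ s) := by
    intro t ht
    filter_upwards [hu] with s hs' hst
    rw [Set.uIoc_of_le ht.1] at hst
    exact hs' ⟨hst.1, hst.2.trans ht.2⟩
  refine ⟨hs.admissible.sol.cont, fun k t ht => ?_, fun k t ht => ?_⟩
  · rw [hs.admissible.sol.fst_eq k t ht]
    congr 1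
    exact intervalIntegral.integral_congr_ae
      ((hu' t ht).mono fun s h1 h2 => by rw [h1 h2])
  · rw [hs.admissible.sol.snd_eq k t ht]
    congr 1
    exact intervalIntegral.integral_congr_ae
      ((hu' t ht).mono fun s h1 h2 => by rw [h1 h2])

variable (hs : IsDynamicSolution ω b T x0 xbar ubar x Λ u)
  (hst : IsStaticSolution ω b xbar ubar xhat Lhat uhat)

include hs

theorem IsDynamicSolution.continuousOn_feedback :
    ContinuousOn (fun t => (ubar + inner ℝ (vecB b) (Λ t)) • vecB b) (Set.Icc 0 T) :=
  (continuousOn_const.add (continuousOn_const.inner (𝕜 := ℝ) hs.adjoint.cont)).smul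
    continuousOn_const

include hst

theorem hasDerivAt_state_fst (k : ℕ) {t : ℝ} (ht : t ∈ Set.Ioo 0 T) :
    HasDerivAt (fun t => (x t - xhat).fst k) (ω k * (x t - xhat).snd k) t := by
  have h := (hs.isSolution_feedback (ht.1.trans ht.2)).hasDerivAt_fst hs.continuousOn_feedback k ht
  convert! h.sub_const (xhat.fst k) using 1
  rw [sub_snd_apply, smul_vecB_fst_apply, mul_sub, (hst.feasible k).1]
  ring

/-- The static constraint and `û - ū = B* Λ̂` cancel the targets, so the system becomes homogeneous.
The continuous feedback makes the equation hold at every interior time. -/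
theorem hasDerivAt_state_snd (k : ℕ) {t : ℝ} (ht : t ∈ Set.Ioo 0 T) :
    HasDerivAt (fun t => (x t - xhat).snd k)
      (-(ω k * (x t - xhat).fst k) + b k * inner ℝ b (Λ t - Lhat).snd) t := by
  have h := (hs.isSolution_feedback (ht.1.trans ht.2)).hasDerivAt_snd hs.continuousOn_feedback k ht
  convert! h.sub_const (xhat.snd k) using 1
  have h1 : inner ℝ b (Λ t - Lhat).snd = inner ℝ (vecB b) (Λ t) - (uhat - ubar) := by
    rw [← inner_vecB, inner_sub_right, hst.stat_control]
  rw [sub_fst_apply, smul_vecB_snd_apply, h1]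
  linear_combination -(hst.feasible k).2

theorem hasDerivAt_adjoint_fst (k : ℕ) {t : ℝ} (ht : t ∈ Set.Ioo 0 T) :
    HasDerivAt (fun t => (Λ t - Lhat).fst k)
      (ω k * (Λ t - Lhat).snd k + (x t - xhat).fst k) t := by
  have h := hs.adjoint.hasDerivAt_fst (hs.admissible.sol.cont.sub continuousOn_const) k ht
  convert! h.sub_const (Lhat.fst k) using 1
  simp only [sub_fst_apply, sub_snd_apply]
  linear_combination -(hst.stat_fst k)

theorem hasDerivAt_adjoint_snd (k : ℕ) {t : ℝ} (ht : t ∈ Set.Ioo 0 T) :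
    HasDerivAt (fun t => (Λ t - Lhat).snd k)
      (-(ω k * (Λ t - Lhat).fst k) + (x t - xhat).snd k) t := by
  have h := hs.adjoint.hasDerivAt_snd (hs.admissible.sol.cont.sub continuousOn_const) k ht
  convert! h.sub_const (Lhat.snd k) using 1
  simp only [sub_fst_apply, sub_snd_apply]
  linear_combination -(hst.stat_snd k)

end Discrepancy

/-! ### Diagonalization. -/

section Modes

/-- The coordinates of `y = (ξ, η)` in the eigenbasis of `A`. -/
noncomputable def modes (y : H) : ℕ ⊕ ℕ → ℂ :=
  Sum.elim (fun k => ((y.snd k : ℂ) - Complex.I * y.fst k) / (Real.sqrt 2 : ℂ))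
    (fun k => ((y.snd k : ℂ) + Complex.I * y.fst k) / (Real.sqrt 2 : ℂ))

/-- The eigenfrequencies of `A`. -/
def modeFreq (ω : ℕ → ℝ) : ℕ ⊕ ℕ → ℝ := Sum.elim (fun k => -ω k) ω

/-- The coordinates of `B` in the eigenbasis of `A`. -/
noncomputable def modeCoeff (b : Ell2 ℝ) : ℕ ⊕ ℕ → ℝ :=
  Sum.elim (fun k => b k / Real.sqrt 2) (fun k => b k / Real.sqrt 2)

theorem continuous_modes (n : ℕ ⊕ ℕ) : Continuous fun y : H => modes y n := by
  rcases n with k | k <;>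
  · have h1 := continuous_fst_apply k
    have h2 := continuous_snd_apply k
    simp only [modes, Sum.elim_inl, Sum.elim_inr]
    fun_prop

theorem norm_sq_modes_inl (y : H) (k : ℕ) :
    ‖modes y (Sum.inl k)‖ ^ 2 = (y.fst k ^ 2 + y.snd k ^ 2) / 2 := by
  rw [modes, Sum.elim_inl, norm_div, div_pow, Complex.norm_real, Real.norm_eq_abs, sq_abs,
    Real.sq_sqrt (by norm_num), ← Complex.normSq_eq_norm_sq, Complex.normSq_apply]
  simp
  ring

theorem norm_sq_modes_inr (y : H) (k : ℕ) :
    ‖modes y (Sum.inr k)‖ ^ 2 = (y.fst k ^ 2 + y.snd k ^ 2) / 2 := by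
  rw [modes, Sum.elim_inr, norm_div, div_pow, Complex.norm_real, Real.norm_eq_abs, sq_abs,
    Real.sq_sqrt (by norm_num), ← Complex.normSq_eq_norm_sq, Complex.normSq_apply]
  simp
  ring

theorem hasSum_norm_sq_modes (y : H) : HasSum (fun n => ‖modes y n‖ ^ 2) (‖y‖ ^ 2) := by
  have h := (hasSum_norm_sq_H y).div_const 2
  have h1 : HasSum ((fun n => ‖modes y n‖ ^ 2) ∘ Sum.inl) (‖y‖ ^ 2 / 2) := by
    simpa only [Function.comp_def, norm_sq_modes_inl] using h
  have h2 : HasSum ((fun n => ‖modes y n‖ ^ 2) ∘ Sum.inr) (‖y‖ ^ 2 / 2) := by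
    simpa only [Function.comp_def, norm_sq_modes_inr] using h
  simpa using h1.sum h2

theorem norm_sq_le_of_sum_modes_le {y : H} {R : ℝ}
    (hy : ∀ s : Finset (ℕ ⊕ ℕ), ∑ n ∈ s, ‖modes y n‖ ^ 2 ≤ R) : ‖y‖ ^ 2 ≤ R :=
  hasSum_le_of_sum_le (hasSum_norm_sq_modes y) hy

theorem sum_norm_sq_modes_le (y : H) (s : Finset (ℕ ⊕ ℕ)) : ∑ n ∈ s, ‖modes y n‖ ^ 2 ≤ ‖y‖ ^ 2 :=
  sum_le_hasSum s (fun _ _ => by positivity) (hasSum_norm_sq_modes y)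

theorem sqrt_two_mul_self : (Real.sqrt 2 : ℂ) * (Real.sqrt 2 : ℂ) = 2 := by
  rw [← Complex.ofReal_mul, Real.mul_self_sqrt (by norm_num)]; norm_num

/-- The `ξ`-parts of the two conjugate modes of each oscillator cancel. -/
theorem hasSum_modeCoeff_mul_modes (b : Ell2 ℝ) (y : H) :
    HasSum (fun n => (modeCoeff b n : ℂ) * modes y n) ((inner ℝ b y.snd : ℝ) : ℂ) := by
  have h1 := Complex.hasSum_ofReal.2 (hasSum_ell2_inner b y.snd)
  have h2 := Complex.hasSum_ofReal.2 (hasSum_ell2_inner b y.fst)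
  have hl : HasSum ((fun n => (modeCoeff b n : ℂ) * modes y n) ∘ Sum.inl)
      ((((inner ℝ b y.snd : ℝ) : ℂ) - Complex.I * ((inner ℝ b y.fst : ℝ) : ℂ)) / 2) := by
    convert! (h1.sub (h2.mul_left Complex.I)).div_const 2 using 2 with k
    simp only [Function.comp_apply, modeCoeff, modes, Sum.elim_inl]
    push_cast
    rw [div_mul_div_comm, sqrt_two_mul_self]
    ring
  have hr : HasSum ((fun n => (modeCoeff b n : ℂ) * modes y n) ∘ Sum.inr)
      ((((inner ℝ b y.snd : ℝ) : ℂ) + Complex.I * ((inner ℝ b y.fst : ℝ) : ℂ)) / 2) := by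
    convert! (h1.add (h2.mul_left Complex.I)).div_const 2 using 2 with k
    simp only [Function.comp_apply, modeCoeff, modes, Sum.elim_inr]
    push_cast
    rw [div_mul_div_comm, sqrt_two_mul_self]
    ring
  convert! hl.sum hr using 1
  ring

theorem sum_modeCoeff_sq_le (b : Ell2 ℝ) (s : Finset (ℕ ⊕ ℕ)) :
    ∑ n ∈ s, modeCoeff b n ^ 2 ≤ ‖b‖ ^ 2 := by
  have h : ∀ k, (b k / Real.sqrt 2) ^ 2 = b k ^ 2 / 2 := fun k => by
    rw [div_pow, Real.sq_sqrt (by norm_num)]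
  have h1 := (hasSum_ell2_norm_sq b).div_const 2
  simp_rw [← h] at h1
  have h2 : HasSum (fun n => modeCoeff b n ^ 2) (‖b‖ ^ 2 / 2 + ‖b‖ ^ 2 / 2) := HasSum.sum h1 h1
  rw [add_halves] at h2
  exact sum_le_hasSum s (fun _ _ => sq_nonneg _) h2

theorem hasDerivAt_modes {y : ℝ → H} {t ω : ℝ} {k : ℕ} {f g : ℝ}
    (h1 : HasDerivAt (fun t => (y t).fst k) (ω * (y t).snd k + f) t)
    (h2 : HasDerivAt (fun t => (y t).snd k) (-(ω * (y t).fst k) + g) t) :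
    HasDerivAt (fun t => modes (y t) (Sum.inl k)) (Complex.I * ((-ω : ℝ) : ℂ) *
        modes (y t) (Sum.inl k) + ((g : ℂ) - Complex.I * f) / (Real.sqrt 2 : ℂ)) t ∧
      HasDerivAt (fun t => modes (y t) (Sum.inr k)) (Complex.I * (ω : ℂ) *
        modes (y t) (Sum.inr k) + ((g : ℂ) + Complex.I * f) / (Real.sqrt 2 : ℂ)) t := by
  simp only [modes, Sum.elim_inl, Sum.elim_inr]
  constructor
  · convert! (h2.ofReal_comp.sub (h1.ofReal_comp.const_mul Complex.I)).div_const
      (Real.sqrt 2 : ℂ) using 1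
    push_cast
    field_simp
    ring_nf
    simp only [Complex.I_sq]
    ring
  · convert! (h2.ofReal_comp.add (h1.ofReal_comp.const_mul Complex.I)).div_const
      (Real.sqrt 2 : ℂ) using 1
    push_cast
    field_simp
    ring_nf
    simp only [Complex.I_sq]
    ring

theorem modalSystem_discrepancy {ω : ℕ → ℝ} {b : Ell2 ℝ} {T ubar uhat : ℝ}
    {x0 xbar xhat Lhat : H} {x Λ : ℝ → H} {u : ℝ → ℝ}
    (hs : IsDynamicSolution ω b T x0 xbar ubar x Λ u)
    (hst : IsStaticSolution ω b xbar ubar xhat Lhat uhat) :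
    ModalSystem (modeFreq ω) (modeCoeff b) T (fun t => modes (x t - xhat))
      (fun t => modes (Λ t - Lhat)) (fun t => ((inner ℝ b (Λ t - Lhat).snd : ℝ) : ℂ))
      (fun t => ‖x t - xhat‖ ^ 2) := by
  have cp : ContinuousOn (fun t => x t - xhat) (Set.Icc 0 T) :=
    hs.admissible.sol.cont.sub continuousOn_const
  have cq : ContinuousOn (fun t => Λ t - Lhat) (Set.Icc 0 T) :=
    hs.adjoint.cont.sub continuousOn_const
  refine ⟨fun n => (continuous_modes n).comp_continuousOn cp,
    fun n => (continuous_modes n).comp_continuousOn cq, fun n t ht => ?_, fun n t ht => ?_, ?_,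
    fun t _ => hasSum_modeCoeff_mul_modes b _, cp.norm.pow 2,
    fun t _ => hasSum_norm_sq_modes _, ?_⟩
  · have h := fun k => hasDerivAt_modes (f := 0)
      (by simpa using hasDerivAt_state_fst hs hst k ht) (hasDerivAt_state_snd hs hst k ht)
    rcases n with k | k
    · convert! (h k).1 using 1
      simp [modeFreq, modeCoeff]
      ring
    · convert! (h k).2 using 1
      simp [modeFreq, modeCoeff]
      ring
  · have h := fun k => hasDerivAt_modes (hasDerivAt_adjoint_fst hs hst k ht)
      (hasDerivAt_adjoint_snd hs hst k ht)
    rcases n with k | k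
    · exact (h k).1
    · exact (h k).2
  · refine Complex.continuous_ofReal.comp_continuousOn
      (continuousOn_const.inner (𝕜 := ℝ) ?_)
    exact (by fun_prop : Continuous fun y : H => y.snd).comp_continuousOn cq
  · obtain ⟨B, hB⟩ := isCompact_Icc.exists_bound_of_continuousOn (cq.norm.pow 2)
    exact ⟨B, fun t ht s => (sum_norm_sq_modes_le _ s).trans ((le_abs_self _).trans (hB t ht))⟩

end Modes

/-! ### Separation of the frequencies. -/

section Frequencies

variable {ω : ℕ → ℝ}

theorem CondA2.strictMono (h : CondA2 ω) : StrictMono ω := by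
  obtain ⟨_, ωs, hpos, hgap⟩ := h
  exact strictMono_nat_of_lt_succ fun k => by linarith [hgap k]

theorem CondA2.pos (h : CondA2 ω) (k : ℕ) : 0 < ω k :=
  h.1.trans_le (h.strictMono.monotone (Nat.zero_le k))

theorem CondA2.modeFreq_injective (h : CondA2 ω) : Function.Injective (modeFreq ω) := by
  rintro (j | j) (k | k) hjk
  · exact congrArg _ (h.strictMono.injective (neg_injective hjk))
  · have h1 : -ω j = ω k := hjk
    linarith [h.pos j, h.pos k]
  · have h1 : ω j = -ω k := hjk
    linarith [h.pos j, h.pos k]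
  · exact congrArg _ (h.strictMono.injective hjk)

/-- The convention `1 / 0 = 0` allows the sums to include `j = k`. -/
theorem CondA3.exists_sum_le (h : CondA3 ω) :
    ∃ C, 0 ≤ C ∧ ∀ k (s : Finset ℕ), ∑ j ∈ s, 1 / (ω k - ω j) ^ 2 ≤ C := by
  obtain ⟨C, hC⟩ := h
  refine ⟨C, le_trans (tsum_nonneg fun j => by positivity) (hC 0).2, fun k s => ?_⟩
  refine le_trans ?_ (hC k).2
  have h1 := (hC k).1.sum_le_tsum (s.subtype (· ≠ k)) fun j _ => by positivity
  refine le_trans (le_of_eq ?_) h1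
  rw [Finset.sum_subtype_eq_sum_filter (p := (· ≠ k)) (fun j => 1 / (ω k - ω j) ^ 2),
    Finset.sum_filter]
  refine Finset.sum_congr rfl fun j _ => ?_
  by_cases hj : j = k
  · subst hj; simp
  · rw [if_pos hj]

/-- Frequencies of equal sign are covered by the assumption. For opposite signs `ω k + ω j ≥ ω j - ω
0` compares with the sum centred at the first frequency, the term `j = 0` being bounded by `1 / ω 0
^ 2`. -/
theorem exists_sum_modeFreq_le (h2 : CondA2 ω) (h3 : CondA3 ω) :
    ∃ K, 0 ≤ K ∧ ∀ n (s : Finset (ℕ ⊕ ℕ)),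
      ∑ m ∈ s, 1 / (modeFreq ω m - modeFreq ω n) ^ 2 ≤ K := by
  obtain ⟨C, hC0, hC⟩ := h3.exists_sum_le
  have hpos := h2.pos
  have hcross : ∀ k (s : Finset ℕ), ∑ j ∈ s, 1 / (ω k + ω j) ^ 2 ≤ 1 / ω 0 ^ 2 + C := by
    intro k s
    calc ∑ j ∈ s, 1 / (ω k + ω j) ^ 2
        ≤ ∑ j ∈ s, ((if j = 0 then 1 / ω 0 ^ 2 else 0) + 1 / (ω 0 - ω j) ^ 2) := by
          refine Finset.sum_le_sum fun j _ => ?_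
          have hk := hpos k
          have hj := hpos j
          by_cases hj0 : j = 0
          · subst hj0
            simp only [if_true, sub_self]
            norm_num
            gcongr
            linarith
          · rw [if_neg hj0, zero_add]
            have hlt : ω 0 < ω j := h2.strictMono (Nat.pos_of_ne_zero hj0)
            have h0 := hpos 0
            rw [← neg_sub (ω j), neg_sq]
            have : 0 < ω j - ω 0 := sub_pos.2 hlt
            exact one_div_le_one_div_of_le (by positivity)
              (pow_le_pow_left₀ this.le (by linarith) 2)
      _ ≤ 1 / ω 0 ^ 2 + C := by
          rw [Finset.sum_add_distrib]
          refine add_le_add ?_ (hC 0 s)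
          rw [Finset.sum_ite_eq']
          split_ifs
          · exact le_rfl
          · positivity
  refine ⟨C + (1 / ω 0 ^ 2 + C), by positivity, fun n s => ?_⟩
  rw [Finset.sum_sum_eq_sum_toLeft_add_sum_toRight]
  rcases n with k | k
  · refine add_le_add (le_trans (le_of_eq ?_) (hC k s.toLeft))
      (le_trans (le_of_eq ?_) (hcross k s.toRight)) <;>
    · refine Finset.sum_congr rfl fun j _ => ?_
      simp only [modeFreq, Sum.elim_inl, Sum.elim_inr]
      congr 2
      ring
  · rw [add_comm]
    refine add_le_add (le_trans (le_of_eq ?_) (hC k s.toRight))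
      (le_trans (le_of_eq ?_) (hcross k s.toLeft)) <;>
    · refine Finset.sum_congr rfl fun j _ => ?_
      simp only [modeFreq, Sum.elim_inl, Sum.elim_inr]
      congr 1
      ring

end Frequencies

/-! ### The weighted norm and the norm of the discrepancy. -/

section WeightedNorm

variable {ω : ℕ → ℝ} {b : Ell2 ℝ}

theorem vTerm_zero_one (y : H) (k : ℕ) :
    vTerm ω b 0 1 y k = (y.fst k ^ 2 + y.snd k ^ 2) / b k ^ 2 := by
  rw [vTerm, mul_zero, Real.rpow_zero, one_mul, mul_one, Real.rpow_two, sq_abs]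

theorem normV_sq (y : H) : normV ω b 0 1 y ^ 2 = ∑' k, vTerm ω b 0 1 y k :=
  Real.sq_sqrt (tsum_nonneg fun k => by rw [vTerm_zero_one]; positivity)

/-- A static state is `ξ k = b k * u / ω k`, `η = 0`, so the weight cancels `b` and `∑ 1 / ω k ^ 2`
remains. Without this membership the junk value of a divergent `tsum` would void the weighted norm
of `x 0 - x̂`. -/
theorem StaticConstraint.memV {x : H} {u : ℝ} (hω : CondA2 ω) (hω3 : CondA3 ω) (hb : CondA1 b)
    (h : StaticConstraint ω b x u) : MemV ω b 0 1 x := by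
  obtain ⟨K, hK0, hK⟩ := exists_sum_modeFreq_le hω hω3
  have hterm : ∀ k, vTerm ω b 0 1 x k = u ^ 2 * (1 / ω k ^ 2) := by
    intro k
    have h1 := hω.pos k
    have h2 : x.snd k = 0 := (mul_eq_zero.1 (h k).1).resolve_left h1.ne'
    have h3 : x.fst k = b k * u / ω k := by
      rw [eq_div_iff h1.ne']; linarith [(h k).2]
    have h4 := hb k
    rw [vTerm_zero_one, h2, h3]
    field_simp
    ring
  rw [MemV, funext hterm]
  refine Summable.mul_left _ ?_
  refine Summable.of_nonneg_of_le (fun k => by positivity)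
    (f := fun k => 4 * (1 / (ω k + ω 0) ^ 2)) (fun k => ?_) ?_
  · have h0 := hω.pos 0
    have hk := hω.pos k
    have hle := hω.strictMono.monotone (Nat.zero_le k)
    rw [mul_one_div, div_le_div_iff₀ (by positivity) (by positivity)]
    nlinarith
  · refine Summable.mul_left _ (summable_of_sum_le (c := K) (fun k => by positivity) fun s => ?_)
    -- Sums `ω j + ω 0` are the gaps between the modes `ω j` and the mode `-ω 0`.
    refine le_trans (le_of_eq ?_) (hK (Sum.inl 0) (s.map Function.Embedding.inr))
    rw [Finset.sum_map]
    refine Finset.sum_congr rfl fun j _ => ?_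
    simp [modeFreq]

theorem MemV.sub {x y : H} (hx : MemV ω b 0 1 x) (hy : MemV ω b 0 1 y) :
    MemV ω b 0 1 (x - y) := by
  refine Summable.of_nonneg_of_le (fun k => ?_) (fun k => ?_)
    ((Summable.mul_left 2 hx).add (Summable.mul_left 2 hy))
  · rw [vTerm_zero_one]; positivity
  · rw [vTerm_zero_one, vTerm_zero_one, vTerm_zero_one, sub_fst_apply, sub_snd_apply,
      ← mul_div_assoc, ← mul_div_assoc, ← add_div]
    refine div_le_div_of_nonneg_right ?_ (by positivity)
    nlinarith [sq_nonneg (x.fst k + y.fst k), sq_nonneg (x.snd k + y.snd k)]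

/-- The factor `2` counts the two modes of each oscillator: the halves in the mode and in the
coefficient cancel. -/
theorem sum_norm_sq_modes_div_le (hb : CondA1 b) {y : H} (hy : MemV ω b 0 1 y)
    (s : Finset (ℕ ⊕ ℕ)) :
    ∑ n ∈ s, ‖modes y n / modeCoeff b n‖ ^ 2 ≤ 2 * normV ω b 0 1 y ^ 2 := by
  have hterm : ∀ (z : ℂ) (k : ℕ), ‖z‖ ^ 2 = (y.fst k ^ 2 + y.snd k ^ 2) / 2 →
      ‖z / ((b k / Real.sqrt 2 : ℝ) : ℂ)‖ ^ 2 = vTerm ω b 0 1 y k := by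
    intro z k hz
    have h4 := hb k
    rw [vTerm_zero_one, norm_div, div_pow, hz, Complex.norm_real, Real.norm_eq_abs, sq_abs, div_pow,
      Real.sq_sqrt (by norm_num)]
    field_simp
  have h1 : HasSum ((fun n => ‖modes y n / modeCoeff b n‖ ^ 2) ∘ Sum.inl)
      (normV ω b 0 1 y ^ 2) := by
    have e : ((fun n => ‖modes y n / modeCoeff b n‖ ^ 2) ∘ Sum.inl) = vTerm ω b 0 1 y :=
      funext fun k => hterm _ k (norm_sq_modes_inl y k)
    rw [normV_sq, e]
    exact hy.hasSum
  have h2 : HasSum ((fun n => ‖modes y n / modeCoeff b n‖ ^ 2) ∘ Sum.inr)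
      (normV ω b 0 1 y ^ 2) := by
    have e : ((fun n => ‖modes y n / modeCoeff b n‖ ^ 2) ∘ Sum.inr) = vTerm ω b 0 1 y :=
      funext fun k => hterm _ k (norm_sq_modes_inr y k)
    rw [normV_sq, e]
    exact hy.hasSum
  rw [two_mul]
  exact sum_le_hasSum s (fun _ _ => by positivity) (h1.sum h2)

theorem norm_sq_toComplex (a : Ell2 ℝ) : ‖toComplex a‖ ^ 2 = ‖a‖ ^ 2 := by
  have h1 := lp.norm_rpow_eq_tsum (p := 2) (by norm_num) (toComplex a)
  have h2 := lp.norm_rpow_eq_tsum (p := 2) (by norm_num) a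
  simp only [ENNReal.toReal_ofNat, Real.rpow_two] at h1 h2
  rw [h1, h2]
  exact tsum_congr fun k => by simp [toComplex]

theorem norm_sq_discrepancy (x Λ : ℝ → H) (xhat Lhat : H) (t : ℝ) :
    ‖discrepancy x Λ xhat Lhat t‖ ^ 2 = ‖x t - xhat‖ ^ 2 + ‖Λ t - Lhat‖ ^ 2 := by
  rw [PiLp.norm_sq_eq_of_L2, WithLp.prod_norm_sq_eq_of_L2, WithLp.prod_norm_sq_eq_of_L2,
    Fin.sum_univ_four]
  simp only [discrepancy, Matrix.cons_val]
  rw [norm_sq_toComplex, norm_sq_toComplex, norm_sq_toComplex, norm_sq_toComplex]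
  ring

end WeightedNorm

end OscTurnpike

/-! ### The turnpike estimate. -/

theorem mainTheorem7 (ω : ℕ → ℝ) (b : OscTurnpike.Ell2 ℝ)
    (hA1 : OscTurnpike.CondA1 b) (hA2 : OscTurnpike.CondA2 ω) (hA3 : OscTurnpike.CondA3 ω) :
    ∃ C : ℝ, 0 < C ∧
      ∀ (T : ℝ), 0 < T →
      ∀ (x0 xbar : OscTurnpike.H) (ubar : ℝ), OscTurnpike.MemV ω b 0 1 x0 →
      ∀ (xhat Lhat : OscTurnpike.H) (uhat : ℝ),
        OscTurnpike.IsStaticSolution ω b xbar ubar xhat Lhat uhat →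
      ∀ (x Λ : ℝ → OscTurnpike.H) (u : ℝ → ℝ),
        OscTurnpike.IsDynamicSolution ω b T x0 xbar ubar x Λ u →
        ‖OscTurnpike.discrepancy x Λ xhat Lhat 0‖ + ‖OscTurnpike.discrepancy x Λ xhat Lhat T‖ ≤
          C * (OscTurnpike.normV ω b 0 1 (x 0 - xhat) + ‖Lhat.fst‖ + ‖Lhat.snd‖) := by
  open OscTurnpike in
  obtain ⟨K, hK0, hK⟩ := exists_sum_modeFreq_le hA2 hA3
  have hβ : ∀ n, modeCoeff b n ≠ 0 := by
    have h2 : Real.sqrt 2 ≠ 0 := by positivity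
    rintro (k | k) <;> exact div_ne_zero (hA1 k) h2
  have hA := sum_modeCoeff_sq_le b
  obtain ⟨C, hC0, hC⟩ := exists_modal_bound hA hK hK0 hA2.modeFreq_injective hβ
  -- The summands pay for `x 0 - x̂` (`‖b‖ ^ 2`), for `Λ 0 - Λ̂` and `x T - x̂` (`C`), and for `Λ T
  -- - Λ̂ = -Λ̂` (`1`); the factor `2` comes from `D ≤ 2 * R ^ 2`.
  set E := Real.sqrt (2 * (‖b‖ ^ 2 + C + 1)) with hE
  have hEpos : 0 < E := Real.sqrt_pos.2 (by positivity)
  have hEsq : E ^ 2 = 2 * (‖b‖ ^ 2 + C + 1) := Real.sq_sqrt (by positivity)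
  refine ⟨2 * E, by positivity, ?_⟩
  intro T hT x0 xbar ubar hx0 xhat Lhat uhat hst x Λ u hs
  have hmem : MemV ω b 0 1 (x 0 - xhat) := by
    rw [hs.admissible.init]
    exact hx0.sub (hst.feasible.memV hA2 hA3 hA1)
  set V := normV ω b 0 1 (x 0 - xhat) with hV
  have hV0 : 0 ≤ V := Real.sqrt_nonneg _
  set D := 2 * V ^ 2 + ‖Lhat‖ ^ 2 with hD
  have hD0 : 0 ≤ D := by positivity
  have hqT : ‖Λ T - Lhat‖ ^ 2 = ‖Lhat‖ ^ 2 := by rw [hs.terminal, zero_sub, norm_neg]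
  have hp : ∀ s : Finset (ℕ ⊕ ℕ), ∑ n ∈ s, ‖modes (x 0 - xhat) n / modeCoeff b n‖ ^ 2 ≤ D :=
    fun s => (sum_norm_sq_modes_div_le hA1 hmem s).trans (by rw [hD]; linarith [sq_nonneg ‖Lhat‖])
  have hq : ∀ s : Finset (ℕ ⊕ ℕ), ∑ n ∈ s, ‖modes (Λ T - Lhat) n‖ ^ 2 ≤ D := fun s =>
    (sum_norm_sq_modes_le _ s).trans (by rw [hqT, hD]; linarith [sq_nonneg V])
  have hmain := hC T hT _ _ _ _ (modalSystem_discrepancy hs hst) D hp hq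
  have hq0 : ‖Λ 0 - Lhat‖ ^ 2 ≤ C * D := norm_sq_le_of_sum_modes_le fun s => (hmain s).1
  have hpT : ‖x T - xhat‖ ^ 2 ≤ C * D := norm_sq_le_of_sum_modes_le fun s => (hmain s).2
  have hp0 : ‖x 0 - xhat‖ ^ 2 ≤ ‖b‖ ^ 2 * D :=
    norm_sq_le_of_sum_modes_le (sum_norm_sq_le_of_div hA hβ hp)
  set R := V + ‖Lhat.fst‖ + ‖Lhat.snd‖ with hR
  have hR0 : 0 ≤ R := by positivity
  have hDR : D ≤ 2 * R ^ 2 := by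
    rw [hD, hR, WithLp.prod_norm_sq_eq_of_L2]
    have h1 := norm_nonneg Lhat.fst
    have h2 := norm_nonneg Lhat.snd
    nlinarith [mul_nonneg hV0 h1, mul_nonneg hV0 h2, mul_nonneg h1 h2, sq_nonneg ‖Lhat.fst‖,
      sq_nonneg ‖Lhat.snd‖]
  have hfin : ∀ z : ℝ, z ^ 2 ≤ (‖b‖ ^ 2 + C + 1) * D → z ≤ E * R := by
    intro z hz
    refine le_of_sq_le_sq ?_ (by positivity)
    rw [mul_pow, hEsq]
    have := mul_le_mul_of_nonneg_left hDR (show 0 ≤ ‖b‖ ^ 2 + C + 1 by positivity)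
    linarith
  have hb0 : 0 ≤ ‖b‖ ^ 2 * D := by positivity
  have h0 := hfin ‖discrepancy x Λ xhat Lhat 0‖ (by
    rw [norm_sq_discrepancy]
    linarith)
  have h1 := hfin ‖discrepancy x Λ xhat Lhat T‖ (by
    rw [norm_sq_discrepancy, hqT]
    have : ‖Lhat‖ ^ 2 ≤ D := by rw [hD]; linarith [sq_nonneg V]
    linarith)
  linarith
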